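/- Let $\mathcal C_F$ be a plane branch, $F\in\mathbb C\{x\}[y]$ irreducible and monic of degree $n=v_0$ in $y$, with primitive Puiseux parameterization $\varphi(t)=(t^{n},\sum_{k\ge\beta_1}c_kt^k)$, where $\beta_1>n$ is the smallest exponent with $c_k\neq0$ and $n\nmid\beta_1$. Let $e_0=\beta_0=n$, $\beta_{l}=\min\{k:\ e_{l-1}\nmid k,\ c_k\ne0\}$ and $e_{l}=\gcd(e_{l-1},\beta_{l})$ for $1\le l\le g$, where $e_g=1$ and $e_{g-1}>1$ if $g\geq 1$, and put $\beta_{g+1}=\infty$. Let $v_0=n$, $v_1=\beta_1$ and $v_l=\frac{e_{l-2}}{e_{l-1}}v_{l-1}+\beta_l-\beta_{l-1}$ for $2\le l\le g$ be the minimal generators of the value semigroup of $\mathcal C_F$, and for $G\in\mathbb C\{x,y\}$ let $I(F,G)=\operatorname{ord}_tG(\varphi(t))\in\mathbb N\cup\{\infty\}$ be the intersection multiplicity. Let $F_0=x$ and, for $1\le l\le g+1$, let $F_l\in\mathbb C\{x\}[y]$ be the minimal polynomial over $\mathbb C((x))$ of $\eta_l(x^{e_{l-1}/n})$, where $\eta_l(t)=\sum_{\beta_1\le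 k<\beta_l}c_kt^{k/e_{l-1}}$ (the canonical system of semiroots, $F_{g+1}=F$). For $0\le i<j\le g$ put $\omega_{ij}=v_iF_i\,dF_j-v_jF_j\,dF_i$. Let $T_1,\dots,T_g$ be the triple points (vertices with exactly three neighbours) of the dual graph of the canonical (minimal embedded) resolution of $\mathcal C_F$, whose vertices are the components of the exceptional divisor and the strict transform of $\mathcal C_F$; they are numbered in the order in which the corresponding components appear in the resolution process. A foliation is called dicritical at $T_j$ if the component of the exceptional divisor corresponding to $T_j$ is generically transversal to the strict transform of the foliation. Let $0\le i<j\le g$ and let $H_1,H_2\in\mathbb C\{x\}[y]$ with $\deg_yH_l<\deg_yF_{j+1}=v_0/e_j$ for $l=1,2$, $H_1\neq0$ and $H_2\in\langle x,y\rangle$. Assume that $\omega=H_1\omega_{ij}+dH_2$ defines a singular holomorphic foliation $\mathcal F_\omega$ of $(\mathbb C^2,0)$, that is, that its two coefficients vanish at the origin and are coprime in $\mathbb C\{x,y\}$. Then $\mathcal F_\omega$ is dicritical at $T_j$ if and only if $$I(F,H_1)+v_i+v_j<I(F,H_2).$$ Moreover, in that case there are rational functions $s_l\in\mathbb C(u)$,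 $l>\beta_j/e_j$, without poles in $\mathbb C^*$, such that for every $u\in\mathbb C^*$ the second coordinate of $$\psi_u(t)=\Big(t^{\beta_0/e_j},\ \sum_{\beta_1\le l<\beta_j}c_lt^{l/e_j}+u\,t^{\beta_j/e_j}+\sum_{l>\beta_j/e_j}s_l(u)\,t^{l}\Big)$$ is a convergent power series and $\psi_u$ parameterizes a separatrix of $\mathcal F_\omega$, i.e. $\psi_u^*(\omega)=0$. -/

import Mathlib

open PowerSeries in
/-- A univariate power series that converges absolutely near the origin: an element of `ℂ{t}`. -/
def IsConvergent (f : PowerSeries ℂ) : Prop :=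
  ∃ r : ℝ, 0 < r ∧ Summable fun k : ℕ => ‖coeff k f‖ * r ^ k

/-- A power series in two variables that converges absolutely near the origin: an element of
`ℂ{x,y}` (`x` is the variable `0`, `y` is the variable `1`). -/
def IsConvergent₂ (f : MvPowerSeries (Fin 2) ℂ) : Prop :=
  ∃ r : ℝ, 0 < r ∧ Summable fun m : Fin 2 →₀ ℕ => ‖MvPowerSeries.coeff m f‖ * r ^ (m 0 + m 1)

/-- A polynomial `H ∈ ℂ⟦x⟧[y]` that lies in `ℂ{x}[y]`. -/
def IsConvergentPoly (H : Polynomial (PowerSeries ℂ)) : Prop :=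
  ∀ i : ℕ, IsConvergent (H.coeff i)

/-- The inclusion of `ℂ⟦x⟧[y]` into `ℂ⟦x,y⟧`. -/
noncomputable def toSeries (H : Polynomial (PowerSeries ℂ)) : MvPowerSeries (Fin 2) ℂ :=
  fun m => PowerSeries.coeff (m 0) (H.coeff (m 1))

/-- `G(x(t), y(t))`, for series `x(t), y(t)` without constant term. -/
noncomputable def evalArc (x y : PowerSeries ℂ) (G : MvPowerSeries (Fin 2) ℂ) : PowerSeries ℂ :=
  MvPowerSeries.subst (![x, y] : Fin 2 → PowerSeries ℂ) G

/-! ### Differential 1-forms -/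

/-- The 1-form `ω 0 dx + ω 1 dy`. -/
abbrev OneForm : Type := Fin 2 → MvPowerSeries (Fin 2) ℂ

/-- The differential `df = f_x dx + f_y dy`. -/
noncomputable def differential (f : MvPowerSeries (Fin 2) ℂ) : OneForm :=
  fun i => MvPowerSeries.pderiv ℂ i f

/-- The pull-back `σ^* ω` under `(x, y) ↦ (σ 0 (x, y), σ 1 (x, y))`, `σ` without constant terms. -/
noncomputable def OneForm.pullback (σ : Fin 2 → MvPowerSeries (Fin 2) ℂ) (ω : OneForm) : OneForm :=
  fun i => ∑ l : Fin 2, MvPowerSeries.subst σ (ω l) * MvPowerSeries.pderiv ℂ i (σ l)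

/-- The coefficient of `dt` in the pull-back of `ω` under `t ↦ (x(t), y(t))`, that is
`A(x(t), y(t)) x'(t) + B(x(t), y(t)) y'(t)` for `ω = A dx + B dy`. -/
noncomputable def OneForm.pullArc (x y : PowerSeries ℂ) (ω : OneForm) : PowerSeries ℂ :=
  evalArc x y (ω 0) * PowerSeries.derivative ℂ x + evalArc x y (ω 1) * PowerSeries.derivative ℂ y

/-- `ω = A dx + B dy` (with `A, B ∈ ℂ{x,y}`) defines a singular foliation:
`A(0,0) = B(0,0) = 0` and `gcd(A, B) = 1` in `ℂ{x,y}`. -/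
def OneForm.DefinesSingularFoliation (ω : OneForm) : Prop :=
  (∀ i, MvPowerSeries.constantCoeff (ω i) = 0) ∧
  ∀ f a b : MvPowerSeries (Fin 2) ℂ, IsConvergent₂ f → IsConvergent₂ a → IsConvergent₂ b →
    ω 0 = f * a → ω 1 = f * b → IsUnit f

/-- The branch parameterized by the (non-constant, convergent) arc `(x(t), y(t))` is a separatrix
(an invariant curve) of the foliation `ω = 0`. -/
def OneForm.IsSeparatrix (ω : OneForm) (x y : PowerSeries ℂ) : Prop :=
  IsConvergent x ∧ IsConvergent y ∧ PowerSeries.constantCoeff x = 0 ∧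
  PowerSeries.constantCoeff y = 0 ∧ (x ≠ 0 ∨ y ≠ 0) ∧ ω.pullArc x y = 0

/-- The line `X i = 0` is generically transversal to the foliation `ω = 0`: after division of `ω`
by the largest possible power of `X i`, the restriction of the form to this line is not
identically zero. -/
def OneForm.GenericallyTransversal (ω : OneForm) (i : Fin 2) : Prop :=
  ∃ (m : ℕ) (ω' : OneForm), ω = (MvPowerSeries.X i : MvPowerSeries (Fin 2) ℂ) ^ m • ω' ∧
    ¬ (MvPowerSeries.X i : MvPowerSeries (Fin 2) ℂ) ∣ ω' (1 - i)

/-! ### Plane branches and their characteristic data -/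

/-- A plane branch `F = 0` with tangent cone `y = 0`, where `F ∈ ℂ{x}[y]` is irreducible and monic
of degree `n`, together with a primitive Puiseux parameterization
`φ(t) = (t ^ n, η(t))`, `η = ∑_{k ≥ β₁} c_k t ^ k`, `n < β₁`, `n ∤ β₁`. -/
structure PlaneBranch where
  n : ℕ
  F : Polynomial (PowerSeries ℂ)
  η : PowerSeries ℂ
  n_ne_zero : n ≠ 0
  convergent_F : IsConvergentPoly F
  monic_F : F.Monic
  natDegree_F : F.natDegree = n
  irreducible_F : Irreducible F
  convergent_η : IsConvergent η
  /-- All exponents of `η` are larger than `n`. -/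
  exponent_gt : ∀ k, PowerSeries.coeff k η ≠ 0 → n < k
  /-- The smallest exponent of `η` is not divisible by `n`. -/
  first_exponent : ∀ k, PowerSeries.coeff k η ≠ 0 → ∃ l ≤ k, PowerSeries.coeff l η ≠ 0 ∧ ¬ n ∣ l
  /-- The parameterization is primitive. -/
  primitive : ∀ d, d ∣ n → (∀ k, PowerSeries.coeff k η ≠ 0 → d ∣ k) → d = 1
  /-- `F(t ^ n, η(t)) = 0`. -/
  root : evalArc (PowerSeries.X ^ n) η (toSeries F) = 0

namespace PlaneBranch

/-- The coefficients `c_k` of `η`. -/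
noncomputable def c (C : PlaneBranch) (k : ℕ) : ℂ := PowerSeries.coeff k C.η

/-- The pair `(e_i, β_i)`: `e_0 = β_0 = n`, `β_{i+1} = min {k : e_i ∤ k, c_k ≠ 0}`,
`e_{i+1} = gcd (e_i, β_{i+1})`. Only the values for `i ≤ g` matter. -/
noncomputable def eβ (C : PlaneBranch) : ℕ → ℕ × ℕ
  | 0 => (C.n, C.n)
  | i + 1 =>
    (Nat.gcd (C.eβ i).1 (sInf {k | ¬ (C.eβ i).1 ∣ k ∧ C.c k ≠ 0}),
      sInf {k | ¬ (C.eβ i).1 ∣ k ∧ C.c k ≠ 0})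

noncomputable def e (C : PlaneBranch) (i : ℕ) : ℕ := (C.eβ i).1

/-- The characteristic exponents. -/
noncomputable def β (C : PlaneBranch) (i : ℕ) : ℕ := (C.eβ i).2

/-- The number `g` of characteristic exponents different from `β_0`: the first index with
`e_g = 1`. -/
noncomputable def g (C : PlaneBranch) : ℕ := sInf {i | C.e i = 1}

/-- The minimal generators of the value semigroup: `v_0 = n`, `v_1 = β_1` and
`v_i = n_{i-1} v_{i-1} + β_i - β_{i-1}` for `i ≥ 2`, where `n_i = e_{i-1} / e_i`. -/
noncomputable def v (C : PlaneBranch) : ℕ → ℕ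
  | 0 => C.n
  | 1 => C.β 1
  | i + 2 => C.e i / C.e (i + 1) * C.v (i + 1) + C.β (i + 2) - C.β (i + 1)

/-- The intersection multiplicity `I(F, G) = ord_t G(φ(t))`. -/
noncomputable def inter (C : PlaneBranch) (G : Polynomial (PowerSeries ℂ)) : ℕ∞ :=
  (evalArc (PowerSeries.X ^ C.n) C.η (toSeries G)).order

theorem e_dvd (C : PlaneBranch) (i : ℕ) : C.e i ∣ C.n := by
  induction i with
  | zero => exact dvd_rfl
  | succ i ih => exact (Nat.gcd_dvd_left _ _).trans ih

theorem n_div_e_ne_zero (C : PlaneBranch) (i : ℕ) : C.n / C.e i ≠ 0 := by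
  have h := C.e_dvd i
  have hn := C.n_ne_zero
  exact (Nat.div_pos (Nat.le_of_dvd (Nat.pos_of_ne_zero hn) h)
    (Nat.pos_of_dvd_of_pos h (Nat.pos_of_ne_zero hn))).ne'

end PlaneBranch

/-- The minimal polynomial over `ℂ⟦x⟧` of the Puiseux series `ξ(x^{1/m})`: the one of
`ξ(t) ∈ ℂ⟦t⟧`, where `ℂ⟦x⟧` is embedded into `ℂ⟦t⟧` by `x = t ^ m`. -/
noncomputable def puiseuxMinpoly (m : ℕ) (hm : m ≠ 0) (ξ : PowerSeries ℂ) :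
    Polynomial (PowerSeries ℂ) :=
  @minpoly (PowerSeries ℂ) (PowerSeries ℂ) _ _ (PowerSeries.expand m hm).toRingHom.toAlgebra ξ

namespace PlaneBranch

/-- The truncation `η_{i+1}(t) = ∑_{β_1 ≤ k < β_{i+1}} c_k t ^ (k / e_i)`, with the convention
`β_{g+1} = ∞`. -/
noncomputable def truncation (C : PlaneBranch) (i : ℕ) : PowerSeries ℂ :=
  open Classical in
  PowerSeries.mk fun k => if C.e i * k < C.β (i + 1) ∨ C.g ≤ i then C.c (C.e i * k) else 0

/-- The canonical system of semiroots `F_0 = x, F_1, …, F_g, F_{g+1} = F`: for `i ≥ 1`, `F_i` is the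
minimal polynomial of `η_i(x^{e_{i-1}/n})`. -/
noncomputable def semiroot (C : PlaneBranch) : ℕ → Polynomial (PowerSeries ℂ)
  | 0 => Polynomial.C PowerSeries.X
  | i + 1 => puiseuxMinpoly (C.n / C.e i) (C.n_div_e_ne_zero i) (C.truncation i)

/-- The 1-form `ω_{ij} = v_i F_i dF_j - v_j F_j dF_i`. -/
noncomputable def omega (C : PlaneBranch) (i j : ℕ) : OneForm :=
  (C.v i * toSeries (C.semiroot i) : MvPowerSeries (Fin 2) ℂ) •
      differential (toSeries (C.semiroot j)) -
    (C.v j * toSeries (C.semiroot j) : MvPowerSeries (Fin 2) ℂ) •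
      differential (toSeries (C.semiroot i))

end PlaneBranch

/-! ### Infinitely near points and the canonical resolution

The `k`-th blow-up has center `O_k`, the point of the strict transform of the branch after `k`
blow-ups, and creates the component `E_{k+1}` of the exceptional divisor. Near `O_k` local
coordinates `(x, y)` centered at `O_k` are used in which every component of the exceptional divisor
through `O_k` is one of the two axes. -/

/-- An infinitely near point of a branch, in local coordinates `(x, y)` centered at it. -/
structure NearPoint where
  /-- A parameterization `(x(t), y(t))` of the strict transform of the branch. -/
  x : PowerSeries ℂ
  y : PowerSeries ℂ
  /-- `some a` if `x = 0` is the component `E_a` of the exceptional divisor, `none` if `x = 0` is not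
  contained in the exceptional divisor. -/
  onX : Option ℕ
  /-- The same for `y = 0`. -/
  onY : Option ℕ

/-- The quotient `p / q`, for `q ≠ 0` and `ord q ≤ ord p`. -/
noncomputable def seriesQuot (p q : PowerSeries ℂ) : PowerSeries ℂ :=
  PowerSeries.X ^ (p.order.toNat - q.order.toNat) * p.divXPowOrder * (q.divXPowOrder)⁻¹

namespace NearPoint

/-- The value at `t = 0` of `y(t) / x(t)`, if `ord x ≤ ord y`: the slope of the tangent. -/
noncomputable def slope (P : NearPoint) : ℂ := PowerSeries.constantCoeff (seriesQuot P.y P.x)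

/-- The blow-up of `P`, in local coordinates centered at the point of the strict transform of the
branch: `(x, y) ↦ (x, x (y + slope))` if the tangent of the branch is not `x = 0`, and
`(x, y) ↦ (x y, y)` otherwise. -/
noncomputable def chart (P : NearPoint) : Fin 2 → MvPowerSeries (Fin 2) ℂ :=
  open Classical in
  if P.x.order ≤ P.y.order then
    ![MvPowerSeries.X 0, MvPowerSeries.X 0 * (MvPowerSeries.X 1 + MvPowerSeries.C P.slope)]
  else ![MvPowerSeries.X 0 * MvPowerSeries.X 1, MvPowerSeries.X 1]

/-- The point of the strict transform of the branch on the component `E_a` created by the blow-up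
of `P`. -/
noncomputable def blowUp (P : NearPoint) (a : ℕ) : NearPoint :=
  open Classical in
  if P.x.order ≤ P.y.order then
    { x := P.x
      y := seriesQuot P.y P.x - PowerSeries.C P.slope
      onX := some a
      onY := if P.slope = 0 then P.onY else none }
  else
    { x := seriesQuot P.x P.y
      y := P.y
      onX := P.onX
      onY := some a }

/-- The component `E_a` passes through `P`. -/
def Through (P : NearPoint) (a : ℕ) : Prop := P.onX = some a ∨ P.onY = some a

/-- At `P` the strict transform of the branch is smooth and the total transform (the strict
transform together with the exceptional divisor) has a normal crossing. -/
def Resolved (P : NearPoint) : Prop :=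
  min P.x.order P.y.order = 1 ∧ (P.onX = none ∨ P.onY = none) ∧
  (P.onX ≠ none → P.x.order = 1) ∧ (P.onY ≠ none → P.y.order = 1)

end NearPoint

namespace PlaneBranch

/-- The infinitely near point `O_k` of the branch. -/
noncomputable def point (C : PlaneBranch) : ℕ → NearPoint
  | 0 => { x := PowerSeries.X ^ C.n, y := C.η, onX := none, onY := none }
  | k + 1 => (C.point k).blowUp (k + 1)

/-- The number of blow-ups of the canonical (minimal embedded) resolution of the branch. -/
noncomputable def resolutionLength (C : PlaneBranch) : ℕ := sInf {k | (C.point k).Resolved}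

/-- The dual graph `G(C)` of the canonical resolution. The vertex `a`, for `1 ≤ a ≤ N` with `N` the
number of blow-ups, is the component `E_a`, and the vertex `0` is the strict transform of the
branch; other natural numbers are isolated. Two vertices are joined if the corresponding curves
meet: `E_a` and `E_b` with `a < b` meet when `E_b` is created if `E_a` passes through `O_{b-1}`, and
they get separated if later their common point is the center of a blow-up. -/
def dualGraph (C : PlaneBranch) : SimpleGraph ℕ :=
  SimpleGraph.fromRel fun a b =>
    (1 ≤ a ∧ a < b ∧ b ≤ C.resolutionLength ∧ (C.point (b - 1)).Through a ∧
      ∀ k, b ≤ k → k < C.resolutionLength →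
        ¬ ((C.point k).Through a ∧ (C.point k).Through b)) ∨
    (a = 0 ∧ 1 ≤ b ∧ b ≤ C.resolutionLength ∧ (C.point C.resolutionLength).Through b)

/-- The `j`-th triple point `T_j` (`j ≥ 1`) of the dual graph, in the order of appearance in the
resolution process: the `j`-th vertex with exactly three neighbours. -/
noncomputable def triplePoint (C : PlaneBranch) (j : ℕ) : ℕ :=
  open Classical in Nat.nth (fun a => (C.dualGraph.neighborSet a).ncard = 3) (j - 1)

/-- The pull-back of `ω` under the composition of the first `k` blow-ups, near `O_k`. -/
noncomputable def totalPullback (C : PlaneBranch) (ω : OneForm) : ℕ → OneForm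
  | 0 => ω
  | k + 1 => (C.totalPullback ω k).pullback (C.point k).chart

/-- The foliation `ω = 0` is dicritical in the component `E_a` (`a ≥ 1`): `E_a` is generically
transversal to the strict transform of the foliation. As `E_a` is irreducible, this is checked
near the point `O_a` of `E_a`. -/
def IsDicriticalAt (C : PlaneBranch) (ω : OneForm) (a : ℕ) : Prop :=
  ((C.point a).onX = some a ∧ (C.totalPullback ω a).GenericallyTransversal 0) ∨
  ((C.point a).onY = some a ∧ (C.totalPullback ω a).GenericallyTransversal 1)

/-- The second coordinate of the parameterization
`ψ_u(t) = (t^{β_0/e_j}, ∑_{β_1 ≤ l < β_j} c_l t^{l/e_j} + u t^{β_j/e_j} + ∑_{l > β_j/e_j} s_l(u) t^l)`. -/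
noncomputable def sepFamily (C : PlaneBranch) (j : ℕ) (s : ℕ → RatFunc ℂ) (u : ℂ) : PowerSeries ℂ :=
  open Classical in
  PowerSeries.mk fun l =>
    if C.e j * l < C.β j then C.c (C.e j * l)
    else if C.e j * l = C.β j then u
    else (s l).eval (RingHom.id ℂ) u

end PlaneBranch

/-!
Fix `j ≥ 1` and consider the family of arcs
`Φ_j(T, w) = (T ^ (n / e_j), head_j(T) + T ^ (β_j / e_j) w)`, where `head_j` collects the terms of
`η` below `β_j`. It contains the branch: `φ(t) = Φ_j(t ^ e_j, w(t))` with `w(0) = c_{β_j} ≠ 0`.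
Both assertions are read off from the pull-back `Φ_j^* ω`.

**Leading forms.** A nonzero `H` of degree less than `n / e_j` in `y` satisfies
`Φ_j^* H = κ T ^ N w ^ m + (higher powers of T)` (`exists_leadsWith`), so `I(F, H) = e_j N`. This
is proved by induction on `j`, by expanding `H` in powers of a semiroot. The leading form of a
semiroot comes from the factorization of its image in `ℂ⟦t⟧[y]` over the roots of unity
(`leadsWith_semiroot`), and no two terms of the expansion have the same power of `T`, because
`v_{i+1} / e_{i+1}` is prime to `e_i / e_{i+1}`. For `i < j` the leading form of `F_i` is
`κ_i T ^ (v_i / e_j)`, and that of `F_j` is `κ_j T ^ (v_j / e_j) w`. In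
`v_i F_i dF_j - v_j F_j dF_i` the logarithmic terms `dT / T` cancel, so `Φ_j^*(H₁ ω_{ij})` is
`T ^ M` times a form whose coefficient of `dw` is a unit at the points `(0, w)`, `w ≠ 0`, where
`e_j M = I(F, H₁) + v_i + v_j`. As `H₂` has a leading form as well, `Φ_j^* dH₂` is divisible by
`T ^ M` with the coefficient of `dw` divisible by `T ^ (M + 1)` if `I(F, H₂) > e_j M`
(`pull_famMap_of_lt`), whereas otherwise its coefficient of `dT` dominates (`pull_famMap_of_le`).
In the first case the line `T = 0` is generically transversal to the foliation, in the second case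
it is invariant.

**The triple point.** The resolution process is followed in coordinates. The first component has
the curvettes `Φ_0 = (T, T w)`. From a component whose curvettes are the members of `Φ_j` on, the
centers of the blow-ups are first free points and then satellite points, according to a Euclidean
algorithm on `(e_j / e_{j+1}, (β_{j+1} - β_j) / e_{j+1})`; at its end the members of `Φ_{j+1}` are
curvettes of the new component, that is, `Φ_{j+1}` factors through a chart that maps the line
`T = 0` onto this component (`exists_free_of_free`, `exists_free_of_satellite`,
`CurvettesAt.exists_succ`). Such a chart respects generic transversality (`PreservesLine`). On the
side of the dual graph, a component has three neighbours if and only if it is created from a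
satellite point and the following point is free (`ncard_neighborSet_eq_three_iff`), and this
happens once in each round. Hence the component found after `j` rounds is that of `T_j`
(`exists_curvettesAt_triplePoint`), which gives the criterion (`isDicriticalAt_triplePoint_iff`).

**The separatrices.** If the inequality holds, then `Φ_j^* ω = T ^ M (A dT + B dZ)` with
`Z = w - u` and `B(0, 0)` a unit, and the separatrix with parameter `u` is the solution `z(T)`,
`z(0) = 0`, of `A(T, z) + B(T, z) z' = 0`. The computation makes sense over the Laurent
polynomials `ℂ[u, u⁻¹]`, where `u` is invertible; the coefficients of the formal solution over
this ring are the rational functions `s_l` (`exists_formal_separatrices`). For each `u ∈ ℂ*` the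
specialized solution converges, by a majorization of its truncations in a weighted `ℓ¹`-norm
(`isConvergent_of_formal_solution`).
-/

/-! ### Substitution into power series and the chain rule -/

namespace MvPowerSeries

variable {σ τ R S : Type*} [CommRing R] [CommRing S] [Algebra R S]

theorem natCast_le_order_subst [Finite σ] {a : σ → MvPowerSeries τ S}
    (ha : ∀ l, constantCoeff (a l) = 0) {f : MvPowerSeries σ R} {N : ℕ} (hf : (N : ℕ∞) ≤ f.order) :
    (N : ℕ∞) ≤ (subst a f).order := by
  refine le_trans ?_ (le_order_subst (hasSubst_of_constantCoeff_zero ha) f)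
  calc (N : ℕ∞) ≤ 1 * f.order := by simpa using hf
    _ ≤ _ := by
      gcongr
      exact le_iInf fun i => one_le_order_iff_constCoeff_eq_zero.2 (ha i)

theorem natCast_le_order_pderiv {f : MvPowerSeries σ R} {N : ℕ} (hf : ((N + 1 : ℕ) : ℕ∞) ≤ f.order)
    (i : σ) : (N : ℕ∞) ≤ (pderiv R i f).order := by
  refine le_order fun d hd => ?_
  rw [coeff_pderiv, coeff_of_lt_order, zero_mul]
  refine lt_of_lt_of_le ?_ hf
  rw [map_add, Finsupp.degree_single]
  exact_mod_cast Nat.add_lt_add_right (by exact_mod_cast hd) 1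

theorem pderiv_subst_coe [Fintype σ] (a : σ → MvPowerSeries τ S)
    (p : MvPolynomial σ R) (i : τ) :
    pderiv S i (subst a (p : MvPowerSeries σ R)) =
      ∑ l, subst a (pderiv R l (p : MvPowerSeries σ R)) * pderiv S i (a l) := by
  classical
  simp only [pderiv_coe, subst_coe]
  induction p using MvPolynomial.induction_on with
  | C r =>
    simp [algebraMap_apply]
  | add p q hp hq => simp only [map_add, add_mul, Finset.sum_add_distrib, hp, hq]
  | mul_X p k hp =>
    simp only [map_mul, Derivation.leibniz, hp, MvPolynomial.aeval_X, smul_eq_mul, map_add,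
      add_mul, Finset.sum_add_distrib, Finset.mul_sum, MvPolynomial.pderiv_X]
    congr 1
    · rw [Finset.sum_eq_single k]
      · simp
      · intro l _ hl
        simp [hl.symm]
      · simp
    · exact Finset.sum_congr rfl fun l _ => by ring

/-- The chain rule for the substitution of power series without constant terms. -/
theorem pderiv_subst [Fintype σ] [Finite τ] {a : σ → MvPowerSeries τ S}
    (ha : ∀ l, constantCoeff (a l) = 0) (f : MvPowerSeries σ R) (i : τ) :
    pderiv S i (subst a f) = ∑ l, subst a (pderiv R l f) * pderiv S i (a l) := by
  classical
  have hs : HasSubst a := hasSubst_of_constantCoeff_zero ha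
  ext n
  set N := Finsupp.degree n + 2 with hN
  -- Terms of `f` of degree at least `N` do not affect the coefficient of `n`.
  set q : MvPowerSeries σ R := ((truncTotal N f : MvPolynomial σ R) : MvPowerSeries σ R) with hq
  have hh : ((N : ℕ) : ℕ∞) ≤ (f - q).order := by
    refine le_order fun d hd => ?_
    rw [map_sub, hq, MvPolynomial.coeff_coe, coeff_truncTotal f (by exact_mod_cast hd), sub_self]
  have key : ∀ g : MvPowerSeries σ R, g = q + (f - q) → pderiv S i (subst a g) -
      (∑ l, subst a (pderiv R l g) * pderiv S i (a l)) = pderiv S i (subst a (f - q)) -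
      (∑ l, subst a (pderiv R l (f - q)) * pderiv S i (a l)) := by
    rintro g rfl
    have := pderiv_subst_coe a (truncTotal N f : MvPolynomial σ R) i
    rw [← hq] at this
    rw [subst_add hs]
    simp only [map_add, subst_add hs, add_mul, Finset.sum_add_distrib, this]
    ring
  have h0 := congrArg (coeff n) (key f (by ring))
  rw [map_sub, map_sub, map_sum (coeff n)
    (fun l => subst a (pderiv R l (f - q)) * pderiv S i (a l))] at h0
  rw [← sub_eq_zero, h0]
  have hlt : ((Finsupp.degree n : ℕ) : ℕ∞) < ((Finsupp.degree n + 1 : ℕ) : ℕ∞) := by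
    exact_mod_cast Nat.lt_succ_self _
  rw [coeff_of_lt_order (lt_of_lt_of_le hlt
    (natCast_le_order_pderiv (natCast_le_order_subst ha hh) i)), Finset.sum_eq_zero, sub_zero]
  intro l _
  refine coeff_of_lt_order (lt_of_lt_of_le hlt (le_trans ?_ le_order_mul))
  exact le_add_right (natCast_le_order_subst ha (natCast_le_order_pderiv hh l))

theorem constantCoeff_subst_of_constantCoeff_zero [Finite σ] {a : σ → MvPowerSeries τ S}
    (ha : ∀ l, constantCoeff (a l) = 0) (f : MvPowerSeries σ S) :
    constantCoeff (subst a f) = constantCoeff f := by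
  have hs := hasSubst_of_constantCoeff_zero ha
  have h : constantCoeff (subst a (f - C (constantCoeff f))) = 0 :=
    constantCoeff_subst_eq_zero hs ha (by simp)
  rwa [subst_sub hs, map_sub, subst_C, constantCoeff_C, sub_eq_zero] at h

end MvPowerSeries

theorem toSeries_add (G H : Polynomial (PowerSeries ℂ)) :
    toSeries (G + H) = toSeries G + toSeries H := by
  ext m
  have h : ∀ K : Polynomial (PowerSeries ℂ), MvPowerSeries.coeff m (toSeries K) =
      PowerSeries.coeff (m 0) (K.coeff (m 1)) := fun _ => rfl
  rw [map_add, h, h, h, Polynomial.coeff_add, map_add]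

theorem toSeries_monomial (i : ℕ) (h : PowerSeries ℂ) :
    toSeries (Polynomial.monomial i h) =
      PowerSeries.subst (MvPowerSeries.X 0 : MvPowerSeries (Fin 2) ℂ) h *
        MvPowerSeries.X 1 ^ i := by
  classical
  ext m
  have h1 : MvPowerSeries.coeff m (toSeries (Polynomial.monomial i h)) =
      PowerSeries.coeff (m 0) ((Polynomial.monomial i h).coeff (m 1)) := rfl
  rw [h1, MvPowerSeries.X_pow_eq, MvPowerSeries.coeff_mul_monomial, PowerSeries.coeff_subst_single,
    Polynomial.coeff_monomial]
  have hle : Finsupp.single (1 : Fin 2) i ≤ m ↔ i ≤ m 1 := by simp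
  have heq : m - Finsupp.single 1 i = Finsupp.single 0 ((m - Finsupp.single 1 i : Fin 2 →₀ ℕ) 0) ↔
      m 1 ≤ i := by
    rw [Finsupp.ext_iff, Fin.forall_fin_two]
    simp [tsub_eq_zero_iff_le]
  simp only [hle, heq]
  by_cases him : i = m 1
  · simp [him]
  · rcases lt_or_gt_of_ne him with h | h
    · simp [him, h.le, h.not_ge]
    · simp [him, h.not_ge]

/-- Substitution into `H ∈ ℂ⟦x⟧[y]` is evaluation of the polynomial `H`. -/
theorem subst_toSeries {τ S : Type*} [CommRing S] [Algebra ℂ S] [Finite τ]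
    {a : Fin 2 → MvPowerSeries τ S} (ha : ∀ l, MvPowerSeries.constantCoeff (a l) = 0)
    (ε : PowerSeries ℂ →+* MvPowerSeries τ S) (hε : ∀ f, ε f = PowerSeries.subst (a 0) f)
    (H : Polynomial (PowerSeries ℂ)) :
    MvPowerSeries.subst a (toSeries H) = H.eval₂ ε (a 1) := by
  have hs : MvPowerSeries.HasSubst a := MvPowerSeries.hasSubst_of_constantCoeff_zero ha
  induction H using Polynomial.induction_on' with
  | add p q hp hq => rw [toSeries_add, MvPowerSeries.subst_add hs, hp, hq, Polynomial.eval₂_add]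
  | monomial n h =>
    rw [toSeries_monomial, MvPowerSeries.subst_mul hs, MvPowerSeries.subst_pow hs,
      MvPowerSeries.subst_X hs, Polynomial.eval₂_monomial, hε, PowerSeries.subst,
      MvPowerSeries.subst_comp_subst_apply _ hs]
    · simp only [MvPowerSeries.subst_X hs]
      rfl
    · exact (PowerSeries.HasSubst.X (0 : Fin 2)).const

/-! ### Pull-back of 1-forms -/

/-- The pull-back of a 1-form under a substitution with coefficients in a `ℂ`-algebra `S` and any
number of variables. -/
noncomputable def OneForm.pull {τ S : Type*} [CommRing S] [Algebra ℂ S]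
    (a : Fin 2 → MvPowerSeries τ S) (ω : OneForm) : τ → MvPowerSeries τ S :=
  fun i => ∑ l, MvPowerSeries.subst a (ω l) * MvPowerSeries.pderiv S i (a l)

theorem OneForm.pullback_eq_pull (a : Fin 2 → MvPowerSeries (Fin 2) ℂ) (ω : OneForm) :
    ω.pullback a = ω.pull a := rfl

theorem OneForm.pullArc_eq_pull (x y : PowerSeries ℂ) (ω : OneForm) :
    ω.pullArc x y = ω.pull (τ := Unit) ![x, y] () := by
  simp only [OneForm.pull, Fin.sum_univ_two]
  rfl

theorem OneForm.pull_comp {τ υ S S' : Type*} [CommRing S] [Algebra ℂ S] [CommRing S']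
    [Algebra ℂ S'] [Algebra S S'] [IsScalarTower ℂ S S'] [Fintype τ] [Finite υ]
    {a : Fin 2 → MvPowerSeries τ S} {b : τ → MvPowerSeries υ S'}
    (ha : ∀ l, MvPowerSeries.constantCoeff (a l) = 0)
    (hb : ∀ l, MvPowerSeries.constantCoeff (b l) = 0) (ω : OneForm) (i : υ) :
    ω.pull (fun l => MvPowerSeries.subst b (a l)) i =
      ∑ k, MvPowerSeries.subst b (ω.pull a k) * MvPowerSeries.pderiv S' i (b k) := by
  have hs := MvPowerSeries.hasSubst_of_constantCoeff_zero hb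
  have hsum : ∀ k, MvPowerSeries.subst b (ω.pull a k) = ∑ l,
      MvPowerSeries.subst b (MvPowerSeries.subst a (ω l)) *
        MvPowerSeries.subst b (MvPowerSeries.pderiv S k (a l)) := fun k => by
    simp only [OneForm.pull, ← MvPowerSeries.coe_substAlgHom hs, map_sum, map_mul]
  simp only [hsum, Finset.sum_mul]
  rw [Finset.sum_comm]
  simp only [OneForm.pull, MvPowerSeries.pderiv_subst hb, Finset.mul_sum, mul_assoc,
    MvPowerSeries.subst_comp_subst_apply (MvPowerSeries.hasSubst_of_constantCoeff_zero ha) hs]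

theorem OneForm.pullback_pullback {a b : Fin 2 → MvPowerSeries (Fin 2) ℂ}
    (ha : ∀ l, MvPowerSeries.constantCoeff (a l) = 0)
    (hb : ∀ l, MvPowerSeries.constantCoeff (b l) = 0) (ω : OneForm) :
    (ω.pullback a).pullback b = ω.pullback (fun l => MvPowerSeries.subst b (a l)) := by
  funext i
  exact (OneForm.pull_comp ha hb ω i).symm

theorem OneForm.pull_add {τ S : Type*} [CommRing S] [Algebra ℂ S] [Finite τ]
    {a : Fin 2 → MvPowerSeries τ S} (ha : ∀ l, MvPowerSeries.constantCoeff (a l) = 0)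
    (ω ω' : OneForm) (i : τ) : (ω + ω').pull a i = ω.pull a i + ω'.pull a i := by
  simp only [OneForm.pull, Pi.add_apply, MvPowerSeries.subst_add
    (MvPowerSeries.hasSubst_of_constantCoeff_zero ha), add_mul, Finset.sum_add_distrib]

theorem OneForm.pull_smul {τ S : Type*} [CommRing S] [Algebra ℂ S] [Finite τ]
    {a : Fin 2 → MvPowerSeries τ S} (ha : ∀ l, MvPowerSeries.constantCoeff (a l) = 0)
    (f : MvPowerSeries (Fin 2) ℂ) (ω : OneForm) (i : τ) :
    (f • ω).pull a i = MvPowerSeries.subst a f * ω.pull a i := by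
  simp only [OneForm.pull, Pi.smul_apply, smul_eq_mul, MvPowerSeries.subst_mul
    (MvPowerSeries.hasSubst_of_constantCoeff_zero ha), mul_assoc, Finset.mul_sum]

theorem OneForm.pull_differential {τ S : Type*} [CommRing S] [Algebra ℂ S] [Finite τ]
    {a : Fin 2 → MvPowerSeries τ S} (ha : ∀ l, MvPowerSeries.constantCoeff (a l) = 0)
    (f : MvPowerSeries (Fin 2) ℂ) (i : τ) :
    (differential f).pull a i = MvPowerSeries.pderiv S i (MvPowerSeries.subst a f) :=
  (MvPowerSeries.pderiv_subst ha f i).symm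

/-! ### Characteristic exponents and semigroup generators -/

namespace PlaneBranch

variable (C : PlaneBranch)

theorem e_zero : C.e 0 = C.n := rfl

theorem β_zero : C.β 0 = C.n := rfl

theorem e_succ (i : ℕ) : C.e (i + 1) = Nat.gcd (C.e i) (C.β (i + 1)) := rfl

theorem n_pos : 0 < C.n := Nat.pos_of_ne_zero C.n_ne_zero

theorem e_pos (i : ℕ) : 0 < C.e i := Nat.pos_of_dvd_of_pos (C.e_dvd i) C.n_pos

theorem e_succ_dvd (i : ℕ) : C.e (i + 1) ∣ C.e i := Nat.gcd_dvd_left _ _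

theorem e_dvd_of_le {i j : ℕ} (h : i ≤ j) : C.e j ∣ C.e i := by
  induction j, h using Nat.le_induction with
  | base => exact dvd_rfl
  | succ j _ ih => exact (C.e_succ_dvd j).trans ih

theorem e_dvd_β (i : ℕ) : C.e i ∣ C.β i := by
  cases i with
  | zero => exact dvd_rfl
  | succ i => exact Nat.gcd_dvd_right _ _

theorem e_dvd_β_of_le {i j : ℕ} (h : i ≤ j) : C.e j ∣ C.β i := (C.e_dvd_of_le h).trans (C.e_dvd_β i)

theorem exists_not_dvd {i : ℕ} (hi : C.e i ≠ 1) : ∃ k, ¬ C.e i ∣ k ∧ C.c k ≠ 0 := by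
  by_contra! h
  refine hi (C.primitive _ (C.e_dvd i) fun k hk => ?_)
  by_contra hd
  exact hk (h k hd)

theorem β_succ_spec {i : ℕ} (hi : C.e i ≠ 1) :
    ¬ C.e i ∣ C.β (i + 1) ∧ C.c (C.β (i + 1)) ≠ 0 :=
  Nat.sInf_mem (s := {k | ¬ C.e i ∣ k ∧ C.c k ≠ 0}) (C.exists_not_dvd hi)

theorem e_succ_lt {i : ℕ} (hi : C.e i ≠ 1) : C.e (i + 1) < C.e i := by
  refine lt_of_le_of_ne (Nat.le_of_dvd (C.e_pos i) (C.e_succ_dvd i)) fun h => ?_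
  exact (C.β_succ_spec hi).1 (h ▸ C.e_dvd_β (i + 1))

theorem exists_e_eq_one : ∃ i, C.e i = 1 := by
  by_contra! h
  have : ∀ i, C.e i + i ≤ C.n := fun i => by
    induction i with
    | zero => simp [e_zero]
    | succ i ih => have := C.e_succ_lt (h i); omega
  have h1 := this (C.n + 1)
  omega

theorem e_g : C.e C.g = 1 := Nat.sInf_mem (s := {i | C.e i = 1}) C.exists_e_eq_one

theorem e_ne_one {i : ℕ} (hi : i < C.g) : C.e i ≠ 1 :=
  Nat.notMem_of_lt_sInf (s := {i | C.e i = 1}) hi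

theorem e_dvd_of_lt_β {i k : ℕ} (hk : k < C.β (i + 1)) (hc : C.c k ≠ 0) : C.e i ∣ k := by
  have := Nat.notMem_of_lt_sInf (s := {k | ¬ C.e i ∣ k ∧ C.c k ≠ 0}) hk
  by_contra h
  exact this ⟨h, hc⟩

theorem β_lt_succ {i : ℕ} (hi : i < C.g) : C.β i < C.β (i + 1) := by
  obtain ⟨h1, h2⟩ := C.β_succ_spec (C.e_ne_one hi)
  cases i with
  | zero => exact C.exponent_gt _ h2
  | succ i =>
    refine lt_of_le_of_ne (Nat.sInf_le ⟨fun h => h1 ((C.e_succ_dvd i).trans h), h2⟩) fun h => ?_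
    exact h1 (h ▸ C.e_dvd_β (i + 1))

theorem β_le_of_le {i j : ℕ} (hij : i ≤ j) (hj : j ≤ C.g) : C.β i ≤ C.β j := by
  induction j, hij using Nat.le_induction with
  | base => exact le_rfl
  | succ j _ ih => exact (ih (by omega)).trans (C.β_lt_succ (by omega)).le

theorem c_β_ne_zero {i : ℕ} (hi : i < C.g) : C.c (C.β (i + 1)) ≠ 0 :=
  (C.β_succ_spec (C.e_ne_one hi)).2

theorem c_n : C.c C.n = 0 := by
  by_contra h
  exact lt_irrefl _ (C.exponent_gt _ h)

theorem c_eq_zero_of_le_n {k : ℕ} (hk : k ≤ C.n) : C.c k = 0 := by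
  by_contra h
  exact absurd (C.exponent_gt _ h) (not_lt.2 hk)

theorem β_pos {i : ℕ} (hi : i ≤ C.g) : 0 < C.β i :=
  lt_of_lt_of_le C.n_pos (C.β_le_of_le (Nat.zero_le i) hi)

theorem v_succ_succ {i : ℕ} (hi : i + 1 < C.g) :
    C.v (i + 2) + C.β (i + 1) = C.e i / C.e (i + 1) * C.v (i + 1) + C.β (i + 2) := by
  have h : C.v (i + 2) = C.e i / C.e (i + 1) * C.v (i + 1) + C.β (i + 2) - C.β (i + 1) := rfl
  have : C.β (i + 1) < C.β (i + 2) := C.β_lt_succ hi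
  omega

theorem e_dvd_v {i : ℕ} (hi : i ≤ C.g) : C.e i ∣ C.v i := by
  induction i with
  | zero => exact dvd_rfl
  | succ i ih =>
    cases i with
    | zero => exact C.e_dvd_β 1
    | succ i =>
      have h := C.v_succ_succ (i := i) (by omega)
      have h1 := (C.e_succ_dvd (i + 1)).trans (ih (by omega))
      refine (Nat.dvd_add_left (C.e_dvd_β_of_le (show i + 1 ≤ i + 2 by omega))).1 ?_
      rw [h]
      exact dvd_add (h1.mul_left _) (C.e_dvd_β _)

theorem gcd_e_v {i : ℕ} (hi : i < C.g) : Nat.gcd (C.e i) (C.v (i + 1)) = C.e (i + 1) := by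
  cases i with
  | zero => rfl
  | succ i =>
    have h := C.v_succ_succ (i := i) (by omega)
    have h1 : C.e (i + 1) ∣ C.e i / C.e (i + 1) * C.v (i + 1) := (C.e_dvd_v (by omega)).mul_left _
    rw [C.e_succ (i + 1)]
    refine Nat.dvd_antisymm (Nat.dvd_gcd (Nat.gcd_dvd_left _ _) ?_)
      (Nat.dvd_gcd (Nat.gcd_dvd_left _ _) ?_)
    · refine (Nat.dvd_add_right ((Nat.gcd_dvd_left _ _).trans h1)).1 ?_
      rw [← h]
      exact dvd_add (Nat.gcd_dvd_right _ _) ((Nat.gcd_dvd_left _ _).trans (C.e_dvd_β _))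
    · refine (Nat.dvd_add_left ((Nat.gcd_dvd_left _ _).trans (C.e_dvd_β (i + 1)))).1 ?_
      rw [h]
      exact dvd_add ((Nat.gcd_dvd_left _ _).trans h1) (Nat.gcd_dvd_right _ _)

theorem coprime_v_div {i : ℕ} (hi : i < C.g) :
    Nat.Coprime (C.e i / C.e (i + 1)) (C.v (i + 1) / C.e (i + 1)) := by
  have := Nat.coprime_div_gcd_div_gcd (m := C.e i) (n := C.v (i + 1))
    (Nat.gcd_pos_of_pos_left _ (C.e_pos i))
  rwa [C.gcd_e_v hi] at this

theorem v_pos {i : ℕ} (hi : i ≤ C.g) : 0 < C.v i := by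
  cases i with
  | zero => exact C.n_pos
  | succ i =>
    cases i with
    | zero => exact C.β_pos hi
    | succ i =>
      have h := C.v_succ_succ (i := i) (by omega)
      have : C.β (i + 1) < C.β (i + 2) := C.β_lt_succ (by omega)
      change 0 < C.v (i + 2)
      omega

/-- The closed formula for the generators of the semigroup. -/
theorem e_mul_v {i : ℕ} (hi : i < C.g) : C.e i * C.v (i + 1) =
    C.e i * C.β (i + 1) + ∑ l ∈ Finset.range i, (C.e l - C.e (l + 1)) * C.β (l + 1) := by
  induction i with
  | zero => rfl
  | succ i ih =>
    have h := C.v_succ_succ (i := i) (by omega)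
    have h1 : C.e (i + 1) * (C.e i / C.e (i + 1)) = C.e i := Nat.mul_div_cancel' (C.e_succ_dvd i)
    have h2 := ih (by omega)
    have hle : C.e (i + 1) ≤ C.e i := Nat.le_of_dvd (C.e_pos i) (C.e_succ_dvd i)
    rw [Finset.sum_range_succ]
    obtain ⟨d, hd⟩ := Nat.exists_eq_add_of_le hle
    have h3 : C.e i - C.e (i + 1) = d := by omega
    rw [h3]
    have h4 : C.e (i + 1) * (C.v (i + 2) + C.β (i + 1)) =
        C.e i * C.v (i + 1) + C.e (i + 1) * C.β (i + 2) := by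
      rw [h, mul_add, ← mul_assoc, h1]
    rw [h2] at h4
    have h5 : C.e i * C.β (i + 1) = C.e (i + 1) * C.β (i + 1) + d * C.β (i + 1) := by
      rw [hd]; ring
    rw [h5] at h4
    have h6 : C.e (i + 1) * (C.v (i + 2) + C.β (i + 1)) =
      C.e (i + 1) * C.v (i + 2) + C.e (i + 1) * C.β (i + 1) := by ring
    have h7 : i + 1 + 1 = i + 2 := rfl
    rw [h7]
    omega

end PlaneBranch

/-! ### Semiroots as products over roots of unity -/

section PuiseuxMinpoly

open Polynomial

/-- The product of the linear factors `y - ξ(ζ t)` over the `m`-th roots of unity `ζ`. -/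
noncomputable def conjugateProduct (m : ℕ) (ξ : PowerSeries ℂ) : Polynomial (PowerSeries ℂ) :=
  ∏ ζ ∈ nthRootsFinset m (1 : ℂ), (X - Polynomial.C (PowerSeries.rescale ζ ξ))

theorem conjugateProduct_monic (m : ℕ) (ξ : PowerSeries ℂ) : (conjugateProduct m ξ).Monic :=
  monic_prod_of_monic _ _ fun _ _ => monic_X_sub_C _

theorem natDegree_conjugateProduct {m : ℕ} (hm : m ≠ 0) (ξ : PowerSeries ℂ) :
    (conjugateProduct m ξ).natDegree = m := by
  rw [conjugateProduct, natDegree_prod_of_monic _ _ fun _ _ => monic_X_sub_C _]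
  simp only [natDegree_X_sub_C, Finset.sum_const, smul_eq_mul, mul_one]
  exact (Complex.isPrimitiveRoot_exp m hm).card_nthRootsFinset

theorem conjugateProduct_map_rescale {m : ℕ} (hm : m ≠ 0) (ξ : PowerSeries ℂ) {z : ℂ}
    (hz : z ^ m = 1) : (conjugateProduct m ξ).map (PowerSeries.rescale z) =
      conjugateProduct m ξ := by
  have hz0 : z ≠ 0 := by
    rintro rfl
    simp [hm] at hz
  have hpos : 0 < m := Nat.pos_of_ne_zero hm
  simp only [conjugateProduct, Polynomial.map_prod, Polynomial.map_sub, map_X, map_C]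
  refine Finset.prod_bij' (fun ζ _ => z * ζ) (fun ζ _ => z⁻¹ * ζ) ?_ ?_ ?_ ?_ ?_
  · intro ζ hζ
    rw [mem_nthRootsFinset hpos] at hζ ⊢
    rw [mul_pow, hz, hζ, mul_one]
  · intro ζ hζ
    rw [mem_nthRootsFinset hpos] at hζ ⊢
    rw [mul_pow, inv_pow, hz, hζ, inv_one, mul_one]
  · intro ζ _
    field_simp
  · intro ζ _
    field_simp
  · intro ζ _
    rw [PowerSeries.rescale_rescale, mul_comm]

/-- A series in `t` that is invariant under all `t ↦ z t`, `z ^ m = 1`, is a series in `t ^ m`. -/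
theorem mem_range_expand {m : ℕ} (hm : m ≠ 0) {f : PowerSeries ℂ}
    (hf : ∀ z : ℂ, z ^ m = 1 → PowerSeries.rescale z f = f) :
    ∃ g, PowerSeries.expand m hm g = f := by
  refine ⟨PowerSeries.mk fun k => PowerSeries.coeff (m * k) f, ?_⟩
  ext k
  by_cases hk : m ∣ k
  · obtain ⟨l, rfl⟩ := hk
    rw [PowerSeries.coeff_expand_mul, PowerSeries.coeff_mk]
  · rw [PowerSeries.coeff_expand_of_not_dvd _ _ _ hk]
    have hp := Complex.isPrimitiveRoot_exp m hm
    have h1 := congrArg (PowerSeries.coeff k) (hf _ hp.pow_eq_one)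
    rw [PowerSeries.coeff_rescale] at h1
    by_contra h0
    exact hk (hp.dvd_of_pow_eq_one _ (mul_right_cancel₀ (Ne.symm h0) (by rw [h1, one_mul])))

theorem rescale_injOn {m : ℕ} (hm : m ≠ 0) {ξ : PowerSeries ℂ}
    (hξ : ∀ d, d ∣ m → (∀ k, PowerSeries.coeff k ξ ≠ 0 → d ∣ k) → d = 1) {z w : ℂ}
    (hz : z ^ m = 1) (hw : w ^ m = 1)
    (h : PowerSeries.rescale z ξ = PowerSeries.rescale w ξ) : z = w := by
  have hw0 : w ≠ 0 := by
    rintro rfl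
    simp [hm] at hw
  have h1 : orderOf (z / w) = 1 := by
    refine hξ _ (orderOf_dvd_of_pow_eq_one (by rw [div_pow, hz, hw, div_one])) fun k hk => ?_
    refine orderOf_dvd_of_pow_eq_one ?_
    have := congrArg (PowerSeries.coeff k) h
    rw [PowerSeries.coeff_rescale, PowerSeries.coeff_rescale] at this
    rw [div_pow, mul_right_cancel₀ hk this, div_self (pow_ne_zero _ hw0)]
  rw [orderOf_eq_one_iff] at h1
  field_simp at h1
  exact h1

/-- Over `ℂ⟦t⟧`, `x = t ^ m`, the minimal polynomial of a primitive Puiseux series splits into the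
linear factors given by the conjugates of the series. -/
theorem map_puiseuxMinpoly {m : ℕ} (hm : m ≠ 0) {ξ : PowerSeries ℂ}
    (hξ : ∀ d, d ∣ m → (∀ k, PowerSeries.coeff k ξ ≠ 0 → d ∣ k) → d = 1) :
    (puiseuxMinpoly m hm ξ).Monic ∧
    (puiseuxMinpoly m hm ξ).map (PowerSeries.expand m hm : PowerSeries ℂ →ₐ[ℂ] _).toRingHom =
      conjugateProduct m ξ := by
  set E : PowerSeries ℂ →+* PowerSeries ℂ :=
    (PowerSeries.expand m hm : PowerSeries ℂ →ₐ[ℂ] PowerSeries ℂ).toRingHom with hE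
  have hpos : 0 < m := Nat.pos_of_ne_zero hm
  have hlift : conjugateProduct m ξ ∈ lifts E := by
    rw [lifts_iff_coeff_lifts]
    intro k
    obtain ⟨g, hg⟩ := mem_range_expand (f := (conjugateProduct m ξ).coeff k) hm fun z hz => by
      rw [← coeff_map, conjugateProduct_map_rescale hm ξ hz]
    exact ⟨g, hg⟩
  obtain ⟨Q, hQ, hQd, hQm⟩ := lifts_and_natDegree_eq_and_monic hlift (conjugateProduct_monic m ξ)
  let : Algebra (PowerSeries ℂ) (PowerSeries ℂ) := E.toAlgebra
  have hroot : Polynomial.aeval (R := PowerSeries ℂ) (A := PowerSeries ℂ) ξ Q = 0 := by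
    have h1 : Polynomial.aeval (R := PowerSeries ℂ) (A := PowerSeries ℂ) ξ Q =
      (Q.map E).eval ξ := by rw [aeval_def, eval_map]; rfl
    rw [h1, hQ, conjugateProduct, eval_prod]
    refine Finset.prod_eq_zero (i := 1) ?_ ?_
    · rw [mem_nthRootsFinset hpos, one_pow]
    · simp
  have hM : puiseuxMinpoly m hm ξ = minpoly (PowerSeries ℂ) ξ := rfl
  have hmonic : (minpoly (PowerSeries ℂ) ξ).Monic := minpoly.monic ⟨Q, hQm, hroot⟩
  have hdeg : (minpoly (PowerSeries ℂ) ξ).natDegree ≤ m := by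
    rw [← natDegree_conjugateProduct hm ξ, ← hQd]
    exact natDegree_le_natDegree (minpoly.min _ _ hQm hroot)
  have hmap : ((minpoly (PowerSeries ℂ) ξ).map E).Monic := hmonic.map E
  have hev : ((minpoly (PowerSeries ℂ) ξ).map E).eval ξ = 0 := by
    rw [eval_map]
    exact minpoly.aeval (PowerSeries ℂ) ξ
  refine ⟨hM ▸ hmonic, ?_⟩
  rw [hM]
  refine (eq_of_monic_of_dvd_of_natDegree_le (conjugateProduct_monic m ξ) hmap ?_ ?_)
  · have hprod : conjugateProduct m ξ =
        (((nthRootsFinset m (1 : ℂ)).val.map fun ζ => PowerSeries.rescale ζ ξ).map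
          fun a => X - Polynomial.C a).prod := by
      rw [Multiset.map_map]
      rfl
    rw [hprod, Multiset.prod_X_sub_C_dvd_iff_le_roots hmap.ne_zero, Multiset.le_iff_subset]
    · intro a ha
      obtain ⟨ζ, hζ, rfl⟩ := Multiset.mem_map.1 ha
      have hζ1 : ζ ^ m = 1 := (mem_nthRootsFinset hpos 1).1 hζ
      rw [mem_roots hmap.ne_zero, IsRoot]
      have hinv : (PowerSeries.rescale ζ).comp E = E := by
        ext f k
        simp only [RingHom.comp_apply, PowerSeries.coeff_rescale]
        by_cases hk : m ∣ k
        · obtain ⟨l, rfl⟩ := hk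
          rw [pow_mul, hζ1, one_pow, one_mul]
        · have : PowerSeries.coeff k (E f) = 0 := PowerSeries.coeff_expand_of_not_dvd _ _ _ hk
          rw [this, mul_zero]
      have h1 := hom_eval₂ (minpoly (PowerSeries ℂ) ξ) E (PowerSeries.rescale ζ) ξ
      rw [hinv] at h1
      rw [eval_map, ← h1, ← eval_map, hev, map_zero]
    · refine Multiset.Nodup.map_on ?_ (nthRootsFinset m (1 : ℂ)).nodup
      intro z hz w hw h
      exact rescale_injOn hm hξ ((mem_nthRootsFinset hpos 1).1 hz)
        ((mem_nthRootsFinset hpos 1).1 hw) h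
  · rw [natDegree_conjugateProduct hm, hmonic.natDegree_map]
    exact hdeg

theorem natDegree_puiseuxMinpoly {m : ℕ} (hm : m ≠ 0) {ξ : PowerSeries ℂ}
    (hξ : ∀ d, d ∣ m → (∀ k, PowerSeries.coeff k ξ ≠ 0 → d ∣ k) → d = 1) :
    (puiseuxMinpoly m hm ξ).natDegree = m := by
  obtain ⟨h1, h2⟩ := map_puiseuxMinpoly hm hξ
  rw [← h1.natDegree_map (PowerSeries.expand m hm : PowerSeries ℂ →ₐ[ℂ] _).toRingHom, h2,
    natDegree_conjugateProduct hm]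

/-- The minimal polynomial of a Puiseux polynomial has polynomial coefficients; in particular they
converge. -/
theorem puiseuxMinpoly_coeff_finite {m : ℕ} (hm : m ≠ 0) {ξ : Polynomial ℂ}
    (hξ : ∀ d, d ∣ m → (∀ k, PowerSeries.coeff k (ξ : PowerSeries ℂ) ≠ 0 → d ∣ k) → d = 1)
    (i : ℕ) :
    ∃ N, ∀ k, N ≤ k →
      PowerSeries.coeff k ((puiseuxMinpoly m hm (ξ : PowerSeries ℂ)).coeff i) = 0 := by
  have hl : conjugateProduct m (ξ : PowerSeries ℂ) ∈
      lifts (Polynomial.coeToPowerSeries.ringHom (R := ℂ)) := by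
    unfold conjugateProduct
    refine prod_mem fun ζ _ => ?_
    refine (liftsRing (Polynomial.coeToPowerSeries.ringHom (R := ℂ))).sub_mem ?_ ?_
    · exact X_mem_lifts _
    · refine C'_mem_lifts ⟨ξ.comp (Polynomial.C ζ * X), ?_⟩
      ext k
      rw [Polynomial.coeToPowerSeries.ringHom_apply, Polynomial.coeff_coe, comp_C_mul_X_coeff,
        PowerSeries.coeff_rescale, Polynomial.coeff_coe, mul_comm]
  rw [lifts_iff_coeff_lifts] at hl
  obtain ⟨q, hq⟩ := hl i
  refine ⟨q.natDegree + 1, fun k hk => ?_⟩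
  rw [← PowerSeries.coeff_expand_mul m hm]
  have h1 : PowerSeries.expand m hm ((puiseuxMinpoly m hm (ξ : PowerSeries ℂ)).coeff i) =
      (conjugateProduct m (ξ : PowerSeries ℂ)).coeff i := by
    rw [← (map_puiseuxMinpoly hm hξ).2, coeff_map]
    rfl
  rw [h1, ← hq, Polynomial.coeToPowerSeries.ringHom_apply, Polynomial.coeff_coe]
  refine coeff_eq_zero_of_natDegree_lt ?_
  have : 1 * k ≤ m * k := Nat.mul_le_mul_right k (Nat.pos_of_ne_zero hm)
  omega

end PuiseuxMinpoly

namespace PlaneBranch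

variable (C : PlaneBranch)

theorem coeff_truncation {i : ℕ} (hi : i < C.g) (k : ℕ) :
    PowerSeries.coeff k (C.truncation i) =
      if C.e i * k < C.β (i + 1) then C.c (C.e i * k) else 0 := by
  rw [truncation, PowerSeries.coeff_mk]
  simp [hi.not_ge]

theorem truncation_eq_coe {i : ℕ} (hi : i < C.g) :
    ∃ p : Polynomial ℂ, C.truncation i = p := by
  refine ⟨PowerSeries.trunc (C.β (i + 1)) (C.truncation i), ?_⟩
  ext k
  rw [Polynomial.coeff_coe, PowerSeries.coeff_trunc]
  split_ifs with h
  · rfl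
  · rw [C.coeff_truncation hi, if_neg]
    have := Nat.mul_le_mul_right k (C.e_pos i)
    omega

/-- The truncation below `β_{i+1}`, as a series in `t ^ (1 / e_i)`, is a primitive parameterization,
as its exponents include `β_1 / e_i, …, β_i / e_i`. -/
theorem truncation_primitive {i : ℕ} (hi : i < C.g) (d : ℕ) (hd : d ∣ C.n / C.e i)
    (h : ∀ k, PowerSeries.coeff k (C.truncation i) ≠ 0 → d ∣ k) : d = 1 := by
  have key : ∀ l ≤ i, C.e i * d ∣ C.e l := by
    intro l hl
    induction l with
    | zero =>
      obtain ⟨q, hq⟩ := C.e_dvd i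
      rw [hq, Nat.mul_div_cancel_left _ (C.e_pos i)] at hd
      rw [e_zero, hq]
      exact Nat.mul_dvd_mul_left _ hd
    | succ l ih =>
      rw [C.e_succ]
      refine Nat.dvd_gcd (ih (by omega)) ?_
      obtain ⟨q, hq⟩ := C.e_dvd_β_of_le hl
      rw [hq]
      refine Nat.mul_dvd_mul_left _ (h q ?_)
      rw [C.coeff_truncation hi, ← hq, if_pos]
      · exact C.c_β_ne_zero (by omega)
      · exact lt_of_le_of_lt (C.β_le_of_le hl hi.le) (C.β_lt_succ hi)
  have h1 := key i le_rfl
  have h2 : C.e i * d ∣ C.e i * 1 := by simpa using h1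
  exact Nat.dvd_one.1 (Nat.dvd_of_mul_dvd_mul_left (C.e_pos i) h2)

theorem semiroot_monic {i : ℕ} (hi : i < C.g) : (C.semiroot (i + 1)).Monic :=
  (map_puiseuxMinpoly _ (C.truncation_primitive hi)).1

theorem natDegree_semiroot {i : ℕ} (hi : i < C.g) :
    (C.semiroot (i + 1)).natDegree = C.n / C.e i :=
  natDegree_puiseuxMinpoly _ (C.truncation_primitive hi)

theorem map_semiroot {i : ℕ} (hi : i < C.g) :
    (C.semiroot (i + 1)).map
      (PowerSeries.expand (C.n / C.e i) (C.n_div_e_ne_zero i) : PowerSeries ℂ →ₐ[ℂ] _).toRingHom =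
      conjugateProduct (C.n / C.e i) (C.truncation i) :=
  (map_puiseuxMinpoly _ (C.truncation_primitive hi)).2

theorem semiroot_coeff_finite {i : ℕ} (hi : i < C.g) (l : ℕ) :
    ∃ N, ∀ k, N ≤ k → PowerSeries.coeff k ((C.semiroot (i + 1)).coeff l) = 0 := by
  obtain ⟨p, hp⟩ := C.truncation_eq_coe hi
  have := puiseuxMinpoly_coeff_finite (C.n_div_e_ne_zero i) (ξ := p)
    (by rw [← hp]; exact C.truncation_primitive hi) l
  rwa [← hp] at this

end PlaneBranch

/-! ### Leading forms along the parametrized families -/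

/-- `y = T ^ N (κ w ^ m + T r)` for some `r`, where `T` is the image of the variable of `ℂ⟦t⟧` under
`ε : ℂ⟦t⟧ → A`. -/
def LeadsWith {A : Type*} [CommRing A] (ε : PowerSeries ℂ →+* A) (w y : A) (N : ℕ) (κ : ℂ)
    (m : ℕ) : Prop :=
  ∃ r, y = ε PowerSeries.X ^ N * (ε (PowerSeries.C κ) * w ^ m + ε PowerSeries.X * r)

namespace LeadsWith

variable {A : Type*} [CommRing A] {ε : PowerSeries ℂ →+* A} {w y y' : A} {N N' : ℕ} {κ κ' : ℂ}
  {m m' : ℕ}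

theorem mul (h : LeadsWith ε w y N κ m) (h' : LeadsWith ε w y' N' κ' m') :
    LeadsWith ε w (y * y') (N + N') (κ * κ') (m + m') := by
  obtain ⟨r, rfl⟩ := h
  obtain ⟨r', rfl⟩ := h'
  refine ⟨ε (PowerSeries.C κ) * w ^ m * r' + r * (ε (PowerSeries.C κ') * w ^ m') +
    ε PowerSeries.X * r * r', ?_⟩
  rw [map_mul, map_mul]
  ring

theorem add_of_lt (h : LeadsWith ε w y N κ m) (h' : LeadsWith ε w y' N' κ' m') (hN : N < N') :
    LeadsWith ε w (y + y') N κ m := by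
  obtain ⟨r, rfl⟩ := h
  obtain ⟨r', rfl⟩ := h'
  obtain ⟨d, rfl⟩ := Nat.exists_eq_add_of_lt hN
  exact ⟨r + ε PowerSeries.X ^ d * (ε (PowerSeries.C κ') * w ^ m' + ε PowerSeries.X * r'), by ring⟩

theorem one : LeadsWith ε w 1 0 1 0 := ⟨0, by simp⟩

theorem prod {ι : Type*} {s : Finset ι} {f : ι → A} {K : ι → ℂ}
    (h : ∀ i ∈ s, LeadsWith ε w (f i) N (K i) 0) :
    LeadsWith ε w (∏ i ∈ s, f i) (s.card * N) (∏ i ∈ s, K i) 0 := by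
  classical
  induction s using Finset.induction_on with
  | empty => simpa using one
  | insert a s ha ih =>
    rw [Finset.prod_insert ha, Finset.prod_insert ha, Finset.card_insert_of_notMem ha]
    have := (h a (Finset.mem_insert_self _ _)).mul
      (ih fun i hi => h i (Finset.mem_insert_of_mem hi))
    convert this using 1
    ring

end LeadsWith

/-- The composition of `ε` with the substitution `t ↦ t ^ q`. -/
noncomputable def expandHom {A : Type*} [CommRing A] (ε : PowerSeries ℂ →+* A) (q : ℕ)
    (hq : q ≠ 0) : PowerSeries ℂ →+* A :=
  ε.comp (PowerSeries.expand q hq : PowerSeries ℂ →ₐ[ℂ] PowerSeries ℂ).toRingHom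

theorem expandHom_apply {A : Type*} [CommRing A] (ε : PowerSeries ℂ →+* A) (q : ℕ) (hq : q ≠ 0)
    (f : PowerSeries ℂ) : expandHom ε q hq f = ε (PowerSeries.expand q hq f) := rfl

theorem expandHom_expandHom {A : Type*} [CommRing A] (ε : PowerSeries ℂ →+* A) {q q' m : ℕ}
    (hq : q ≠ 0) (hq' : q' ≠ 0) (hm : m ≠ 0) (h : m = q * q') :
    expandHom (expandHom ε q hq) q' hq' = expandHom ε m hm := by
  subst h
  ext f
  rw [expandHom_apply, expandHom_apply, expandHom_apply, ← PowerSeries.expand_mul]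

namespace PlaneBranch

variable (C : PlaneBranch)

/-- The part of `η` of degree less than `β_j`, as a series in `t ^ (1 / e_j)`. -/
noncomputable def head (j : ℕ) : PowerSeries ℂ :=
  PowerSeries.mk fun k => if C.e j * k < C.β j then C.c (C.e j * k) else 0

/-- The second coordinate `head_j(T) + T ^ (β_j / e_j) w` of the `j`-th family of arcs, for
parameters `T = ε(t)` and `w` in a ring `A`. The first one is `T ^ (n / e_j)`. -/
noncomputable def famY (j : ℕ) {A : Type*} [CommRing A] (ε : PowerSeries ℂ →+* A) (w : A) : A :=
  ε (C.head j) + ε PowerSeries.X ^ (C.β j / C.e j) * w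

/-- The value of `H ∈ ℂ⟦x⟧[y]` along the `j`-th family of arcs. -/
noncomputable def famEval (j : ℕ) {A : Type*} [CommRing A] (ε : PowerSeries ℂ →+* A) (w : A)
    (H : Polynomial (PowerSeries ℂ)) : A :=
  H.eval₂ (expandHom ε (C.n / C.e j) (C.n_div_e_ne_zero j)) (C.famY j ε w)

theorem coeff_head (j k : ℕ) : PowerSeries.coeff k (C.head j) =
    if C.e j * k < C.β j then C.c (C.e j * k) else 0 := PowerSeries.coeff_mk _ _

theorem e_dvd_of_lt_β' {j k : ℕ} (hk : k < C.β j) (hc : C.c k ≠ 0) : C.e j ∣ k := by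
  cases j with
  | zero => exact absurd (C.c_eq_zero_of_le_n hk.le) hc
  | succ j => exact (C.e_succ_dvd j).trans (C.e_dvd_of_lt_β hk hc)

theorem head_zero : C.head 0 = 0 := by
  ext k
  rw [coeff_head]
  split_ifs with h
  · rw [C.c_eq_zero_of_le_n h.le, map_zero]
  · rw [map_zero]

theorem e_div_e_ne_zero {i j : ℕ} (hij : i ≤ j) : C.e i / C.e j ≠ 0 :=
  (Nat.div_pos (Nat.le_of_dvd (C.e_pos i) (C.e_dvd_of_le hij)) (C.e_pos j)).ne'

theorem e_mul_div {i j : ℕ} (hij : i ≤ j) : C.e j * (C.e i / C.e j) = C.e i :=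
  Nat.mul_div_cancel' (C.e_dvd_of_le hij)

theorem e_mul_β_div {i j : ℕ} (hij : i ≤ j) : C.e j * (C.β i / C.e j) = C.β i :=
  Nat.mul_div_cancel' (C.e_dvd_β_of_le hij)

theorem e_mul_n_div (j : ℕ) : C.e j * (C.n / C.e j) = C.n := Nat.mul_div_cancel' (C.e_dvd j)

theorem n_div_e_eq {i j : ℕ} (hij : i ≤ j) : C.n / C.e j = C.e i / C.e j * (C.n / C.e i) := by
  apply Nat.eq_of_mul_eq_mul_left (C.e_pos j)
  rw [← mul_assoc, C.e_mul_div hij, e_mul_n_div, e_mul_n_div]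

/-- The part of `head_j` of degree at least `β_i`, divided by the `β_i`-th power of the variable. -/
noncomputable def headTail (i j : ℕ) : PowerSeries ℂ :=
  PowerSeries.mk fun k => PowerSeries.coeff (k + C.β i / C.e j) (C.head j)

theorem head_eq {i j : ℕ} (hij : i < j) (hj : j ≤ C.g) : C.head j =
    PowerSeries.expand (C.e i / C.e j) (C.e_div_e_ne_zero hij.le) (C.head i) +
      PowerSeries.X ^ (C.β i / C.e j) * C.headTail i j := by
  have hb := C.e_mul_β_div hij.le
  have hq := C.e_mul_div hij.le
  have hlt : C.β i < C.β j :=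
    lt_of_lt_of_le (C.β_lt_succ (by omega)) (C.β_le_of_le (by omega) hj)
  ext k
  rw [map_add, PowerSeries.coeff_X_pow_mul']
  split_ifs with hk
  · have h1 : C.β i ≤ C.e j * k := hb ▸ Nat.mul_le_mul_left (C.e j) hk
    rw [headTail, PowerSeries.coeff_mk, Nat.sub_add_cancel hk]
    suffices h : PowerSeries.coeff k (PowerSeries.expand (C.e i / C.e j)
        (C.e_div_e_ne_zero hij.le) (C.head i)) = 0 by rw [h, zero_add]
    by_cases hd : C.e i / C.e j ∣ k
    · obtain ⟨l, rfl⟩ := hd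
      rw [PowerSeries.coeff_expand_mul, coeff_head, if_neg]
      rw [← mul_assoc, hq] at h1
      omega
    · exact PowerSeries.coeff_expand_of_not_dvd _ _ _ hd
  · have h1 : C.e j * k < C.β i := by
      rw [← hb]
      exact Nat.mul_lt_mul_of_pos_left (not_le.1 hk) (C.e_pos j)
    rw [add_zero, coeff_head, if_pos (h1.trans hlt)]
    by_cases hd : C.e i / C.e j ∣ k
    · obtain ⟨l, rfl⟩ := hd
      rw [← mul_assoc, hq] at h1 ⊢
      rw [PowerSeries.coeff_expand_mul, coeff_head, if_pos h1]
    · rw [PowerSeries.coeff_expand_of_not_dvd _ _ _ hd]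
      by_contra h
      have h2 := C.e_dvd_of_lt_β' h1 h
      rw [← hq] at h2
      exact hd (Nat.dvd_of_mul_dvd_mul_left (C.e_pos j) h2)

theorem constantCoeff_headTail {i j : ℕ} (hij : i < j) (hj : j ≤ C.g) :
    PowerSeries.constantCoeff (C.headTail i j) = C.c (C.β i) := by
  have hlt : C.β i < C.β j :=
    lt_of_lt_of_le (C.β_lt_succ (by omega)) (C.β_le_of_le (by omega) hj)
  rw [← PowerSeries.coeff_zero_eq_constantCoeff_apply, headTail, PowerSeries.coeff_mk, zero_add,
    coeff_head, C.e_mul_β_div hij.le, if_pos hlt]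

/-- The family of index `j` is a specialization of the family of index `i < j`. -/
theorem famY_eq {i j : ℕ} (hij : i < j) (hj : j ≤ C.g) {A : Type*} [CommRing A]
    (ε : PowerSeries ℂ →+* A) (w : A) :
    C.famY j ε w = C.famY i (expandHom ε (C.e i / C.e j) (C.e_div_e_ne_zero hij.le))
      (ε (C.headTail i j) + ε PowerSeries.X ^ (C.β j / C.e j - C.β i / C.e j) * w) := by
  have hb := C.e_mul_β_div hij.le
  have hb' := C.e_mul_β_div (le_refl j)
  have hlt : C.β i < C.β j :=
    lt_of_lt_of_le (C.β_lt_succ (by omega)) (C.β_le_of_le (by omega) hj)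
  have hle : C.β i / C.e j ≤ C.β j / C.e j := Nat.div_le_div_right hlt.le
  have hpow : C.e i / C.e j * (C.β i / C.e i) = C.β i / C.e j := by
    apply Nat.eq_of_mul_eq_mul_left (C.e_pos j)
    rw [← mul_assoc, C.e_mul_div hij.le, hb, C.e_mul_β_div le_rfl]
  rw [famY, famY, C.head_eq hij hj, map_add, map_mul, map_pow, expandHom_apply, expandHom_apply,
    PowerSeries.expand_X, map_pow, ← pow_mul, hpow]
  obtain ⟨d, hd⟩ := Nat.exists_eq_add_of_le hle
  rw [hd, Nat.add_sub_cancel_left]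
  ring

theorem famEval_eq {i j : ℕ} (hij : i < j) (hj : j ≤ C.g) {A : Type*} [CommRing A]
    (ε : PowerSeries ℂ →+* A) (w : A) (H : Polynomial (PowerSeries ℂ)) :
    C.famEval j ε w H = C.famEval i (expandHom ε (C.e i / C.e j) (C.e_div_e_ne_zero hij.le))
      (ε (C.headTail i j) + ε PowerSeries.X ^ (C.β j / C.e j - C.β i / C.e j) * w) H := by
  rw [famEval, famEval, C.famY_eq hij hj, expandHom_expandHom _ _ _ _ (C.n_div_e_eq hij.le)]

/-- Leading forms with respect to a family determine those with respect to later families. -/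
theorem leadsWith_famEval_of_lt {i j : ℕ} (hij : i < j) (hj : j ≤ C.g)
    {H : Polynomial (PowerSeries ℂ)} {N : ℕ} {κ : ℂ} {m : ℕ}
    (h : ∀ (A : Type) [CommRing A] (ε : PowerSeries ℂ →+* A) (w : A),
      LeadsWith ε w (C.famEval i ε w H) N κ m)
    (A : Type) [CommRing A] (ε : PowerSeries ℂ →+* A) (w : A) :
    LeadsWith ε w (C.famEval j ε w H) (C.e i / C.e j * N) (κ * C.c (C.β i) ^ m) 0 := by
  rw [C.famEval_eq hij hj]
  have hb := C.e_mul_β_div hij.le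
  have hb' := C.e_mul_β_div (le_refl j)
  have hlt : C.β i < C.β j :=
    lt_of_lt_of_le (C.β_lt_succ (by omega)) (C.β_le_of_le (by omega) hj)
  set w' := ε (C.headTail i j) + ε PowerSeries.X ^ (C.β j / C.e j - C.β i / C.e j) * w with hw'
  obtain ⟨r, hr⟩ := h A (expandHom ε (C.e i / C.e j) (C.e_div_e_ne_zero hij.le)) w'
  have hlt' : C.β i / C.e j < C.β j / C.e j := by
    by_contra hcon
    have := Nat.mul_le_mul_left (C.e j) (not_lt.1 hcon)
    omega
  have hd : ε PowerSeries.X ∣ w' - ε (PowerSeries.C (C.c (C.β i))) := by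
    have h1 : ε PowerSeries.X ∣ ε (C.headTail i j) - ε (PowerSeries.C (C.c (C.β i))) := by
      rw [← map_sub]
      refine map_dvd ε (PowerSeries.X_dvd_iff.2 ?_)
      rw [map_sub, C.constantCoeff_headTail hij hj, PowerSeries.constantCoeff_C, sub_self]
    have h2 : ε PowerSeries.X ∣ ε PowerSeries.X ^ (C.β j / C.e j - C.β i / C.e j) * w :=
      (dvd_pow_self _ (by omega)).mul_right _
    have := dvd_add h1 h2
    rwa [sub_add_eq_add_sub] at this
  obtain ⟨s, hs⟩ := hd.trans (sub_dvd_pow_sub_pow w' (ε (PowerSeries.C (C.c (C.β i)))) m)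
  obtain ⟨q, hq : C.e i / C.e j = q + 1⟩ :=
    Nat.exists_eq_succ_of_ne_zero (C.e_div_e_ne_zero hij.le)
  refine ⟨ε (PowerSeries.C κ) * s + ε PowerSeries.X ^ q * r, ?_⟩
  rw [hr, expandHom_apply, expandHom_apply, PowerSeries.expand_X, PowerSeries.expand_C,
    sub_eq_iff_eq_add.1 hs, map_mul, map_mul, map_pow, map_pow, map_pow, ← pow_mul, hq]
  ring

end PlaneBranch

/-! ### Leading forms of semiroots and of polynomials of small degree -/

namespace PlaneBranch

variable (C : PlaneBranch)

open Polynomial in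
theorem famEval_semiroot {i : ℕ} (hi : i < C.g) {A : Type*} [CommRing A]
    (ε : PowerSeries ℂ →+* A) (w : A) :
    C.famEval (i + 1) ε w (C.semiroot (i + 1)) =
      ∏ ζ ∈ nthRootsFinset (C.n / C.e i) (1 : ℂ),
        (ε (C.head (i + 1) - PowerSeries.expand (C.e i / C.e (i + 1))
          (C.e_div_e_ne_zero (Nat.le_succ i)) (PowerSeries.rescale ζ (C.truncation i))) +
          ε PowerSeries.X ^ (C.β (i + 1) / C.e (i + 1)) * w) := by
  have h1 := expandHom_expandHom ε (C.e_div_e_ne_zero (Nat.le_succ i)) (C.n_div_e_ne_zero i)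
    (C.n_div_e_ne_zero (i + 1)) (C.n_div_e_eq (Nat.le_succ i))
  rw [famEval, ← h1]
  conv_lhs => rw [expandHom, ← eval₂_map, C.map_semiroot hi]
  rw [conjugateProduct, eval₂_finsetProd]
  refine Finset.prod_congr rfl fun ζ _ => ?_
  rw [eval₂_sub, eval₂_X, eval₂_C, famY, expandHom_apply, map_sub]
  ring

theorem coeff_head_sub {i : ℕ} (hi : i < C.g) (ζ : ℂ) (k : ℕ) :
    PowerSeries.coeff k (C.head (i + 1) - PowerSeries.expand (C.e i / C.e (i + 1))
      (C.e_div_e_ne_zero (Nat.le_succ i)) (PowerSeries.rescale ζ (C.truncation i))) =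
    if C.e (i + 1) * k < C.β (i + 1) then
      C.c (C.e (i + 1) * k) * (1 - ζ ^ (C.e (i + 1) * k / C.e i)) else 0 := by
  have hq := C.e_mul_div (Nat.le_succ i)
  rw [map_sub, coeff_head]
  by_cases hd : C.e i / C.e (i + 1) ∣ k
  · obtain ⟨l, rfl⟩ := hd
    rw [PowerSeries.coeff_expand_mul, PowerSeries.coeff_rescale, C.coeff_truncation hi,
      ← mul_assoc, hq, Nat.mul_div_cancel_left _ (C.e_pos i)]
    split_ifs <;> ring
  · rw [PowerSeries.coeff_expand_of_not_dvd _ _ _ hd, sub_zero]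
    split_ifs with h
    · have : C.c (C.e (i + 1) * k) = 0 := by
        by_contra h0
        have h2 := C.e_dvd_of_lt_β h h0
        rw [← hq] at h2
        exact hd (Nat.dvd_of_mul_dvd_mul_left (C.e_pos _) h2)
      rw [this, zero_mul]
    · rfl

/-- A conjugate of the truncation differs from the family of arcs first at `β_{l+1}`, where `l` is
determined by the order of the root of unity. -/
theorem leadsWith_conjugate {i l : ℕ} (hi : i < C.g) (hl : l < i) {ζ : ℂ}
    (h1 : ζ ^ (C.e l / C.e i) = 1) (h2 : ζ ^ (C.e (l + 1) / C.e i) ≠ 1) :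
    ∃ κ : ℂ, κ ≠ 0 ∧ ∀ (A : Type) [CommRing A] (ε : PowerSeries ℂ →+* A) (w : A),
      LeadsWith ε w (ε (C.head (i + 1) - PowerSeries.expand (C.e i / C.e (i + 1))
          (C.e_div_e_ne_zero (Nat.le_succ i)) (PowerSeries.rescale ζ (C.truncation i))) +
          ε PowerSeries.X ^ (C.β (i + 1) / C.e (i + 1)) * w)
        (C.β (l + 1) / C.e (i + 1)) κ 0 := by
  have hβ : C.β (l + 1) < C.β (i + 1) :=
    lt_of_le_of_lt (C.β_le_of_le hl hi.le) (C.β_lt_succ hi)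
  have hb := C.e_mul_β_div (i := l + 1) (j := i + 1) (by omega)
  have hb' := C.e_mul_β_div (le_refl (i + 1))
  have hbi := C.e_mul_β_div (i := l + 1) (j := i) hl
  have hel := C.e_mul_div (i := l) (j := i) hl.le
  have hel' := C.e_mul_div (i := l + 1) (j := i) hl
  have hζ : ζ ^ (C.β (l + 1) / C.e i) ≠ 1 := by
    intro h
    have h3 := pow_gcd_eq_one.2 ⟨h1, h⟩
    rw [Nat.gcd_div (C.e_dvd_of_le hl.le) (C.e_dvd_β_of_le hl), ← C.e_succ] at h3
    exact h2 h3
  set D := C.head (i + 1) - PowerSeries.expand (C.e i / C.e (i + 1))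
          (C.e_div_e_ne_zero (Nat.le_succ i)) (PowerSeries.rescale ζ (C.truncation i)) with hD
  set b := C.β (l + 1) / C.e (i + 1) with hbdef
  have hX : PowerSeries.X ^ b ∣ D := by
    rw [PowerSeries.X_pow_dvd_iff]
    intro k hk
    rw [hD, C.coeff_head_sub hi]
    have hk' : C.e (i + 1) * k < C.β (l + 1) := by
      rw [← hb]
      exact Nat.mul_lt_mul_of_pos_left hk (C.e_pos _)
    rw [if_pos (hk'.trans hβ)]
    by_cases hc : C.c (C.e (i + 1) * k) = 0
    · rw [hc, zero_mul]
    · obtain ⟨s, hs⟩ := C.e_dvd_of_lt_β hk' hc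
      rw [hs, ← hel, mul_assoc, Nat.mul_div_cancel_left _ (C.e_pos i), pow_mul, h1, one_pow,
        sub_self, mul_zero]
  obtain ⟨E, hE⟩ := hX
  have hE0 : PowerSeries.constantCoeff E = C.c (C.β (l + 1)) * (1 - ζ ^ (C.β (l + 1) / C.e i)) := by
    have h3 := C.coeff_head_sub hi ζ b
    rw [← hD, hE, PowerSeries.coeff_X_pow_mul', if_pos le_rfl, Nat.sub_self,
      PowerSeries.coeff_zero_eq_constantCoeff_apply, hb, if_pos hβ] at h3
    exact h3
  refine ⟨PowerSeries.constantCoeff E, ?_, fun A _ ε w => ?_⟩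
  · rw [hE0]
    exact mul_ne_zero (C.c_β_ne_zero (by omega)) (sub_ne_zero.2 (Ne.symm hζ))
  · have hlt : b < C.β (i + 1) / C.e (i + 1) := by
      by_contra hcon
      have := Nat.mul_le_mul_left (C.e (i + 1)) (not_lt.1 hcon)
      omega
    obtain ⟨s, hs⟩ : PowerSeries.X ∣ E - PowerSeries.C (PowerSeries.constantCoeff E) := by
      rw [PowerSeries.X_dvd_iff, map_sub, PowerSeries.constantCoeff_C, sub_self]
    obtain ⟨d, hd⟩ := Nat.exists_eq_add_of_lt hlt
    refine ⟨ε s + ε PowerSeries.X ^ d * w, ?_⟩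
    have hE' : ε E = ε PowerSeries.X * ε s + ε (PowerSeries.C (PowerSeries.constantCoeff E)) := by
      rw [← map_mul, ← map_add, ← hs, sub_add_cancel]
    rw [hE, map_mul, map_pow, hE', hd]
    ring

open Polynomial in
/-- The semiroot `F_{i+1}` has leading form `κ T ^ (v_{i+1} / e_{i+1}) w` along the family of index
`i + 1`. -/
theorem leadsWith_semiroot {i : ℕ} (hi : i < C.g) :
    ∃ κ : ℂ, κ ≠ 0 ∧ ∀ (A : Type) [CommRing A] (ε : PowerSeries ℂ →+* A) (w : A),
      LeadsWith ε w (C.famEval (i + 1) ε w (C.semiroot (i + 1)))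
        (C.v (i + 1) / C.e (i + 1)) κ 1 := by
  have hb' := C.e_mul_β_div (le_refl (i + 1))
  -- The product over the `e_l / e_i`-th roots of unity, by descending induction on `l`.
  have key : ∀ d ≤ i, ∃ (κ : ℂ) (N : ℕ), κ ≠ 0 ∧ C.e i * (C.e (i + 1) * N) = C.e i * C.β (i + 1) +
      ∑ a ∈ Finset.Ico (i - d) i, (C.e a - C.e (a + 1)) * C.β (a + 1) ∧
      ∀ (A : Type) [CommRing A] (ε : PowerSeries ℂ →+* A) (w : A),
        LeadsWith ε w (∏ ζ ∈ nthRootsFinset (C.e (i - d) / C.e i) (1 : ℂ),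
        (ε (C.head (i + 1) - PowerSeries.expand (C.e i / C.e (i + 1))
          (C.e_div_e_ne_zero (Nat.le_succ i)) (PowerSeries.rescale ζ (C.truncation i))) +
          ε PowerSeries.X ^ (C.β (i + 1) / C.e (i + 1)) * w)) N κ 1 := by
    intro d hd
    induction d with
    | zero =>
      refine ⟨1, C.β (i + 1) / C.e (i + 1), one_ne_zero, by simp [hb'], fun A _ ε w => ?_⟩
      have h0 : C.head (i + 1) - PowerSeries.expand (C.e i / C.e (i + 1))
          (C.e_div_e_ne_zero (Nat.le_succ i)) (PowerSeries.rescale 1 (C.truncation i)) = 0 := by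
        ext k
        rw [C.coeff_head_sub hi, one_pow, sub_self, mul_zero, ite_self, map_zero]
      have h1 : nthRootsFinset (C.e (i - 0) / C.e i) (1 : ℂ) = {1} := by
        rw [Nat.sub_zero, Nat.div_self (C.e_pos i)]
        ext z
        rw [mem_nthRootsFinset Nat.one_pos]
        simp
      rw [h1, Finset.prod_singleton, h0, map_zero, zero_add]
      exact ⟨0, by simp⟩
    | succ d ih =>
      obtain ⟨κ, N, hκ, hN, hlead⟩ := ih (by omega)
      set l := i - (d + 1) with hl
      have hl1 : i - d = l + 1 := by omega
      rw [hl1] at hN hlead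
      have hli : l < i := by omega
      have hm : 0 < C.e l / C.e i := Nat.pos_of_ne_zero (C.e_div_e_ne_zero hli.le)
      have hm' : 0 < C.e (l + 1) / C.e i := Nat.pos_of_ne_zero (C.e_div_e_ne_zero hli)
      have hcard : ∀ m, 0 < m → (nthRootsFinset m (1 : ℂ)).card = m := fun m hm =>
        (Complex.isPrimitiveRoot_exp m hm.ne').card_nthRootsFinset
      have hel := C.e_mul_div (i := l) (j := i) hli.le
      have hel' := C.e_mul_div (i := l + 1) (j := i) hli
      have hsub : nthRootsFinset (C.e (l + 1) / C.e i) (1 : ℂ) ⊆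
          nthRootsFinset (C.e l / C.e i) (1 : ℂ) := by
        intro z hz
        rw [mem_nthRootsFinset hm'] at hz
        rw [mem_nthRootsFinset hm]
        obtain ⟨s, hs⟩ : C.e (l + 1) / C.e i ∣ C.e l / C.e i :=
          Nat.div_dvd_div (C.e_dvd_of_le hli) (C.e_succ_dvd l)
        rw [hs, pow_mul, hz, one_pow]
      have hex : ∀ ζ ∈ nthRootsFinset (C.e l / C.e i) (1 : ℂ) \
          nthRootsFinset (C.e (l + 1) / C.e i) (1 : ℂ), ∃ κ : ℂ, κ ≠ 0 ∧ _ := fun ζ hζ =>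
        C.leadsWith_conjugate hi hli ((mem_nthRootsFinset hm 1).1 (Finset.mem_sdiff.1 hζ).1)
          (fun h => (Finset.mem_sdiff.1 hζ).2 ((mem_nthRootsFinset hm' 1).2 h))
      choose! K hK0 hK using hex
      refine ⟨(∏ ζ ∈ nthRootsFinset (C.e l / C.e i) (1 : ℂ) \
          nthRootsFinset (C.e (l + 1) / C.e i) (1 : ℂ), K ζ) * κ,
        (nthRootsFinset (C.e l / C.e i) (1 : ℂ) \
          nthRootsFinset (C.e (l + 1) / C.e i) (1 : ℂ)).card *
          (C.β (l + 1) / C.e (i + 1)) + N, mul_ne_zero (Finset.prod_ne_zero_iff.2 hK0) hκ, ?_,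
        fun A _ ε w => ?_⟩
      · rw [Finset.card_sdiff_of_subset hsub, hcard _ hm, hcard _ hm',
          Finset.sum_eq_sum_Ico_succ_bot hli, mul_add, mul_add, hN]
        have hb := C.e_mul_β_div (i := l + 1) (j := i + 1) (by omega)
        have h3 : C.e i * (C.e (i + 1) * ((C.e l / C.e i - C.e (l + 1) / C.e i) *
            (C.β (l + 1) / C.e (i + 1)))) = (C.e l - C.e (l + 1)) * C.β (l + 1) := by
          calc _ = (C.e i * (C.e l / C.e i - C.e (l + 1) / C.e i)) *
              (C.e (i + 1) * (C.β (l + 1) / C.e (i + 1))) := by ring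
            _ = _ := by rw [hb, Nat.mul_sub, hel, hel']
        rw [h3]
        ring
      · rw [← Finset.prod_sdiff hsub]
        have h4 := (LeadsWith.prod fun ζ hζ => hK ζ hζ A ε w).mul (hlead A ε w)
        rwa [zero_add] at h4
  obtain ⟨κ, N, hκ, hN, hlead⟩ := key i le_rfl
  refine ⟨κ, hκ, fun A _ ε w => ?_⟩
  have hN' : N = C.v (i + 1) / C.e (i + 1) := by
    have h1 := C.e_mul_v hi
    rw [Nat.sub_self, ← Finset.range_eq_Ico, ← h1] at hN
    have h2 := Nat.eq_of_mul_eq_mul_left (C.e_pos i) hN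
    rw [← h2, Nat.mul_div_cancel_left _ (C.e_pos _)]
  have := hlead A ε w
  rw [Nat.sub_self, e_zero, hN'] at this
  rw [C.famEval_semiroot hi]
  exact this

end PlaneBranch

namespace PlaneBranch

variable (C : PlaneBranch)

open Polynomial

theorem famEval_add (j : ℕ) {A : Type*} [CommRing A] (ε : PowerSeries ℂ →+* A) (w : A)
    (G H : Polynomial (PowerSeries ℂ)) :
    C.famEval j ε w (G + H) = C.famEval j ε w G + C.famEval j ε w H := eval₂_add _ _

theorem famEval_mul (j : ℕ) {A : Type*} [CommRing A] (ε : PowerSeries ℂ →+* A) (w : A)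
    (G H : Polynomial (PowerSeries ℂ)) :
    C.famEval j ε w (G * H) = C.famEval j ε w G * C.famEval j ε w H := eval₂_mul _ _

/-- The induction step: division by powers of the semiroot `F_{i+1}`. The exponent `N` is recorded
modulo `e_i / e_{i+1}`, so that no two terms of the expansion have leading forms of the same
order. -/
theorem leadsWith_of_degree_lt_mul {i : ℕ} (hi : i < C.g)
    (ih : ∀ H : Polynomial (PowerSeries ℂ), H ≠ 0 → H.degree < (C.n / C.e i : ℕ) →
      ∃ (N : ℕ) (κ : ℂ) (m : ℕ), κ * C.c (C.β i) ^ m ≠ 0 ∧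
        ∀ (A : Type) [CommRing A] (ε : PowerSeries ℂ →+* A) (w : A),
          LeadsWith ε w (C.famEval i ε w H) N κ m)
    (a : ℕ) (ha : a ≤ C.e i / C.e (i + 1)) (H : Polynomial (PowerSeries ℂ)) (hH : H ≠ 0)
    (hd : H.degree < (a * (C.n / C.e i) : ℕ)) :
    ∃ (N : ℕ) (κ : ℂ) (m : ℕ), κ ≠ 0 ∧ m < a ∧
      N ≡ m * (C.v (i + 1) / C.e (i + 1)) [MOD C.e i / C.e (i + 1)] ∧
      ∀ (A : Type) [CommRing A] (ε : PowerSeries ℂ →+* A) (w : A),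
        LeadsWith ε w (C.famEval (i + 1) ε w H) N κ m := by
  induction a generalizing H with
  | zero =>
    rw [Nat.zero_mul, Nat.cast_zero, Nat.WithBot.lt_zero_iff, degree_eq_bot] at hd
    exact absurd hd hH
  | succ a iha =>
    set F := C.semiroot (i + 1) with hF
    have hFm : F.Monic := C.semiroot_monic hi
    have hFd : F.degree = (C.n / C.e i : ℕ) := by
      rw [degree_eq_natDegree hFm.ne_zero, C.natDegree_semiroot hi]
    have hdiv : H = F * (H /ₘ F) + H %ₘ F := by rw [add_comm, modByMonic_add_div]
    set Q := H /ₘ F with hQ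
    set R := H %ₘ F with hR
    have hRd : R.degree < (C.n / C.e i : ℕ) := hFd ▸ degree_modByMonic_lt H hFm
    have hQd : Q.degree < (a * (C.n / C.e i) : ℕ) := by
      by_cases hQ0 : Q = 0
      · rw [hQ0, degree_zero]
        exact WithBot.bot_lt_coe _
      · have h1 : (F * Q).degree < ((a + 1) * (C.n / C.e i) : ℕ) := by
          have : F * Q = H - R := by rw [hdiv]; ring
          rw [this]
          refine lt_of_le_of_lt (degree_sub_le _ _) (max_lt hd (lt_of_lt_of_le hRd ?_))
          exact_mod_cast Nat.le_mul_of_pos_left _ (Nat.succ_pos a)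
        rw [hFm.degree_mul_comm, hFm.degree_mul, hFd, degree_eq_natDegree hQ0] at h1
        rw [degree_eq_natDegree hQ0]
        norm_cast at h1 ⊢
        rw [add_mul, one_mul] at h1
        omega
    obtain ⟨κF, hκF, hlF⟩ := C.leadsWith_semiroot hi
    -- The leading form of the remainder.
    have hRl : R ≠ 0 → ∃ (N : ℕ) (κ : ℂ), κ ≠ 0 ∧ C.e i / C.e (i + 1) ∣ N ∧
        ∀ (A : Type) [CommRing A] (ε : PowerSeries ℂ →+* A) (w : A),
          LeadsWith ε w (C.famEval (i + 1) ε w R) N κ 0 := fun hR0 => by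
      obtain ⟨N, κ, m, h1, h2⟩ := ih R hR0 hRd
      exact ⟨_, _, h1, dvd_mul_right _ _, C.leadsWith_famEval_of_lt (Nat.lt_succ_self i) hi h2⟩
    by_cases hQ0 : Q = 0
    · have hHR : H = R := by rw [hdiv, hQ0, mul_zero, zero_add]
      obtain ⟨N, κ, h1, h2, h3⟩ := hRl (hHR ▸ hH)
      refine ⟨N, κ, 0, h1, Nat.succ_pos a, ?_, by rw [hHR]; exact h3⟩
      rw [zero_mul]
      exact (Nat.modEq_zero_iff_dvd).2 h2
    · obtain ⟨N, κ, m, h1, h2, h3, h4⟩ := iha (by omega) Q hQ0 hQd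
      have hFQ : ∀ (A : Type) [CommRing A] (ε : PowerSeries ℂ →+* A) (w : A),
          LeadsWith ε w (C.famEval (i + 1) ε w (F * Q)) (C.v (i + 1) / C.e (i + 1) + N)
            (κF * κ) (1 + m) := fun A _ ε w => by
        rw [famEval_mul]
        exact (hlF A ε w).mul (h4 A ε w)
      have hmod : C.v (i + 1) / C.e (i + 1) + N ≡
          (1 + m) * (C.v (i + 1) / C.e (i + 1)) [MOD C.e i / C.e (i + 1)] := by
        rw [add_mul, one_mul]
        exact Nat.ModEq.add_left _ h3
      by_cases hR0 : R = 0
      · refine ⟨_, _, _, mul_ne_zero hκF h1, by omega, hmod, ?_⟩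
        rw [hdiv, hR0, add_zero]
        exact hFQ
      · obtain ⟨N', κ', h1', h2', h3'⟩ := hRl hR0
        rcases lt_trichotomy (C.v (i + 1) / C.e (i + 1) + N) N' with hlt | heq | hlt
        · refine ⟨_, _, _, mul_ne_zero hκF h1, by omega, hmod, fun A _ ε w => ?_⟩
          rw [hdiv, famEval_add]
          exact (hFQ A ε w).add_of_lt (h3' A ε w) hlt
        · exfalso
          rw [heq] at hmod
          have h5 := (Nat.modEq_zero_iff_dvd).1 (hmod.symm.trans ((Nat.modEq_zero_iff_dvd).2 h2'))
          have h6 := (C.coprime_v_div hi).dvd_of_dvd_mul_right h5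
          have := Nat.le_of_dvd (by omega) h6
          omega
        · refine ⟨N', κ', 0, h1', Nat.succ_pos a, ?_, fun A _ ε w => ?_⟩
          · rw [zero_mul]
            exact (Nat.modEq_zero_iff_dvd).2 h2'
          · rw [hdiv, famEval_add, add_comm]
            exact (h3' A ε w).add_of_lt (hFQ A ε w) hlt

/-- Every nonzero polynomial of degree less than `n / e_j` has a leading form `κ T ^ N w ^ m` along
the `j`-th family of arcs: its coefficient vanishes for no `w ≠ 0`. -/
theorem exists_leadsWith {j : ℕ} (hj : j ≤ C.g) (H : Polynomial (PowerSeries ℂ)) (hH : H ≠ 0)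
    (hd : H.degree < (C.n / C.e j : ℕ)) :
    ∃ (N : ℕ) (κ : ℂ) (m : ℕ), κ * C.c (C.β j) ^ m ≠ 0 ∧
      ∀ (A : Type) [CommRing A] (ε : PowerSeries ℂ →+* A) (w : A),
        LeadsWith ε w (C.famEval j ε w H) N κ m := by
  induction j generalizing H with
  | zero =>
    rw [e_zero, Nat.div_self C.n_pos, Nat.cast_one] at hd
    have hC : H = Polynomial.C (H.coeff 0) :=
      eq_C_of_degree_le_zero (Nat.WithBot.lt_one_iff_le_zero.1 hd)
    have h0 : H.coeff 0 ≠ 0 := fun h => hH (by rw [hC, h, map_zero])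
    set h := H.coeff 0 with hh
    refine ⟨h.order.toNat, PowerSeries.constantCoeff h.divXPowOrder, 0, ?_, fun A _ ε w => ?_⟩
    · rw [pow_zero, mul_one, PowerSeries.constantCoeff_divXPowOrder]
      exact (PowerSeries.coeff_order h0)
    · obtain ⟨s, hs⟩ : PowerSeries.X ∣ h.divXPowOrder -
          PowerSeries.C (PowerSeries.constantCoeff h.divXPowOrder) := by
        rw [PowerSeries.X_dvd_iff, map_sub, PowerSeries.constantCoeff_C, sub_self]
      refine ⟨ε s, ?_⟩
      have h1 : expandHom ε (C.n / C.e 0) (C.n_div_e_ne_zero 0) = ε := by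
        ext f
        rw [expandHom_apply]
        congr 1
        have : C.n / C.e 0 = 1 := Nat.div_self C.n_pos
        simp only [this]
        exact PowerSeries.expand_one_apply f
      rw [famEval, hC, eval₂_C, h1]
      conv_lhs => rw [← PowerSeries.X_pow_order_mul_divXPowOrder (f := h)]
      have h2 : ε h.divXPowOrder = ε PowerSeries.X * ε s +
          ε (PowerSeries.C (PowerSeries.constantCoeff h.divXPowOrder)) := by
        rw [← map_mul, ← map_add, ← sub_eq_iff_eq_add.1 hs]
      rw [map_mul, map_pow, h2]
      ring
  | succ i ih =>
    have hdeg : H.degree < (C.e i / C.e (i + 1) * (C.n / C.e i) : ℕ) := by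
      rwa [← C.n_div_e_eq (Nat.le_succ i)]
    obtain ⟨N, κ, m, h1, _, _, h4⟩ := C.leadsWith_of_degree_lt_mul hj
      (ih (by omega)) _ le_rfl H hH hdeg
    exact ⟨N, κ, m, mul_ne_zero h1 (pow_ne_zero _ (C.c_β_ne_zero hj)), h4⟩

/-! ### Intersection multiplicities -/

/-- The branch is the member `T = τ ^ e_j`, `w = ∑ c_{β_j + k} τ ^ k` of the `j`-th family. -/
theorem famY_branch (j : ℕ) :
    C.famY j (expandHom (RingHom.id _) (C.e j) (C.e_pos j).ne')
      (PowerSeries.mk fun k => C.c (k + C.β j)) = C.η := by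
  have hb := C.e_mul_β_div (le_refl j)
  ext k
  rw [famY, map_add, expandHom_apply, expandHom_apply, PowerSeries.expand_X, RingHom.id_apply,
    RingHom.id_apply, ← pow_mul, hb, PowerSeries.coeff_X_pow_mul']
  have hc : PowerSeries.coeff k C.η = C.c k := rfl
  by_cases hk : C.β j ≤ k
  · rw [if_pos hk, PowerSeries.coeff_mk, Nat.sub_add_cancel hk, hc]
    suffices h : PowerSeries.coeff k (PowerSeries.expand (C.e j) (C.e_pos j).ne' (C.head j)) = 0 by
      rw [h, zero_add]
    by_cases hd : C.e j ∣ k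
    · obtain ⟨l, rfl⟩ := hd
      rw [PowerSeries.coeff_expand_mul, coeff_head, if_neg (not_lt.2 hk)]
    · exact PowerSeries.coeff_expand_of_not_dvd _ _ _ hd
  · rw [if_neg hk, add_zero, hc]
    by_cases hd : C.e j ∣ k
    · obtain ⟨l, rfl⟩ := hd
      rw [PowerSeries.coeff_expand_mul, coeff_head, if_pos (not_le.1 hk)]
    · rw [PowerSeries.coeff_expand_of_not_dvd _ _ _ hd]
      by_contra h
      exact hd (C.e_dvd_of_lt_β' (not_le.1 hk) (Ne.symm h))

theorem evalArc_branch (j : ℕ) (H : Polynomial (PowerSeries ℂ)) :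
    evalArc (PowerSeries.X ^ C.n) C.η (toSeries H) =
      C.famEval j (expandHom (RingHom.id _) (C.e j) (C.e_pos j).ne')
        (PowerSeries.mk fun k => C.c (k + C.β j)) H := by
  have hη : PowerSeries.constantCoeff C.η = 0 := by
    rw [← PowerSeries.coeff_zero_eq_constantCoeff_apply]
    by_contra h
    exact absurd (C.exponent_gt 0 h) (Nat.not_lt_zero _)
  rw [evalArc, famEval, C.famY_branch, expandHom_expandHom _ _ _ C.n_ne_zero (C.e_mul_n_div j).symm]
  refine subst_toSeries (τ := Unit) ?_ _ ?_ H
  · intro l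
    fin_cases l
    · exact (map_pow PowerSeries.constantCoeff PowerSeries.X C.n).trans (by simp [C.n_ne_zero])
    · exact hη
  · intro f
    exact PowerSeries.expand_apply _ C.n_ne_zero f

theorem inter_eq {j : ℕ} {H : Polynomial (PowerSeries ℂ)} {N : ℕ} {κ : ℂ} {m : ℕ}
    (hκ : κ * C.c (C.β j) ^ m ≠ 0)
    (h : ∀ (A : Type) [CommRing A] (ε : PowerSeries ℂ →+* A) (w : A),
      LeadsWith ε w (C.famEval j ε w H) N κ m) :
    C.inter H = (C.e j * N : ℕ) := by
  obtain ⟨r, hr⟩ := h _ (expandHom (RingHom.id _) (C.e j) (C.e_pos j).ne')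
    (PowerSeries.mk fun k => C.c (k + C.β j))
  rw [inter, C.evalArc_branch j, hr, expandHom_apply, expandHom_apply, PowerSeries.expand_X,
    PowerSeries.expand_C, RingHom.id_apply, RingHom.id_apply, ← pow_mul, PowerSeries.order_mul,
    PowerSeries.order_X_pow, PowerSeries.order_zero_of_unit, add_zero]
  rw [PowerSeries.isUnit_iff_constantCoeff]
  refine IsUnit.mk0 _ ?_
  simp only [map_add, map_mul, map_pow, PowerSeries.constantCoeff_C, PowerSeries.constantCoeff_X]
  rw [zero_pow (C.e_pos j).ne', zero_mul, add_zero, ← PowerSeries.coeff_zero_eq_constantCoeff_apply,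
    PowerSeries.coeff_mk, zero_add]
  exact hκ

end PlaneBranch

/-! ### The pull-back of the foliation under the parametrized families -/

section

open MvPowerSeries

/-- The inclusion of `ℂ⟦t⟧` into `R⟦T, Z⟧` with `t = T`. -/
noncomputable def inclT (R : Type*) [CommRing R] [Algebra ℂ R] :
    PowerSeries ℂ →+* MvPowerSeries (Fin 2) R :=
  (PowerSeries.substAlgHom (PowerSeries.HasSubst.X (S := R) (0 : Fin 2))).toRingHom

variable {R : Type*} [CommRing R] [Algebra ℂ R]

theorem inclT_apply (f : PowerSeries ℂ) :
    inclT R f = PowerSeries.subst (X 0 : MvPowerSeries (Fin 2) R) f := by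
  rw [← PowerSeries.coe_substAlgHom (PowerSeries.HasSubst.X (S := R) (0 : Fin 2))]
  rfl

theorem inclT_X : inclT R PowerSeries.X = X 0 := by
  rw [inclT_apply, PowerSeries.subst_X (PowerSeries.HasSubst.X 0)]

theorem inclT_C (z : ℂ) : inclT R (PowerSeries.C z) = C (algebraMap ℂ R z) := by
  refine ((PowerSeries.substAlgHom
    (PowerSeries.HasSubst.X (S := R) (0 : Fin 2))).commutes z).trans ?_
  rw [MvPowerSeries.algebraMap_apply]

theorem constantCoeff_inclT (f : PowerSeries ℂ) (hf : PowerSeries.constantCoeff f = 0) :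
    constantCoeff (inclT R f) = 0 := by
  obtain ⟨s, rfl⟩ := PowerSeries.X_dvd_iff.2 hf
  rw [map_mul, inclT_X, map_mul, constantCoeff_X, zero_mul]

namespace PlaneBranch

variable (C : PlaneBranch)

/-- The `j`-th family of arcs near the parameter `u`, as a map germ in the variables `T` and
`Z = w - u`. -/
noncomputable def famMap (j : ℕ) (u : R) : Fin 2 → MvPowerSeries (Fin 2) R :=
  ![X 0 ^ (C.n / C.e j), C.famY j (inclT R) (MvPowerSeries.C u + X 1)]

theorem constantCoeff_head (j : ℕ) : PowerSeries.constantCoeff (C.head j) = 0 := by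
  rw [← PowerSeries.coeff_zero_eq_constantCoeff_apply, coeff_head, mul_zero,
    C.c_eq_zero_of_le_n (Nat.zero_le _), ite_self]

theorem β_div_ne_zero {j : ℕ} (hj : j ≤ C.g) : C.β j / C.e j ≠ 0 :=
  (Nat.div_pos (Nat.le_of_dvd (C.β_pos hj) (C.e_dvd_β j)) (C.e_pos j)).ne'

theorem constantCoeff_famMap {j : ℕ} (hj : j ≤ C.g) (u : R) (l : Fin 2) :
    constantCoeff (C.famMap j u l) = 0 := by
  fin_cases l
  · simp [famMap, C.n_div_e_ne_zero j]
  · simp only [famMap, famY, inclT_X]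
    simp [C.β_div_ne_zero hj, constantCoeff_inclT _ (C.constantCoeff_head j)]

theorem subst_famMap {j : ℕ} (hj : j ≤ C.g) (u : R) (H : Polynomial (PowerSeries ℂ)) :
    subst (C.famMap j u) (toSeries H) =
      C.famEval j (inclT R) (MvPowerSeries.C u + X 1) H := by
  refine subst_toSeries (C.constantCoeff_famMap hj u) _ (fun f => ?_) H
  have hX := PowerSeries.HasSubst.X (S := R) (0 : Fin 2)
  rw [expandHom_apply, inclT_apply, PowerSeries.expand_apply,
    PowerSeries.subst_comp_subst_apply (PowerSeries.HasSubst.X_pow (C.n_div_e_ne_zero j)) hX,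
    PowerSeries.subst_pow hX, PowerSeries.subst_X hX]
  rfl

end PlaneBranch

theorem LeadsWith.exists_eq {y : MvPowerSeries (Fin 2) R} {w : MvPowerSeries (Fin 2) R} {N : ℕ}
    {κ : ℂ} {m : ℕ} (h : LeadsWith (inclT R) w y N κ m) :
    ∃ r, y = X 0 ^ N * (MvPowerSeries.C (algebraMap ℂ R κ) * w ^ m + X 0 * r) := by
  obtain ⟨r, hr⟩ := h
  exact ⟨r, by rw [hr, inclT_X, inclT_C]⟩

/-- The factors `T ^ Nᵢ` and `T ^ Nⱼ` contribute nothing to `vᵢ fᵢ dfⱼ - vⱼ fⱼ dfᵢ` but a power of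
`T`, because `vᵢ Nⱼ = vⱼ Nᵢ`. -/
theorem derivation_cancel {S : Type*} [CommRing S] {K : Type*} [CommRing K] [Algebra K S]
    (D : Derivation K S S) (T g g' : S) {N N' v v' : ℕ} (hN : N ≠ 0) (hN' : N' ≠ 0)
    (h : v * N' = v' * N) :
    v * (T ^ N * g) * D (T ^ N' * g') - v' * (T ^ N' * g') * D (T ^ N * g) =
      T ^ (N + N') * (v * g * D g' - v' * g' * D g) := by
  obtain ⟨a, rfl⟩ := Nat.exists_eq_succ_of_ne_zero hN
  obtain ⟨b, rfl⟩ := Nat.exists_eq_succ_of_ne_zero hN'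
  have h' : (v : S) * ((b : S) + 1) = v' * ((a : S) + 1) := by
    have := congrArg (Nat.cast (R := S)) h
    push_cast at this
    exact this
  simp only [Derivation.leibniz, Derivation.leibniz_pow, smul_eq_mul, nsmul_eq_mul,
    Nat.succ_eq_add_one, Nat.add_sub_cancel]
  push_cast
  linear_combination (T ^ a * T ^ (b + 1) * D T * g * g') * h'

theorem pderiv_X_pow_succ_mul {S : Type*} [CommRing S] (N : ℕ) (G : MvPowerSeries (Fin 2) S)
    (i : Fin 2) :
    pderiv S i (X 0 ^ (N + 1) * G) =
      X 0 ^ N * (((N + 1 : ℕ) : MvPowerSeries (Fin 2) S) * pderiv S i (X 0) * G +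
        X 0 * pderiv S i G) := by
  simp only [Derivation.leibniz, Derivation.leibniz_pow, smul_eq_mul, nsmul_eq_mul,
    Nat.add_sub_cancel]
  ring

namespace PlaneBranch

variable (C : PlaneBranch)

/-- The leading form of `F_i` along the `j`-th family, for `i < j`, does not involve `w`. -/
theorem leadsWith_semiroot_of_lt {i j : ℕ} (hij : i < j) (hj : j ≤ C.g) :
    ∃ κ : ℂ, κ ≠ 0 ∧ ∀ (A : Type) [CommRing A] (ε : PowerSeries ℂ →+* A) (w : A),
      LeadsWith ε w (C.famEval j ε w (C.semiroot i)) (C.v i / C.e j) κ 0 := by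
  cases i with
  | zero =>
    refine ⟨1, one_ne_zero, fun A _ ε w => ⟨0, ?_⟩⟩
    rw [famEval, semiroot, Polynomial.eval₂_C, expandHom_apply, PowerSeries.expand_X]
    simp [v]
  | succ i =>
    obtain ⟨κ, hκ, h⟩ := C.leadsWith_semiroot (i := i) (by omega)
    refine ⟨_, mul_ne_zero hκ (pow_ne_zero 1 (C.c_β_ne_zero (i := i) (by omega))), ?_⟩
    have := C.leadsWith_famEval_of_lt hij hj h
    have hN : C.e (i + 1) / C.e j * (C.v (i + 1) / C.e (i + 1)) = C.v (i + 1) / C.e j := by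
      have h1 := C.e_mul_div hij.le
      have h2 : C.e j ∣ C.v (i + 1) := (C.e_dvd_of_le hij.le).trans (C.e_dvd_v (by omega))
      apply Nat.eq_of_mul_eq_mul_left (C.e_pos j)
      rw [← mul_assoc, h1, Nat.mul_div_cancel' (C.e_dvd_v (by omega)), Nat.mul_div_cancel' h2]
    rwa [hN] at this

theorem pull_omega {i j : ℕ} (H₁ H₂ : Polynomial (PowerSeries ℂ))
    {a : Fin 2 → MvPowerSeries (Fin 2) R} (ha : ∀ l, constantCoeff (a l) = 0) (k : Fin 2) :
    (toSeries H₁ • C.omega i j + differential (toSeries H₂)).pull a k =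
      subst a (toSeries H₁) *
        (C.v i * subst a (toSeries (C.semiroot i)) *
            pderiv R k (subst a (toSeries (C.semiroot j))) -
          C.v j * subst a (toSeries (C.semiroot j)) *
            pderiv R k (subst a (toSeries (C.semiroot i)))) +
      pderiv R k (subst a (toSeries H₂)) := by
  have hs := hasSubst_of_constantCoeff_zero ha
  have hn : ∀ (m : ℕ) (f : MvPowerSeries (Fin 2) ℂ), subst a ((m : MvPowerSeries (Fin 2) ℂ) * f) =
      (m : MvPowerSeries (Fin 2) R) * subst a f := fun m f => by
    rw [← coe_substAlgHom hs, map_mul, map_natCast]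
  have hsub : C.omega i j = (C.v i * toSeries (C.semiroot i) : MvPowerSeries (Fin 2) ℂ) •
      differential (toSeries (C.semiroot j)) + (-(C.v j * toSeries (C.semiroot j)) :
        MvPowerSeries (Fin 2) ℂ) • differential (toSeries (C.semiroot i)) := by
    rw [omega, sub_eq_add_neg, neg_smul]
  have hneg : ∀ f : MvPowerSeries (Fin 2) ℂ, subst a (-f) = -subst a f := fun f => by
    rw [← coe_substAlgHom hs, map_neg]
  rw [OneForm.pull_add ha, OneForm.pull_smul ha, hsub, OneForm.pull_add ha, OneForm.pull_smul ha,
    OneForm.pull_smul ha, OneForm.pull_differential ha, OneForm.pull_differential ha,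
    OneForm.pull_differential ha, hneg, hn, hn]
  ring

/-- The data common to both cases: the pull-back of `ω` under the `j`-th family. -/
theorem pull_famMap_eq {i j : ℕ} (hij : i < j) (hj : j ≤ C.g)
    (H₁ H₂ : Polynomial (PowerSeries ℂ)) {N₁ : ℕ} {κ₁ : ℂ} {m₁ : ℕ} (hκ₁ : κ₁ ≠ 0)
    (h₁ : ∀ (A : Type) [CommRing A] (ε : PowerSeries ℂ →+* A) (w : A),
      LeadsWith ε w (C.famEval j ε w H₁) N₁ κ₁ m₁)
    (R : Type) [CommRing R] [Algebra ℂ R] (u : R) (hu : IsUnit u) :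
    ∃ G : Fin 2 → MvPowerSeries (Fin 2) R, IsUnit (constantCoeff (G 1)) ∧
      ∀ k, (toSeries H₁ • C.omega i j + differential (toSeries H₂)).pull (C.famMap j u) k =
        X 0 ^ (N₁ + C.v i / C.e j + C.v j / C.e j) * G k +
          pderiv R k (C.famEval j (inclT R) (MvPowerSeries.C u + X 1) H₂) := by
  obtain ⟨κi, hκi, hi⟩ := C.leadsWith_semiroot_of_lt hij hj
  obtain ⟨κj, hκj, hjl⟩ : ∃ κ : ℂ, κ ≠ 0 ∧ ∀ (A : Type) [CommRing A] (ε : PowerSeries ℂ →+* A)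
      (w : A), LeadsWith ε w (C.famEval j ε w (C.semiroot j)) (C.v j / C.e j) κ 1 := by
    obtain ⟨l, rfl⟩ := Nat.exists_eq_succ_of_ne_zero (show j ≠ 0 by omega)
    exact C.leadsWith_semiroot hj
  obtain ⟨r₁, hr₁⟩ := (h₁ _ (inclT R) (MvPowerSeries.C u + X 1)).exists_eq
  obtain ⟨ri, hri⟩ := (hi _ (inclT R) (MvPowerSeries.C u + X 1)).exists_eq
  obtain ⟨rj, hrj⟩ := (hjl _ (inclT R) (MvPowerSeries.C u + X 1)).exists_eq
  set G₁ := MvPowerSeries.C (algebraMap ℂ R κ₁) * (MvPowerSeries.C u + X 1) ^ m₁ + X 0 * r₁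
    with hG₁
  set gi := MvPowerSeries.C (algebraMap ℂ R κi) * (MvPowerSeries.C u + X 1) ^ 0 + X 0 * ri with hgi
  set gj := MvPowerSeries.C (algebraMap ℂ R κj) * (MvPowerSeries.C u + X 1) ^ 1 + X 0 * rj with hgj
  have hdi : C.e j ∣ C.v i := (C.e_dvd_of_le hij.le).trans (C.e_dvd_v (by omega))
  have hdj : C.e j ∣ C.v j := C.e_dvd_v hj
  have hunit : ∀ z : ℂ, z ≠ 0 → IsUnit (algebraMap ℂ R z) := fun z hz =>
    (IsUnit.mk0 z hz).map (algebraMap ℂ R)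
  have hdiv0 : ∀ l, l ≤ C.g → C.e j ∣ C.v l → C.v l / C.e j ≠ 0 := fun l hl hd =>
    (Nat.div_pos (Nat.le_of_dvd (C.v_pos hl) hd) (C.e_pos j)).ne'
  refine ⟨fun k => G₁ * (C.v i * gi * pderiv R k gj - C.v j * gj * pderiv R k gi), ?_, fun k => ?_⟩
  · have hX : pderiv R (1 : Fin 2) (X 0 : MvPowerSeries (Fin 2) R) = 0 :=
      pderiv_X_of_ne (by decide)
    have e1 : constantCoeff G₁ = algebraMap ℂ R κ₁ * u ^ m₁ := by simp [hG₁]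
    have e2 : constantCoeff gi = algebraMap ℂ R κi := by simp [hgi]
    have e3 : constantCoeff (pderiv R (1 : Fin 2) gj) = algebraMap ℂ R κj := by
      rw [hgj]
      simp [hX, pderiv_X_self]
    have e4 : constantCoeff (pderiv R (1 : Fin 2) gi) = 0 := by
      rw [hgi]
      simp [hX]
    rw [map_mul, map_sub, map_mul, map_mul, map_mul _ _ (pderiv R 1 gi), e1, e2, e3, e4, mul_zero,
      sub_zero, map_natCast]
    have hv : IsUnit ((C.v i : ℕ) : R) := by
      have := hunit (C.v i : ℂ) (by exact_mod_cast (C.v_pos (show i ≤ C.g by omega)).ne')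
      rwa [map_natCast] at this
    exact ((hunit κ₁ hκ₁).mul (hu.pow _)).mul ((hv.mul (hunit κi hκi)).mul (hunit κj hκj))
  · rw [C.pull_omega H₁ H₂ (C.constantCoeff_famMap hj u), C.subst_famMap hj, C.subst_famMap hj,
      C.subst_famMap hj, C.subst_famMap hj, hr₁, hri, hrj,
      derivation_cancel (pderiv R k) (X 0) gi gj (hdiv0 i (by omega) hdi) (hdiv0 j hj hdj)]
    · ring
    · rw [← Nat.mul_div_assoc _ hdj, ← Nat.mul_div_assoc _ hdi, mul_comm]

end PlaneBranch

end

section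

open MvPowerSeries

namespace PlaneBranch

variable (C : PlaneBranch)

/-- If the inequality of intersection multiplicities holds, then `dH₂` vanishes to higher order than
`H₁ ω_{ij}` along `T = 0`. -/
theorem pull_famMap_of_lt {i j : ℕ} (hij : i < j) (hj : j ≤ C.g)
    {H₁ H₂ : Polynomial (PowerSeries ℂ)}
    (hd₁ : H₁.degree < (C.n / C.e j : ℕ)) (hd₂ : H₂.degree < (C.n / C.e j : ℕ)) (hH₁ : H₁ ≠ 0)
    (hlt : C.inter H₁ + C.v i + C.v j < C.inter H₂) :
    ∃ M : ℕ, ∀ (R : Type) [CommRing R] [Algebra ℂ R] (u : R), IsUnit u →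
      ∃ G : Fin 2 → MvPowerSeries (Fin 2) R, IsUnit (constantCoeff (G 1)) ∧
        ∀ k, (toSeries H₁ • C.omega i j + differential (toSeries H₂)).pull (C.famMap j u) k =
          X 0 ^ M * G k := by
  obtain ⟨N₁, κ₁, m₁, hκ₁, h₁⟩ := C.exists_leadsWith hj H₁ hH₁ hd₁
  refine ⟨N₁ + C.v i / C.e j + C.v j / C.e j, fun R _ _ u hu => ?_⟩
  obtain ⟨G, hG, h⟩ := C.pull_famMap_eq hij hj H₁ H₂ (left_ne_zero_of_mul hκ₁) h₁ R u hu
  set M := N₁ + C.v i / C.e j + C.v j / C.e j with hM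
  by_cases hH₂ : H₂ = 0
  · refine ⟨G, hG, fun k => ?_⟩
    rw [h, hH₂, famEval, Polynomial.eval₂_zero, map_zero, add_zero]
  · obtain ⟨N₂, κ₂, m₂, hκ₂, h₂⟩ := C.exists_leadsWith hj H₂ hH₂ hd₂
    obtain ⟨r, hr⟩ := h₂ _ (inclT R) (MvPowerSeries.C u + X 1)
    have hdi : C.e j * (C.v i / C.e j) = C.v i :=
      Nat.mul_div_cancel' ((C.e_dvd_of_le hij.le).trans (C.e_dvd_v (by omega)))
    have hdj : C.e j * (C.v j / C.e j) = C.v j := Nat.mul_div_cancel' (C.e_dvd_v hj)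
    have hMN : M < N₂ := by
      rw [C.inter_eq hκ₁ h₁, C.inter_eq hκ₂ h₂] at hlt
      have hlt' : C.e j * N₁ + C.v i + C.v j < C.e j * N₂ := by exact_mod_cast hlt
      rw [← hdi, ← hdj, ← mul_add, ← mul_add] at hlt'
      exact Nat.lt_of_mul_lt_mul_left hlt'
    obtain ⟨d, rfl⟩ := Nat.exists_eq_add_of_lt hMN
    rw [inclT_X] at hr
    set Q := inclT R (PowerSeries.C κ₂) * (MvPowerSeries.C u + X 1) ^ m₂ + X 0 * r
    refine ⟨fun k => G k + X 0 ^ d * ((((M + d + 1 : ℕ) : MvPowerSeries (Fin 2) R)) *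
      pderiv R k (X 0) * Q + X 0 * pderiv R k Q), ?_, fun k => ?_⟩
    · have hX : pderiv R (1 : Fin 2) (X 0 : MvPowerSeries (Fin 2) R) = 0 :=
        pderiv_X_of_ne (by decide)
      simpa [hX] using hG
    · rw [h, hr, pderiv_X_pow_succ_mul]
      ring

/-- If the inequality of intersection multiplicities fails, then `dH₂` dominates along `T = 0`. -/
theorem pull_famMap_of_le {i j : ℕ} (hij : i < j) (hj : j ≤ C.g)
    {H₁ H₂ : Polynomial (PowerSeries ℂ)}
    (hd₁ : H₁.degree < (C.n / C.e j : ℕ)) (hd₂ : H₂.degree < (C.n / C.e j : ℕ)) (hH₁ : H₁ ≠ 0)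
    (hH₂ : PowerSeries.constantCoeff (H₂.coeff 0) = 0)
    (hle : C.inter H₂ ≤ C.inter H₁ + C.v i + C.v j) :
    ∃ (M : ℕ) (A B : MvPowerSeries (Fin 2) ℂ), ¬ X 0 ∣ A ∧
      (toSeries H₁ • C.omega i j + differential (toSeries H₂)).pull
        (C.famMap j (C.c (C.β j))) 0 = X 0 ^ M * A ∧
      (toSeries H₁ • C.omega i j + differential (toSeries H₂)).pull
        (C.famMap j (C.c (C.β j))) 1 = X 0 ^ M * (X 0 * B) := by
  obtain ⟨N₁, κ₁, m₁, hκ₁, h₁⟩ := C.exists_leadsWith hj H₁ hH₁ hd₁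
  have hH₂0 : H₂ ≠ 0 := by
    rintro rfl
    rw [C.inter_eq hκ₁ h₁] at hle
    have h0 : C.inter 0 = ⊤ := by
      rw [inter, C.evalArc_branch j, famEval, Polynomial.eval₂_zero, PowerSeries.order_zero]
    rw [h0, top_le_iff] at hle
    exact absurd hle (by exact_mod_cast ENat.natCast_ne_top (C.e j * N₁ + C.v i + C.v j))
  have hc : C.c (C.β j) ≠ 0 := by
    obtain ⟨l, rfl⟩ := Nat.exists_eq_succ_of_ne_zero (show j ≠ 0 by omega)
    exact C.c_β_ne_zero hj
  obtain ⟨N₂, κ₂, m₂, hκ₂, h₂⟩ := C.exists_leadsWith hj H₂ hH₂0 hd₂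
  obtain ⟨G, hG, h⟩ := C.pull_famMap_eq hij hj H₁ H₂ (left_ne_zero_of_mul hκ₁) h₁ ℂ
    (C.c (C.β j)) (IsUnit.mk0 _ hc)
  obtain ⟨r, hr⟩ := (h₂ _ (inclT ℂ) (MvPowerSeries.C (C.c (C.β j)) + X 1)).exists_eq
  set Q := MvPowerSeries.C (algebraMap ℂ ℂ κ₂) *
    (MvPowerSeries.C (C.c (C.β j)) + X 1) ^ m₂ + X 0 * r with hQ
  have hQ0 : constantCoeff Q ≠ 0 := by
    rw [hQ]
    simpa using hκ₂
  have hN₂ : N₂ ≠ 0 := by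
    rintro rfl
    have hser : constantCoeff (toSeries H₂) = 0 := by
      have h1 : constantCoeff (toSeries H₂) = PowerSeries.coeff 0 (H₂.coeff 0) := rfl
      rw [h1, PowerSeries.coeff_zero_eq_constantCoeff_apply, hH₂]
    have h0 := constantCoeff_subst_eq_zero
      (hasSubst_of_constantCoeff_zero (C.constantCoeff_famMap hj (C.c (C.β j))))
      (C.constantCoeff_famMap hj _) hser
    rw [C.subst_famMap hj, hr, pow_zero, one_mul] at h0
    exact hQ0 h0
  obtain ⟨N, rfl⟩ := Nat.exists_eq_succ_of_ne_zero hN₂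
  have hdi : C.e j * (C.v i / C.e j) = C.v i :=
    Nat.mul_div_cancel' ((C.e_dvd_of_le hij.le).trans (C.e_dvd_v (by omega)))
  have hdj : C.e j * (C.v j / C.e j) = C.v j := Nat.mul_div_cancel' (C.e_dvd_v hj)
  have hMN : N + 1 ≤ N₁ + C.v i / C.e j + C.v j / C.e j := by
    rw [C.inter_eq hκ₁ h₁, C.inter_eq hκ₂ h₂] at hle
    have hle' : C.e j * (N + 1) ≤ C.e j * N₁ + C.v i + C.v j := by exact_mod_cast hle
    rw [← hdi, ← hdj, ← mul_add, ← mul_add] at hle'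
    exact Nat.le_of_mul_le_mul_left hle' (C.e_pos j)
  obtain ⟨d, hd⟩ := Nat.exists_eq_add_of_le hMN
  have hX : pderiv ℂ (1 : Fin 2) (X 0 : MvPowerSeries (Fin 2) ℂ) = 0 := pderiv_X_of_ne (by decide)
  refine ⟨N, X 0 * (X 0 ^ d * G 0) + ((((N + 1 : ℕ) : MvPowerSeries (Fin 2) ℂ)) *
      pderiv ℂ 0 (X 0) * Q + X 0 * pderiv ℂ 0 Q), X 0 ^ d * G 1 + pderiv ℂ 1 Q, ?_, ?_, ?_⟩
  · rintro ⟨s, hs⟩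
    have := congrArg constantCoeff hs
    simp only [map_add, map_mul, constantCoeff_X, zero_mul, add_zero, zero_add, pderiv_X_self,
      mul_one, map_natCast] at this
    exact mul_ne_zero (by exact_mod_cast Nat.succ_ne_zero N) hQ0 this
  · rw [h, hr, hd, Nat.succ_eq_add_one, pderiv_X_pow_succ_mul]
    ring
  · rw [h, hr, hd, Nat.succ_eq_add_one, pderiv_X_pow_succ_mul, hX]
    ring

end PlaneBranch

/-! ### Invariance of transversality under changes of coordinates -/

theorem exists_eq_X_mul_add_of_not_dvd {f : MvPowerSeries (Fin 2) ℂ} (hf : ¬ X 0 ∣ f) :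
    ∃ (k : ℕ) (g h : MvPowerSeries (Fin 2) ℂ), f = X 0 * h + X 1 ^ k * g ∧
      constantCoeff g ≠ 0 := by
  classical
  have hex : ∃ k, coeff (Finsupp.single 1 k) f ≠ 0 := by
    by_contra! hcon
    refine hf (X_dvd_iff.2 fun m hm => ?_)
    have : m = Finsupp.single 1 (m 1) := by
      ext l
      fin_cases l <;> simp [hm]
    rw [this]
    exact hcon _
  set f0 : MvPowerSeries (Fin 2) ℂ := fun m => if m 0 = 0 then coeff m f else 0 with hf0
  have hc : ∀ m, coeff m f0 = if m 0 = 0 then coeff m f else 0 := fun _ => rfl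
  obtain ⟨h, hh⟩ : X 0 ∣ f - f0 := X_dvd_iff.2 fun m hm => by rw [map_sub, hc, if_pos hm, sub_self]
  obtain ⟨g, hg⟩ : X 1 ^ (Nat.find hex) ∣ f0 := X_pow_dvd_iff.2 fun m hm => by
    rw [hc]
    split_ifs with h0
    · have : m = Finsupp.single 1 (m 1) := by
        ext l
        fin_cases l <;> simp [h0]
      rw [this]
      exact not_not.1 (Nat.find_min hex hm)
    · rfl
  refine ⟨Nat.find hex, g, h, by rw [← hh, ← hg]; ring, ?_⟩
  have h1 := Nat.find_spec hex
  have h2 := hc (Finsupp.single 1 (Nat.find hex))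
  rw [hg, X_pow_eq, coeff_monomial_mul, if_pos le_rfl, tsub_self, one_mul,
    coeff_zero_eq_constantCoeff_apply] at h2
  rw [h2]
  simpa using h1

/-- A map germ `θ = (X, Y)` of the plane which preserves the line given by the vanishing of the
first coordinate, and is an isomorphism. -/
structure PreservesLine (θ : Fin 2 → MvPowerSeries (Fin 2) ℂ) : Prop where
  dvd : ∃ U, θ 0 = X 0 * U ∧ constantCoeff U ≠ 0
  constantCoeff_one : constantCoeff (θ 1) = 0
  pderiv_one : constantCoeff (pderiv ℂ 1 (θ 1)) ≠ 0

theorem not_X_dvd_of_constantCoeff_ne_zero (k : ℕ) {g : MvPowerSeries (Fin 2) ℂ}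
    (h : MvPowerSeries (Fin 2) ℂ) (hg : constantCoeff g ≠ 0) : ¬ X 0 ∣ X 0 * h + X 1 ^ k * g := by
  classical
  intro hd
  have h1 := (dvd_add_right (dvd_mul_right (X 0) h)).1 hd
  have h2 := X_dvd_iff.1 h1 (Finsupp.single 1 k) (by simp)
  rw [X_pow_eq, coeff_monomial_mul, if_pos le_rfl, tsub_self, one_mul,
    coeff_zero_eq_constantCoeff_apply] at h2
  exact hg h2

theorem not_X_dvd_mul {f g : MvPowerSeries (Fin 2) ℂ} (hf : ¬ X 0 ∣ f) (hg : ¬ X 0 ∣ g) :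
    ¬ X 0 ∣ f * g := by
  obtain ⟨k, a, b, rfl, ha⟩ := exists_eq_X_mul_add_of_not_dvd hf
  obtain ⟨l, c, d, rfl, hc⟩ := exists_eq_X_mul_add_of_not_dvd hg
  have : (X 0 * b + X 1 ^ k * a) * (X 0 * d + X 1 ^ l * c) =
      X 0 * (b * (X 0 * d + X 1 ^ l * c) + X 1 ^ k * a * d) + X 1 ^ (k + l) * (a * c) := by ring
  rw [this]
  exact not_X_dvd_of_constantCoeff_ne_zero _ _ (by rw [map_mul]; exact mul_ne_zero ha hc)

theorem not_X_dvd_of_isUnit {g : MvPowerSeries (Fin 2) ℂ} (hg : constantCoeff g ≠ 0) :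
    ¬ X 0 ∣ g := by
  simpa using not_X_dvd_of_constantCoeff_ne_zero 0 0 hg

theorem not_X_dvd_pow {g : MvPowerSeries (Fin 2) ℂ} (hg : ¬ X 0 ∣ g) (k : ℕ) : ¬ X 0 ∣ g ^ k := by
  induction k with
  | zero => exact not_X_dvd_of_isUnit (by simp)
  | succ k ih =>
    rw [pow_succ]
    exact not_X_dvd_mul ih hg

/-- If `X ^ M a = X ^ m b` and `X` does not divide `a`, then `m ≤ M`. -/
theorem le_of_X_pow_mul_eq {a b : MvPowerSeries (Fin 2) ℂ} {M m : ℕ} (ha : ¬ X 0 ∣ a)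
    (h : X 0 ^ M * a = X 0 ^ m * b) : m ≤ M := by
  by_contra hcon
  obtain ⟨d, rfl⟩ := Nat.exists_eq_add_of_lt (not_le.1 hcon)
  have h1 : X 0 ^ M * a = X 0 ^ M * (X 0 * (X 0 ^ d * b)) := by rw [h]; ring
  have hX : (X 0 : MvPowerSeries (Fin 2) ℂ) ^ M ≠ 0 :=
    nonZeroDivisors.ne_zero (pow_mem X_mem_nonzeroDivisors M)
  exact ha (mul_left_cancel₀ hX h1 ▸ dvd_mul_right _ _)

namespace PreservesLine

variable {θ : Fin 2 → MvPowerSeries (Fin 2) ℂ}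

theorem constantCoeff_eq_zero (hθ : PreservesLine θ) (l : Fin 2) : constantCoeff (θ l) = 0 := by
  obtain ⟨U, hU, _⟩ := hθ.dvd
  fin_cases l
  · simp [hU]
  · exact hθ.constantCoeff_one

theorem not_X_dvd_one (hθ : PreservesLine θ) : ¬ X 0 ∣ θ 1 := by
  rintro ⟨s, hs⟩
  have hX : pderiv ℂ (1 : Fin 2) (X 0 : MvPowerSeries (Fin 2) ℂ) = 0 := pderiv_X_of_ne (by decide)
  exact hθ.pderiv_one (by rw [hs]; simp [hX])

theorem hasSubst (hθ : PreservesLine θ) : HasSubst θ :=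
  hasSubst_of_constantCoeff_zero hθ.constantCoeff_eq_zero

theorem not_X_dvd_subst (hθ : PreservesLine θ) {f : MvPowerSeries (Fin 2) ℂ} (hf : ¬ X 0 ∣ f) :
    ¬ X 0 ∣ subst θ f := by
  obtain ⟨k, g, h, rfl, hg⟩ := exists_eq_X_mul_add_of_not_dvd hf
  obtain ⟨U, hU, _⟩ := hθ.dvd
  intro hd
  rw [subst_add hθ.hasSubst, subst_mul hθ.hasSubst, subst_mul hθ.hasSubst, subst_pow hθ.hasSubst,
    subst_X hθ.hasSubst, subst_X hθ.hasSubst, hU, mul_assoc] at hd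
  have h1 := (dvd_add_right (dvd_mul_right (X 0) _)).1 hd
  have h2 : constantCoeff (subst θ g) ≠ 0 := by
    rwa [constantCoeff_subst_of_constantCoeff_zero hθ.constantCoeff_eq_zero]
  exact not_X_dvd_mul (not_X_dvd_pow hθ.not_X_dvd_one k) (not_X_dvd_of_isUnit h2) h1

theorem X_dvd_subst (hθ : PreservesLine θ) {f : MvPowerSeries (Fin 2) ℂ} (hf : X 0 ∣ f) :
    X 0 ∣ subst θ f := by
  obtain ⟨s, rfl⟩ := hf
  obtain ⟨U, hU, _⟩ := hθ.dvd
  rw [subst_mul hθ.hasSubst, subst_X hθ.hasSubst, hU, mul_assoc]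
  exact dvd_mul_right _ _

theorem pullback_smul (hθ : PreservesLine θ) {U : MvPowerSeries (Fin 2) ℂ} (hU : θ 0 = X 0 * U)
    (m : ℕ) (ω : OneForm) (k : Fin 2) :
    ((X 0 : MvPowerSeries (Fin 2) ℂ) ^ m • ω).pullback θ k =
      X 0 ^ m * (U ^ m * ω.pullback θ k) := by
  rw [OneForm.pullback_eq_pull, OneForm.pull_smul hθ.constantCoeff_eq_zero,
    subst_pow hθ.hasSubst, subst_X hθ.hasSubst, hU, mul_pow, mul_assoc]
  rfl

theorem pderiv_one_zero (hθ : PreservesLine θ) : X 0 ∣ pderiv ℂ 1 (θ 0) := by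
  obtain ⟨U, hU, _⟩ := hθ.dvd
  have hX : pderiv ℂ (1 : Fin 2) (X 0 : MvPowerSeries (Fin 2) ℂ) = 0 := pderiv_X_of_ne (by decide)
  rw [hU, Derivation.leibniz, hX, smul_zero, add_zero, smul_eq_mul]
  exact dvd_mul_right _ _

theorem constantCoeff_pderiv_zero (hθ : PreservesLine θ) :
    constantCoeff (pderiv ℂ 0 (θ 0)) ≠ 0 := by
  obtain ⟨U, hU, hU0⟩ := hθ.dvd
  rw [hU, Derivation.leibniz, pderiv_X_self]
  simpa using hU0

theorem pullback_apply (ω : OneForm) (k : Fin 2) : ω.pullback θ k =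
    subst θ (ω 0) * pderiv ℂ k (θ 0) + subst θ (ω 1) * pderiv ℂ k (θ 1) := by
  rw [OneForm.pullback, Fin.sum_univ_two]

/-- The line `X 0 = 0` is transversal to `ω` if it is so for the pull-back. -/
theorem genericallyTransversal (hθ : PreservesLine θ) {ω : OneForm} {M : ℕ}
    {G : Fin 2 → MvPowerSeries (Fin 2) ℂ} (hG : ¬ X 0 ∣ G 1)
    (h : ∀ k, ω.pullback θ k = X 0 ^ M * G k) : ω.GenericallyTransversal 0 := by
  obtain ⟨U, hU, hU0⟩ := hθ.dvd
  have hUm : ∀ m : ℕ, ¬ X 0 ∣ U ^ m := not_X_dvd_pow (not_X_dvd_of_isUnit hU0)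
  -- `m` is the largest exponent such that `X ^ m` divides `ω`.
  have hbound : ∀ m : ℕ, (∃ ω' : OneForm, ω = (X 0 : MvPowerSeries (Fin 2) ℂ) ^ m • ω') →
      m ≤ M := by
    rintro m ⟨ω', rfl⟩
    exact le_of_X_pow_mul_eq hG ((h 1).symm.trans (hθ.pullback_smul hU m ω' 1))
  classical
  obtain ⟨m, ⟨ω', hω'⟩, hmax⟩ : ∃ m : ℕ, (∃ ω' : OneForm,
      ω = (X 0 : MvPowerSeries (Fin 2) ℂ) ^ m • ω') ∧
      ¬ ∃ ω' : OneForm, ω = (X 0 : MvPowerSeries (Fin 2) ℂ) ^ (m + 1) • ω' := by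
    by_contra! hcon
    have : ∀ m : ℕ, ∃ ω' : OneForm, ω = (X 0 : MvPowerSeries (Fin 2) ℂ) ^ m • ω' := fun m => by
      induction m with
      | zero => exact ⟨ω, by simp⟩
      | succ m ih => exact hcon m ih
    exact absurd (hbound _ (this (M + 1))) (by omega)
  refine ⟨m, ω', hω', fun hd => ?_⟩
  have hd1 : X 0 ∣ ω' 1 := hd
  have hd0 : ¬ X 0 ∣ ω' 0 := by
    rintro ⟨a, ha⟩
    obtain ⟨b, hb⟩ := hd1
    refine hmax ⟨![a, b], ?_⟩
    rw [hω']
    funext k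
    fin_cases k
    · simp [ha, pow_succ, mul_assoc]
    · simp [hb, pow_succ, mul_assoc]
  have h1 : X 0 ∣ ω'.pullback θ 1 := by
    rw [pullback_apply]
    exact dvd_add (hθ.pderiv_one_zero.mul_left _) ((hθ.X_dvd_subst hd1).mul_right _)
  have h0 : ¬ X 0 ∣ ω'.pullback θ 0 := by
    rw [pullback_apply]
    intro hcon
    have := (dvd_add_left ((hθ.X_dvd_subst hd1).mul_right (pderiv ℂ 0 (θ 1)))).1 hcon
    exact not_X_dvd_mul (hθ.not_X_dvd_subst hd0)
      (not_X_dvd_of_isUnit hθ.constantCoeff_pderiv_zero) this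
  obtain ⟨s, hs⟩ := h1
  have e1 := h 1
  have e0 := h 0
  rw [hω', hθ.pullback_smul hU] at e1 e0
  have i1 : m + 1 ≤ M := le_of_X_pow_mul_eq (b := U ^ m * s) hG (by
    rw [← e1, hs]; ring)
  have i0 : M ≤ m := le_of_X_pow_mul_eq (not_X_dvd_mul (hUm m) h0) e0
  omega

/-- Along the image of `T = 0`, the form `ω` is not generically transversal if the coefficient of `dZ`
in its pull-back has more factors `T` than that of `dT`. -/
theorem not_genericallyTransversal (hθ : PreservesLine θ) {ω : OneForm} {M : ℕ}
    {A B : MvPowerSeries (Fin 2) ℂ} (hA : ¬ X 0 ∣ A)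
    (h0 : ω.pullback θ 0 = X 0 ^ M * A) (h1 : ω.pullback θ 1 = X 0 ^ M * (X 0 * B)) :
    ¬ ω.GenericallyTransversal 0 := by
  obtain ⟨U, hU, hU0⟩ := hθ.dvd
  rintro ⟨m, ω', hω', hd⟩
  have hd1 : ¬ X 0 ∣ ω' 1 := hd
  rw [hω', hθ.pullback_smul hU] at h0 h1
  have hV : ¬ X 0 ∣ ω'.pullback θ 1 := by
    rw [pullback_apply]
    intro hcon
    have := (dvd_add_right (hθ.pderiv_one_zero.mul_left (subst θ (ω' 0)))).1 hcon
    exact not_X_dvd_mul (hθ.not_X_dvd_subst hd1) (not_X_dvd_of_isUnit hθ.pderiv_one) this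
  have i0 : m ≤ M := le_of_X_pow_mul_eq hA h0.symm
  have i1 : M + 1 ≤ m := le_of_X_pow_mul_eq (b := B)
    (not_X_dvd_mul (not_X_dvd_pow (not_X_dvd_of_isUnit hU0) m) hV) (by rw [h1]; ring)
  omega

end PreservesLine

end

/-! ### Charts at the infinitely near points -/

section

open MvPowerSeries

theorem seriesQuot_eq {p q s : PowerSeries ℂ} (hq : q ≠ 0) (h : p = q * s) :
    seriesQuot p q = s := by
  by_cases hs : s = 0
  · rw [h, hs, mul_zero, seriesQuot]
    simp
  have hp : p ≠ 0 := by rw [h]; exact mul_ne_zero hq hs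
  have hle : q.order.toNat ≤ p.order.toNat := by
    rw [h, PowerSeries.order_mul, ENat.toNat_add]
    · exact Nat.le_add_right _ _
    · exact (PowerSeries.order_finite_iff_ne_zero.2 hq).ne
    · exact (PowerSeries.order_finite_iff_ne_zero.2 hs).ne
  have hinv : q.divXPowOrder * (q.divXPowOrder)⁻¹ = 1 := by
    refine PowerSeries.mul_inv_cancel _ ?_
    rw [PowerSeries.constantCoeff_divXPowOrder]
    exact PowerSeries.coeff_order hq
  refine mul_left_cancel₀ hq ?_
  rw [← h, seriesQuot]
  calc q * (PowerSeries.X ^ (p.order.toNat - q.order.toNat) * p.divXPowOrder *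
        (q.divXPowOrder)⁻¹) = (PowerSeries.X ^ q.order.toNat * q.divXPowOrder) *
        (PowerSeries.X ^ (p.order.toNat - q.order.toNat) * p.divXPowOrder *
        (q.divXPowOrder)⁻¹) := by rw [PowerSeries.X_pow_order_mul_divXPowOrder]
    _ = PowerSeries.X ^ (q.order.toNat + (p.order.toNat - q.order.toNat)) * p.divXPowOrder *
        (q.divXPowOrder * (q.divXPowOrder)⁻¹) := by ring
    _ = _ := by rw [hinv, mul_one, Nat.add_sub_cancel' hle,
      PowerSeries.X_pow_order_mul_divXPowOrder]

namespace PlaneBranch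

variable (C : PlaneBranch)

/-- `θ = (X, Y)` are the local coordinates at the infinitely near point `O_k` along a germ of a map
`Φ` into the plane which lifts to `O_k`, and the branch is the image of the arc `a`. That `Φ` is the
composition of `θ` with the blow-ups is recorded through pull-backs of forms. -/
structure ChartAt (k : ℕ) (Φ θ : Fin 2 → MvPowerSeries (Fin 2) ℂ)
    (a : Fin 2 → MvPowerSeries Unit ℂ) : Prop where
  map_zero : ∀ l, constantCoeff (Φ l) = 0
  coord_zero : ∀ l, constantCoeff (θ l) = 0
  arc_zero : ∀ l, constantCoeff (a l) = 0
  x_eq : (C.point k).x = subst a (θ 0)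
  y_eq : (C.point k).y = subst a (θ 1)
  pull : ∀ ω, (C.totalPullback ω k).pullback θ = ω.pullback Φ

namespace ChartAt

variable {C} {k : ℕ} {Φ θ : Fin 2 → MvPowerSeries (Fin 2) ℂ} {a : Fin 2 → MvPowerSeries Unit ℂ}

theorem reparametrize (h : C.ChartAt k Φ θ a) {b : Fin 2 → MvPowerSeries (Fin 2) ℂ}
    {a' : Fin 2 → MvPowerSeries Unit ℂ} (hb : ∀ l, constantCoeff (b l) = 0)
    (ha' : ∀ l, constantCoeff (a' l) = 0) (hab : ∀ l, a l = subst a' (b l)) :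
    C.ChartAt k (fun l => subst b (Φ l)) (fun l => subst b (θ l)) a' := by
  have hsb := hasSubst_of_constantCoeff_zero hb
  have hsa := hasSubst_of_constantCoeff_zero ha'
  have hcomp : ∀ f : MvPowerSeries (Fin 2) ℂ, subst a' (subst b f) = subst a f := fun f => by
    rw [subst_comp_subst_apply hsb hsa]
    congr 1
    funext l
    exact (hab l).symm
  refine ⟨fun l => constantCoeff_subst_eq_zero hsb hb (h.map_zero l),
    fun l => constantCoeff_subst_eq_zero hsb hb (h.coord_zero l), ha', ?_, ?_, fun ω => ?_⟩
  · rw [h.x_eq, hcomp]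
  · rw [h.y_eq, hcomp]
  · rw [← OneForm.pullback_pullback h.coord_zero hb, h.pull,
      OneForm.pullback_pullback h.map_zero hb]

/-- Blowing up when the second coordinate is divisible by the first one. -/
theorem blowUp_fst (h : C.ChartAt k Φ θ a) {Q : MvPowerSeries (Fin 2) ℂ} (hQ : θ 1 = θ 0 * Q)
    (h0 : subst a (θ 0) ≠ 0) :
    C.ChartAt (k + 1) Φ ![θ 0, Q - MvPowerSeries.C (constantCoeff Q)] a ∧
      (C.point (k + 1)).onX = some (k + 1) ∧
      (C.point (k + 1)).onY = if constantCoeff Q = 0 then (C.point k).onY else none := by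
  classical
  have hsa := hasSubst_of_constantCoeff_zero h.arc_zero
  have hy : (C.point k).y = (C.point k).x * subst a Q := by
    rw [h.x_eq, h.y_eq, hQ, subst_mul hsa]
  have hx0 : (C.point k).x ≠ 0 := by rw [h.x_eq]; exact h0
  have hle : (C.point k).x.order ≤ (C.point k).y.order := by
    rw [hy, PowerSeries.order_mul]
    exact le_self_add
  have hquot : seriesQuot (C.point k).y (C.point k).x = subst a Q := seriesQuot_eq hx0 hy
  have hslope : (C.point k).slope = constantCoeff Q := by
    rw [NearPoint.slope, hquot]
    exact constantCoeff_subst_of_constantCoeff_zero h.arc_zero Q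
  have hpt : C.point (k + 1) =
      { x := (C.point k).x
        y := seriesQuot (C.point k).y (C.point k).x - PowerSeries.C (C.point k).slope
        onX := some (k + 1)
        onY := if (C.point k).slope = 0 then (C.point k).onY else none } := by
    rw [point, NearPoint.blowUp, if_pos hle]
  have hchart : (C.point k).chart = ![X 0, X 0 * (X 1 + MvPowerSeries.C (constantCoeff Q))] := by
    rw [NearPoint.chart, if_pos hle, hslope]
  have hz : ∀ l, constantCoeff ((![θ 0, Q - MvPowerSeries.C (constantCoeff Q)] :
      Fin 2 → MvPowerSeries (Fin 2) ℂ) l) = 0 := by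
    intro l
    fin_cases l
    · exact h.coord_zero 0
    · simp
  have hsz := hasSubst_of_constantCoeff_zero hz
  refine ⟨⟨h.map_zero, hz, h.arc_zero, ?_, ?_, fun ω => ?_⟩, ?_, ?_⟩
  · rw [hpt]
    exact h.x_eq
  · rw [hpt]
    simp only [hquot, hslope]
    exact ((subst_sub hsa _ _).trans (by rw [subst_C]; rfl)).symm
  · rw [totalPullback, hchart, OneForm.pullback_pullback _ hz, ← h.pull]
    · congr 1
      funext l
      fin_cases l
      · exact subst_X hsz 0
      · refine (subst_mul hsz _ _).trans ?_
        rw [subst_add hsz, subst_X hsz, subst_X hsz, subst_C]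
        simp [hQ]
    · intro l
      fin_cases l <;> simp
  · rw [hpt]
  · rw [hpt, hslope]

/-- Blowing up when the first coordinate is divisible by the second one, and the tangents differ. -/
theorem blowUp_snd (h : C.ChartAt k Φ θ a) {Q : MvPowerSeries (Fin 2) ℂ} (hQ : θ 0 = θ 1 * Q)
    (hQ0 : constantCoeff Q = 0) (h0 : subst a (θ 1) ≠ 0) :
    C.ChartAt (k + 1) Φ ![Q, θ 1] a ∧
      (C.point (k + 1)).onX = (C.point k).onX ∧ (C.point (k + 1)).onY = some (k + 1) := by
  classical
  have hsa := hasSubst_of_constantCoeff_zero h.arc_zero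
  have hx : (C.point k).x = (C.point k).y * subst a Q := by
    rw [h.x_eq, h.y_eq, hQ, subst_mul hsa]
  have hy0 : (C.point k).y ≠ 0 := by rw [h.y_eq]; exact h0
  have hle : ¬ (C.point k).x.order ≤ (C.point k).y.order := by
    rw [hx, PowerSeries.order_mul]
    intro hcon
    have h1 : (C.point k).y.order ≠ ⊤ := (PowerSeries.order_finite_iff_ne_zero.2 hy0).ne
    have h2 : PowerSeries.order (subst a Q : PowerSeries ℂ) ≤ 0 := by
      have h3 : (C.point k).y.order + PowerSeries.order (subst a Q : PowerSeries ℂ) ≤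
        (C.point k).y.order + 0 := by simpa using hcon
      exact (ENat.add_le_add_iff_left h1).1 h3
    have h4 : PowerSeries.order (subst a Q : PowerSeries ℂ) ≠ 0 := by
      rw [PowerSeries.order_ne_zero_iff_constCoeff_eq_zero]
      exact (constantCoeff_subst_of_constantCoeff_zero h.arc_zero Q).trans hQ0
    exact h4 (nonpos_iff_eq_zero.1 h2)
  have hquot : seriesQuot (C.point k).x (C.point k).y = subst a Q := seriesQuot_eq hy0 hx
  have hpt : C.point (k + 1) =
      { x := seriesQuot (C.point k).x (C.point k).y
        y := (C.point k).y
        onX := (C.point k).onX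
        onY := some (k + 1) } := by
    rw [point, NearPoint.blowUp, if_neg hle]
  have hchart : (C.point k).chart = ![X 0 * X 1, X 1] := by
    rw [NearPoint.chart, if_neg hle]
  have hz : ∀ l, constantCoeff ((![Q, θ 1] : Fin 2 → MvPowerSeries (Fin 2) ℂ) l) = 0 := by
    intro l
    fin_cases l
    · exact hQ0
    · exact h.coord_zero 1
  have hsz := hasSubst_of_constantCoeff_zero hz
  refine ⟨⟨h.map_zero, hz, h.arc_zero, ?_, ?_, fun ω => ?_⟩, ?_, ?_⟩
  · rw [hpt]
    exact hquot
  · rw [hpt]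
    exact h.y_eq
  · rw [totalPullback, hchart, OneForm.pullback_pullback _ hz, ← h.pull]
    · congr 1
      funext l
      fin_cases l
      · refine (subst_mul hsz _ _).trans ?_
        rw [subst_X hsz, subst_X hsz]
        simp [hQ, mul_comm]
      · exact subst_X hsz 1
    · intro l
      fin_cases l <;> simp
  · rw [hpt]
  · rw [hpt]

end ChartAt

end PlaneBranch

end

section

open MvPowerSeries

namespace PlaneBranch

variable (C : PlaneBranch)

/-! ### Satellite points and the Euclidean algorithm -/

/-- Two components of the exceptional divisor pass through `O_k`. -/
def Satellite (k : ℕ) : Prop := (C.point k).onX ≠ none ∧ (C.point k).onY ≠ none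

/-- The arc whose image under the `j`-th family is the branch, in the coordinates `T` and
`Z = w - c_{β_j}`. -/
noncomputable def arc (j : ℕ) : Fin 2 → MvPowerSeries Unit ℂ :=
  ![(PowerSeries.X ^ C.e j : PowerSeries ℂ),
    (PowerSeries.mk fun k => if k = 0 then 0 else C.c (k + C.β j) : PowerSeries ℂ)]

theorem constantCoeff_arc (j : ℕ) (l : Fin 2) : constantCoeff (C.arc j l) = 0 := by
  fin_cases l
  · exact (map_pow PowerSeries.constantCoeff PowerSeries.X (C.e j)).trans
      (by simp [(C.e_pos j).ne'])
  · have h : PowerSeries.constantCoeff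
        (PowerSeries.mk fun k => if k = 0 then 0 else C.c (k + C.β j)) = 0 := by
      rw [← PowerSeries.coeff_zero_eq_constantCoeff_apply, PowerSeries.coeff_mk, if_pos rfl]
    exact h

theorem subst_arc_X_zero (j : ℕ) : subst (C.arc j) (X 0 : MvPowerSeries (Fin 2) ℂ) =
    (PowerSeries.X ^ C.e j : PowerSeries ℂ) :=
  subst_X (hasSubst_of_constantCoeff_zero (C.constantCoeff_arc j)) 0

theorem order_subst_arc (j N : ℕ) {f : MvPowerSeries (Fin 2) ℂ} (hf : constantCoeff f ≠ 0) :
    PowerSeries.order (subst (C.arc j) (X 0 ^ N * f) : PowerSeries ℂ) = (C.e j * N : ℕ) := by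
  have hs := hasSubst_of_constantCoeff_zero (C.constantCoeff_arc j)
  have h1 : (subst (C.arc j) (X 0 ^ N * f) : PowerSeries ℂ) =
      PowerSeries.X ^ (C.e j * N) * (subst (C.arc j) f : PowerSeries ℂ) := by
    rw [subst_mul hs, subst_pow hs, C.subst_arc_X_zero, pow_mul]
  rw [h1, PowerSeries.order_mul, PowerSeries.order_X_pow, PowerSeries.order_zero_of_unit, add_zero]
  rw [PowerSeries.isUnit_iff_constantCoeff]
  refine IsUnit.mk0 _ ?_
  have := constantCoeff_subst_of_constantCoeff_zero (C.constantCoeff_arc j) f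
  exact fun h => hf (this.symm.trans h)

theorem subst_arc_ne_zero (j N : ℕ) {f : MvPowerSeries (Fin 2) ℂ} (hf : constantCoeff f ≠ 0) :
    subst (C.arc j) (X 0 ^ N * f) ≠ 0 := by
  intro h
  have := C.order_subst_arc j N hf
  rw [h] at this
  exact absurd (PowerSeries.order_zero.symm.trans this).symm (ENat.natCast_ne_top _)

/-- The Euclidean algorithm: starting from a satellite point with coordinates `T ^ A · unit` and
`T ^ B · unit`, blowing up leads through satellite points to a free point. The determinant condition
on the logarithmic derivatives of the units is invariant under the blow-ups. -/
theorem exists_free_of_satellite {j : ℕ} {Φ : Fin 2 → MvPowerSeries (Fin 2) ℂ} (s : ℕ) :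
    ∀ {k A B : ℕ} {θ : Fin 2 → MvPowerSeries (Fin 2) ℂ} {p q : MvPowerSeries (Fin 2) ℂ},
    A + B ≤ s → 0 < A → 0 < B → Nat.Coprime A B → C.ChartAt k Φ θ (C.arc j) →
    θ 0 = X 0 ^ A * p → θ 1 = X 0 ^ B * q → constantCoeff p ≠ 0 → constantCoeff q ≠ 0 →
    A * constantCoeff p * constantCoeff (pderiv ℂ 1 q) -
      B * constantCoeff q * constantCoeff (pderiv ℂ 1 p) ≠ 0 → C.Satellite k →
    ∃ k' θ', k < k' ∧ C.ChartAt k' Φ θ' (C.arc j) ∧ PreservesLine θ' ∧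
      (C.point k').onX = some k' ∧ (C.point k').onY = none ∧
      ∀ l, k ≤ l → l < k' → C.Satellite l := by
  induction s with
  | zero => intros; omega
  | succ s ih =>
    intro k A B θ p q hs hA hB hcop hch h0 h1 hp hq hdet hsat
    rcases lt_trichotomy A B with hlt | heq | hlt
    · -- The second coordinate is divisible by the first one.
      set r := q * p⁻¹ with hr
      have hqr : q = p * r := by
        rw [hr, mul_left_comm, MvPowerSeries.mul_inv_cancel _ hp, mul_one]
      have hr0 : constantCoeff r ≠ 0 := fun h => hq (by rw [hqr, map_mul, h, mul_zero])
      have hQ : θ 1 = θ 0 * (X 0 ^ (B - A) * r) := by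
        rw [h0, h1, hqr]
        calc X 0 ^ B * (p * r) = X 0 ^ (A + (B - A)) * (p * r) := by
              rw [Nat.add_sub_cancel' hlt.le]
          _ = _ := by ring
      have hQ0 : constantCoeff (X 0 ^ (B - A) * r) = 0 := by
        have : B - A ≠ 0 := by omega
        simp [this]
      obtain ⟨hch', hx, hy⟩ := hch.blowUp_fst hQ (by rw [h0]; exact C.subst_arc_ne_zero j A hp)
      rw [hQ0, map_zero, sub_zero] at hch'
      rw [if_pos hQ0] at hy
      have hsat' : C.Satellite (k + 1) := ⟨by rw [hx]; simp, by rw [hy]; exact hsat.2⟩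
      obtain ⟨k', θ', hk', g1, g2, g3, g4, g5⟩ := ih (k := k + 1) (A := A) (B := B - A) (p := p)
        (q := r) (by omega) hA (by omega) ((Nat.coprime_sub_self_right hlt.le).2 hcop) hch'
        (by simp [h0]) (by simp) hp hr0 (by
          intro hcon
          apply hdet
          rw [hqr, Derivation.leibniz]
          simp only [smul_eq_mul, map_add, map_mul]
          rw [Nat.cast_sub hlt.le] at hcon
          linear_combination constantCoeff p * hcon) hsat'
      refine ⟨k', θ', by omega, g1, g2, g3, g4, fun l hl hl' => ?_⟩
      rcases Nat.lt_or_ge k l with h | h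
      · exact g5 l h hl'
      · rw [le_antisymm h hl]
        exact hsat
    · -- The coordinates have the same order, and the tangent is different from the axes.
      subst heq
      have hA1 : A = 1 := by simpa using hcop
      subst hA1
      set r := q * p⁻¹ with hr
      have hqr : q = p * r := by
        rw [hr, mul_left_comm, MvPowerSeries.mul_inv_cancel _ hp, mul_one]
      have hr0 : constantCoeff r ≠ 0 := fun h => hq (by rw [hqr, map_mul, h, mul_zero])
      have hQ : θ 1 = θ 0 * r := by
        rw [h0, h1, hqr, mul_assoc]
      obtain ⟨hch', hx, hy⟩ := hch.blowUp_fst hQ (by rw [h0]; exact C.subst_arc_ne_zero j 1 hp)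
      rw [if_neg hr0] at hy
      refine ⟨k + 1, _, Nat.lt_succ_self k, hch', ⟨⟨p, by simp [h0], hp⟩, by simp, ?_⟩, hx, hy,
        fun l hl hl' => ?_⟩
      · intro hcon
        apply hdet
        simp only [Matrix.cons_val_one, Matrix.cons_val_fin_one, map_sub, pderiv_C,
          sub_zero] at hcon
        rw [hqr, Derivation.leibniz]
        simp only [smul_eq_mul, map_add, map_mul, hcon]
        ring
      · rw [show l = k by omega]
        exact hsat
    · -- The first coordinate is divisible by the second one.
      set r := p * q⁻¹ with hr
      have hqr : p = q * r := by
        rw [hr, mul_left_comm, MvPowerSeries.mul_inv_cancel _ hq, mul_one]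
      have hr0 : constantCoeff r ≠ 0 := fun h => hp (by rw [hqr, map_mul, h, mul_zero])
      have hQ : θ 0 = θ 1 * (X 0 ^ (A - B) * r) := by
        rw [h0, h1, hqr]
        calc X 0 ^ A * (q * r) = X 0 ^ (B + (A - B)) * (q * r) := by
              rw [Nat.add_sub_cancel' hlt.le]
          _ = _ := by ring
      have hQ0 : constantCoeff (X 0 ^ (A - B) * r) = 0 := by
        have : A - B ≠ 0 := by omega
        simp [this]
      obtain ⟨hch', hx, hy⟩ := hch.blowUp_snd hQ hQ0
        (by rw [h1]; exact C.subst_arc_ne_zero j B hq)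
      have hsat' : C.Satellite (k + 1) := ⟨by rw [hx]; exact hsat.1, by rw [hy]; simp⟩
      obtain ⟨k', θ', hk', g1, g2, g3, g4, g5⟩ := ih (k := k + 1) (A := A - B) (B := B) (p := r)
        (q := q) (by omega) (by omega) hB ((Nat.coprime_sub_self_left hlt.le).2 hcop) hch'
        (by simp) (by simp [h1]) hr0 hq (by
          intro hcon
          apply hdet
          rw [hqr, Derivation.leibniz]
          simp only [smul_eq_mul, map_add, map_mul]
          rw [Nat.cast_sub hlt.le] at hcon
          linear_combination constantCoeff q * hcon) hsat'
      refine ⟨k', θ', by omega, g1, g2, g3, g4, fun l hl hl' => ?_⟩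
      rcases Nat.lt_or_ge k l with h | h
      · exact g5 l h hl'
      · rw [le_antisymm h hl]
        exact hsat

end PlaneBranch

end

section

open MvPowerSeries

/-! ### Power series in a power of one variable -/

/-- The inclusion of `ℂ⟦s⟧` into `ℂ⟦T, Z⟧` with `s = T ^ A`. -/
noncomputable def inclPow (A : ℕ) (hA : A ≠ 0) : PowerSeries ℂ →+* MvPowerSeries (Fin 2) ℂ :=
  expandHom (inclT ℂ) A hA

theorem inclPow_X (A : ℕ) (hA : A ≠ 0) : inclPow A hA PowerSeries.X = X 0 ^ A := by
  rw [inclPow, expandHom_apply, PowerSeries.expand_X, map_pow, inclT_X]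

theorem inclPow_C (A : ℕ) (hA : A ≠ 0) (z : ℂ) :
    inclPow A hA (PowerSeries.C z) = MvPowerSeries.C z := by
  rw [inclPow, expandHom_apply, PowerSeries.expand_C, inclT_C]
  rfl

theorem exists_inclPow_eq (A : ℕ) (hA : A ≠ 0) (V : PowerSeries ℂ) :
    ∃ V', inclPow A hA V = MvPowerSeries.C (PowerSeries.constantCoeff V) +
      X 0 ^ A * inclPow A hA V' := by
  obtain ⟨s, hs⟩ : PowerSeries.X ∣ V - PowerSeries.C (PowerSeries.constantCoeff V) := by
    rw [PowerSeries.X_dvd_iff, map_sub, PowerSeries.constantCoeff_C, sub_self]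
  refine ⟨s, ?_⟩
  rw [← inclPow_C A hA, ← inclPow_X A hA, ← map_mul, ← map_add, ← hs]
  congr 1
  ring

theorem constantCoeff_inclPow (A : ℕ) (hA : A ≠ 0) (V : PowerSeries ℂ) :
    constantCoeff (inclPow A hA V) = PowerSeries.constantCoeff V := by
  obtain ⟨V', h⟩ := exists_inclPow_eq A hA V
  rw [h]
  simp [hA]

theorem subst_inclT {b : Fin 2 → MvPowerSeries (Fin 2) ℂ} (hb : ∀ l, constantCoeff (b l) = 0)
    (A : ℕ) (hA : A ≠ 0) (hb0 : b 0 = X 0 ^ A) (p : PowerSeries ℂ) :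
    subst b (inclT ℂ p) = inclPow A hA p := by
  have hs := hasSubst_of_constantCoeff_zero hb
  have hX := PowerSeries.HasSubst.X (S := ℂ) (0 : Fin 2)
  rw [inclPow, expandHom_apply, inclT_apply, inclT_apply, PowerSeries.expand_apply,
    PowerSeries.subst_comp_subst_apply (PowerSeries.HasSubst.X_pow hA) hX, PowerSeries.subst_pow hX,
    PowerSeries.subst_X hX, PowerSeries.subst, subst_comp_subst_apply hX.const hs]
  simp only [subst_X hs, hb0]
  rfl

theorem exists_inclT_eq (g : PowerSeries ℂ) :
    ∃ t, inclT ℂ g = MvPowerSeries.C (PowerSeries.constantCoeff g) + X 0 * t := by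
  obtain ⟨t, ht⟩ : PowerSeries.X ∣ g - PowerSeries.C (PowerSeries.constantCoeff g) := by
    rw [PowerSeries.X_dvd_iff, map_sub, PowerSeries.constantCoeff_C, sub_self]
  refine ⟨inclT ℂ t, ?_⟩
  have h2 := inclT_C (R := ℂ) (PowerSeries.constantCoeff g)
  rw [Algebra.algebraMap_self, RingHom.id_apply] at h2
  rw [← inclT_X, ← map_mul, ← h2, ← map_add, ← ht]
  congr 1
  ring

theorem exists_eq_inclT_add (f : MvPowerSeries (Fin 2) ℂ) :
    ∃ (p : PowerSeries ℂ) (S : MvPowerSeries (Fin 2) ℂ), f = inclT ℂ p + X 1 * S ∧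
      PowerSeries.constantCoeff p = constantCoeff f := by
  classical
  set p : PowerSeries ℂ := PowerSeries.mk fun k => coeff (Finsupp.single 0 k) f with hp
  obtain ⟨S, hS⟩ : X 1 ∣ f - inclT ℂ p := by
    refine X_dvd_iff.2 fun m hm => ?_
    have h1 : m = Finsupp.single 0 (m 0) := by
      ext l
      fin_cases l <;> simp [hm]
    rw [map_sub, inclT_apply, PowerSeries.coeff_subst_single, if_pos h1, hp, PowerSeries.coeff_mk,
      ← h1, sub_self]
  refine ⟨p, S, by rw [← hS]; ring, ?_⟩
  rw [← PowerSeries.coeff_zero_eq_constantCoeff_apply, hp, PowerSeries.coeff_mk,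
    Finsupp.single_zero, coeff_zero_eq_constantCoeff_apply]

/-- First order expansion of `f(T ^ A, γ(T ^ A) + T ^ B w)`. -/
theorem exists_subst_eq (f : MvPowerSeries (Fin 2) ℂ) {A B : ℕ} (hA : A ≠ 0) (hB : B ≠ 0)
    {γ : PowerSeries ℂ} (hγ : PowerSeries.constantCoeff γ = 0) (w : MvPowerSeries (Fin 2) ℂ) :
    ∃ (p : PowerSeries ℂ) (s : MvPowerSeries (Fin 2) ℂ),
      subst ![X 0 ^ A, inclPow A hA γ + X 0 ^ B * w] f = inclPow A hA p +
        X 0 ^ B * (w * (MvPowerSeries.C (constantCoeff (pderiv ℂ 1 f)) + X 0 * s)) ∧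
      PowerSeries.constantCoeff p = constantCoeff f := by
  classical
  -- The substitution factors through the shear `(T, γ(T) + Z)`.
  set sh : Fin 2 → MvPowerSeries (Fin 2) ℂ := ![X 0, inclT ℂ γ + X 1] with hsh
  set mo : Fin 2 → MvPowerSeries (Fin 2) ℂ := ![X 0 ^ A, X 0 ^ B * w] with hmo
  have hsh0 : ∀ l, constantCoeff (sh l) = 0 := by
    intro l
    fin_cases l
    · simp [hsh]
    · simp [hsh, constantCoeff_inclT γ hγ]
  have hmo0 : ∀ l, constantCoeff (mo l) = 0 := by
    intro l
    fin_cases l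
    · simp [hmo, hA]
    · simp [hmo, hB]
  have hss := hasSubst_of_constantCoeff_zero hsh0
  have hsm := hasSubst_of_constantCoeff_zero hmo0
  have hcomp : subst ![X 0 ^ A, inclPow A hA γ + X 0 ^ B * w] f = subst mo (subst sh f) := by
    rw [subst_comp_subst_apply hss hsm]
    congr 1
    funext l
    fin_cases l
    · exact (subst_X hsm 0).symm
    · refine Eq.symm ((subst_add hsm _ _).trans ?_)
      rw [subst_inclT hmo0 A hA rfl, subst_X hsm]
      rfl
  set f' := subst sh f with hf'
  obtain ⟨p, S, hf'S, hpf'⟩ := exists_eq_inclT_add f'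
  have hpc : PowerSeries.constantCoeff p = constantCoeff f := by
    rw [hpf', hf', constantCoeff_subst_of_constantCoeff_zero hsh0]
  have hX : pderiv ℂ (1 : Fin 2) (X 0 : MvPowerSeries (Fin 2) ℂ) = 0 := pderiv_X_of_ne (by decide)
  have hdinc : ∀ g : PowerSeries ℂ, constantCoeff (pderiv ℂ (1 : Fin 2) (inclT ℂ g)) = 0 :=
    fun g => by
      obtain ⟨t, ht⟩ := exists_inclT_eq g
      rw [ht]
      simp [hX]
  have hS0 : constantCoeff S = constantCoeff (pderiv ℂ 1 f) := by
    have h1 : constantCoeff (pderiv ℂ (1 : Fin 2) f') = constantCoeff S := by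
      rw [hf'S, map_add, Derivation.leibniz, pderiv_X_self, map_add, hdinc]
      simp
    have h2 : constantCoeff (pderiv ℂ (1 : Fin 2) f') = constantCoeff (pderiv ℂ 1 f) := by
      rw [hf', pderiv_subst hsh0, Fin.sum_univ_two]
      have h3 : constantCoeff (subst sh (pderiv ℂ (1 : Fin 2) f)) =
          constantCoeff (pderiv ℂ (1 : Fin 2) f) :=
        constantCoeff_subst_of_constantCoeff_zero hsh0 _
      have h4 : pderiv ℂ (1 : Fin 2) (sh 0) = 0 := hX
      have h5 : constantCoeff (pderiv ℂ (1 : Fin 2) (sh 1)) = 1 := by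
        simp [hsh, hdinc, pderiv_X_self]
      rw [h4, mul_zero, zero_add, map_mul, h3, h5, mul_one]
    rw [← h1, h2]
  have hdvd : X 0 ∣ subst mo (S - MvPowerSeries.C (constantCoeff S)) := by
    obtain ⟨p', S', hS', hp'⟩ := exists_eq_inclT_add (S - MvPowerSeries.C (constantCoeff S))
    obtain ⟨t, ht⟩ := exists_inclPow_eq A hA p'
    rw [map_sub, constantCoeff_C, sub_self] at hp'
    rw [hS', subst_add hsm, subst_inclT hmo0 A hA rfl, subst_mul hsm, subst_X hsm, ht, hp',
      map_zero, zero_add]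
    exact dvd_add ((dvd_pow_self _ hA).mul_right _)
      (((dvd_pow_self (X 0) hB).mul_right w).mul_right _)
  obtain ⟨s, hs⟩ := hdvd
  rw [subst_sub hsm, subst_C, sub_eq_iff_eq_add, hS0] at hs
  refine ⟨p, s, ?_, hpc⟩
  rw [hcomp, hf'S, subst_add hsm, subst_inclT hmo0 A hA rfl, subst_mul hsm, subst_X hsm, hs]
  have : mo 1 = X 0 ^ B * w := rfl
  rw [this]
  ring

end

section

open MvPowerSeries

namespace PlaneBranch

variable (C : PlaneBranch)

/-! ### Free points -/

theorem not_resolved_of_satellite {k : ℕ} (h : C.Satellite k) : ¬ (C.point k).Resolved := by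
  rintro ⟨-, h' | h', -⟩
  · exact h.1 h'
  · exact h.2 h'

/-- The blow-ups between two consecutive triple points: as long as the order `B` of the first
characteristic term exceeds that of the exceptional coordinate, the points are free; afterwards the
Euclidean algorithm starts. -/
theorem exists_free_of_free {j : ℕ} {Φ : Fin 2 → MvPowerSeries (Fin 2) ℂ} {A : ℕ} (hA : A ≠ 0)
    (hA1 : A ≠ 1) {c : ℂ} (hc : c ≠ 0) (n : ℕ) :
    ∀ {k B : ℕ} {θ : Fin 2 → MvPowerSeries (Fin 2) ℂ} {V P : PowerSeries ℂ}
      {r t : MvPowerSeries (Fin 2) ℂ} {α : ℂ},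
    B ≤ n → B ≠ 0 → Nat.Coprime A B → C.ChartAt k Φ θ (C.arc j) →
    θ 0 = X 0 ^ A * (inclPow A hA V + X 0 ^ B * r) →
    θ 1 = inclPow A hA P +
      X 0 ^ B * ((MvPowerSeries.C c + X 1) * MvPowerSeries.C α + X 0 * t) →
    PowerSeries.constantCoeff V ≠ 0 → PowerSeries.constantCoeff P = 0 → α ≠ 0 →
    (C.point k).onX = some k → (C.point k).onY = none →
    ∃ m k' θ', k ≤ m ∧ m + 1 < k' ∧ C.ChartAt k' Φ θ' (C.arc j) ∧ PreservesLine θ' ∧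
      (C.point k').onX = some k' ∧ (C.point k').onY = none ∧
      (∀ l, k ≤ l → l ≤ m → (C.point l).onY = none ∧ ¬ (C.point l).Resolved) ∧
      ∀ l, m < l → l < k' → C.Satellite l := by
  have hX : pderiv ℂ (1 : Fin 2) (X 0 : MvPowerSeries (Fin 2) ℂ) = 0 := pderiv_X_of_ne (by decide)
  induction n with
  | zero => intros; omega
  | succ n ih =>
    intro k B θ V P r t α hBn hB hcop hch h0 h1 hV hP hα honX honY
    set D := inclPow A hA V + X 0 ^ B * r with hD
    have hD0 : constantCoeff D = PowerSeries.constantCoeff V := by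
      rw [hD, map_add, constantCoeff_inclPow]
      simp [hB]
    have hDne : constantCoeff D ≠ 0 := by rwa [hD0]
    have hDD := MvPowerSeries.mul_inv_cancel D hDne
    -- The exceptional coordinate has order `e_j A > 1` along the branch.
    have hres : ¬ (C.point k).Resolved := by
      rintro ⟨-, -, h, -⟩
      have h2 := h (by rw [honX]; simp)
      rw [hch.x_eq, h0, C.order_subst_arc j A hDne] at h2
      have h3 : C.e j * A = 1 := by exact_mod_cast h2
      exact hA1 (Nat.eq_one_of_mul_eq_one_left h3)
    obtain ⟨P', hP'⟩ : PowerSeries.X ∣ P := PowerSeries.X_dvd_iff.2 hP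
    have hPP : inclPow A hA P = X 0 ^ A * inclPow A hA P' := by
      rw [hP', map_mul, inclPow_X]
    have hAB : A ≠ B := by
      rintro rfl
      exact hA1 (by simpa using hcop)
    rcases Nat.lt_or_ge B A with hlt | hge
    · -- The first satellite point.
      obtain ⟨d, rfl⟩ := Nat.exists_eq_add_of_lt hlt
      set q := (MvPowerSeries.C c + X 1) * MvPowerSeries.C α +
        X 0 * (t + X 0 ^ d * inclPow (B + d + 1) hA P') with hq
      have h1' : θ 1 = X 0 ^ B * q := by rw [h1, hPP, hq]; ring
      have hq0 : constantCoeff q = c * α := by simp [hq]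
      have hqne : constantCoeff q ≠ 0 := by rw [hq0]; exact mul_ne_zero hc hα
      have hqq := MvPowerSeries.mul_inv_cancel q hqne
      have hQ : θ 0 = θ 1 * (X 0 ^ (d + 1) * (D * q⁻¹)) := by
        rw [h0, h1']
        linear_combination (-(X 0 ^ (B + d + 1) * D)) * hqq
      obtain ⟨hch', hx, hy⟩ := hch.blowUp_snd hQ (by simp)
        (by rw [h1']; exact C.subst_arc_ne_zero j B hqne)
      set p := D * q⁻¹ with hp
      have hDp : D = q * p := by linear_combination (-D) * hqq
      have hpne : constantCoeff p ≠ 0 := fun h => hDne (by rw [hDp, map_mul, h, mul_zero])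
      have hdD : constantCoeff (pderiv ℂ (1 : Fin 2) D) = 0 := by
        obtain ⟨V', hV'⟩ := exists_inclPow_eq (B + d + 1) hA V
        rw [hD, hV']
        simp only [map_add, Derivation.leibniz, Derivation.leibniz_pow, hX, pderiv_C]
        simp [hB]
      have hdq : constantCoeff (pderiv ℂ (1 : Fin 2) q) = α := by
        rw [hq]
        simp only [map_add, Derivation.leibniz, hX, pderiv_C, pderiv_X_self]
        simp
      have hsat : C.Satellite (k + 1) := ⟨by rw [hx, honX]; simp, by rw [hy]; simp⟩
      obtain ⟨k', θ', hk', g1, g2, g3, g4, g5⟩ := C.exists_free_of_satellite (j := j) (Φ := Φ)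
        (d + 1 + B) (k := k + 1) (A := d + 1) (B := B) (p := p) (q := q) le_rfl (by omega)
        (by omega) (by
          have h2 : B + d + 1 = d + 1 + B := by ring
          rw [h2] at hcop
          simpa using hcop) hch' rfl h1' hpne hqne (by
          -- `∂D = p ∂q + q ∂p = 0` at the origin.
          have h2 : constantCoeff q * constantCoeff (pderiv ℂ (1 : Fin 2) p) =
              -(constantCoeff p * constantCoeff (pderiv ℂ (1 : Fin 2) q)) := by
            rw [hDp, Derivation.leibniz] at hdD
            simp only [smul_eq_mul, map_add, map_mul] at hdD
            linear_combination hdD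
          rw [mul_assoc (B : ℂ), h2, hdq]
          have h3 : ((d + 1 : ℕ) : ℂ) * constantCoeff p * α - B * -(constantCoeff p * α) =
              ((d + 1 + B : ℕ) : ℂ) * (constantCoeff p * α) := by push_cast; ring
          rw [h3]
          exact mul_ne_zero (by exact_mod_cast (by omega)) (mul_ne_zero hpne hα)) hsat
      refine ⟨k, k', θ', le_rfl, hk', g1, g2, g3, g4, fun l hl hl' => ?_, fun l hl hl' =>
        g5 l hl hl'⟩
      rw [show l = k by omega]
      exact ⟨honY, hres⟩
    · -- Another free point.
      have hgt : A < B := lt_of_le_of_ne hge hAB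
      obtain ⟨d, rfl⟩ := Nat.exists_eq_add_of_lt hgt
      set v' := inclPow A hA V⁻¹ with hv'
      have hvv : inclPow A hA V * v' = 1 := by
        rw [hv', ← map_mul, PowerSeries.mul_inv_cancel _ hV, map_one]
      set δ := (PowerSeries.constantCoeff V)⁻¹ with hδ
      obtain ⟨z, hz⟩ : ∃ z, D⁻¹ = MvPowerSeries.C δ + X 0 * z := by
        obtain ⟨V', hV'⟩ := exists_inclPow_eq A hA V
        obtain ⟨A', hA'⟩ := Nat.exists_eq_succ_of_ne_zero hA
        have hC : (MvPowerSeries.C (PowerSeries.constantCoeff V) : MvPowerSeries (Fin 2) ℂ) *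
            MvPowerSeries.C δ = 1 := by
          rw [← map_mul, hδ, mul_inv_cancel₀ hV, map_one]
        have hDX : D = MvPowerSeries.C (PowerSeries.constantCoeff V) +
            X 0 * (X 0 ^ A' * inclPow A hA V' + X 0 ^ (A + d) * r) := by
          rw [hD, hV']
          have : (X 0 : MvPowerSeries (Fin 2) ℂ) ^ A = X 0 * X 0 ^ A' := by
            rw [hA', pow_succ, mul_comm]
          linear_combination (inclPow A hA V') * this
        refine ⟨-(D⁻¹ * MvPowerSeries.C δ *
          (X 0 ^ A' * inclPow A hA V' + X 0 ^ (A + d) * r)), ?_⟩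
        linear_combination (-D⁻¹) * hC + (MvPowerSeries.C δ) * hDD - (D⁻¹ * MvPowerSeries.C δ) * hDX
      set P₁ := V⁻¹ * P' with hP₁
      set t' := z * ((MvPowerSeries.C c + X 1) * MvPowerSeries.C α) + D⁻¹ * t -
        X 0 ^ (A - 1) * (r * v' * D⁻¹ * inclPow A hA P') with ht'
      set Q := inclPow A hA P₁ +
        X 0 ^ (d + 1) * ((MvPowerSeries.C c + X 1) * MvPowerSeries.C (α * δ) + X 0 * t') with hQdef
      have hQ : θ 1 = θ 0 * Q := by
        have hXA : (X 0 : MvPowerSeries (Fin 2) ℂ) ^ A = X 0 * X 0 ^ (A - 1) := by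
          rw [← pow_succ', Nat.sub_add_cancel (Nat.pos_of_ne_zero hA)]
        have hPv : inclPow A hA P₁ = v' * inclPow A hA P' := by rw [hP₁, map_mul]
        have hCC : (MvPowerSeries.C (α * δ) : MvPowerSeries (Fin 2) ℂ) =
          MvPowerSeries.C α * MvPowerSeries.C δ := map_mul _ _ _
        -- `D⁻¹ = v' - T ^ B r v' D⁻¹`
        have hDinv : D⁻¹ = v' - X 0 ^ (A + d + 1) * r * v' * D⁻¹ := by
          linear_combination (-D⁻¹) * hvv + v' * hDD - (v' * D⁻¹) * hD
        have hQD : Q = D⁻¹ * (inclPow A hA P' +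
            X 0 ^ (d + 1) * ((MvPowerSeries.C c + X 1) * MvPowerSeries.C α + X 0 * t)) := by
          rw [hQdef, hPv, hCC, ht']
          have e1 : (X 0 : MvPowerSeries (Fin 2) ℂ) ^ (A + d + 1) =
            X 0 ^ (d + 1) * (X 0 * X 0 ^ (A - 1)) := by rw [← hXA]; ring
          rw [e1] at hDinv
          linear_combination (-(inclPow A hA P')) * hDinv -
            (X 0 ^ (d + 1) * (MvPowerSeries.C c + X 1) * MvPowerSeries.C α) * hz
        rw [h1, h0, hQD, hPP]
        linear_combination (-(X 0 ^ A * (inclPow A hA P' +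
          X 0 ^ (d + 1) * ((MvPowerSeries.C c + X 1) * MvPowerSeries.C α + X 0 * t)))) * hDD
      have hQ0 : constantCoeff Q = PowerSeries.constantCoeff P₁ := by
        rw [hQdef, map_add, constantCoeff_inclPow]
        simp
      obtain ⟨hch', hx, hy⟩ := hch.blowUp_fst hQ
        (by rw [h0]; exact C.subst_arc_ne_zero j A hDne)
      rw [honY, ite_self] at hy
      obtain ⟨m, k', θ', hm, hk', g1, g2, g3, g4, g5, g6⟩ := ih (k := k + 1) (B := d + 1) (V := V)
        (P := P₁ - PowerSeries.C (PowerSeries.constantCoeff P₁)) (r := X 0 ^ A * r) (t := t')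
        (α := α * δ) (by omega) (by omega) (by
          have h2 : A + d + 1 = A + (d + 1) := by ring
          rw [h2] at hcop
          simpa using hcop) hch' (by
          simp only [Matrix.cons_val_zero, h0, hD]
          ring) (by
          show Q - MvPowerSeries.C (constantCoeff Q) = _
          rw [hQ0, map_sub, inclPow_C, hQdef]
          ring) hV (by simp) (mul_ne_zero hα (inv_ne_zero hV)) hx hy
      refine ⟨m, k', θ', by omega, hk', g1, g2, g3, g4, fun l hl hl' => ?_, g6⟩
      rcases Nat.lt_or_ge k l with h | h
      · exact g5 l h hl'
      · rw [le_antisymm h hl]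
        exact ⟨honY, hres⟩

end PlaneBranch

end

section

open MvPowerSeries

namespace PlaneBranch

variable (C : PlaneBranch)

/-! ### Curvettes -/

theorem subst_arc_inclT (j : ℕ) (p : PowerSeries ℂ) :
    subst (C.arc j) (inclT ℂ p) = expandHom (RingHom.id _) (C.e j) (C.e_pos j).ne' p := by
  have hs := hasSubst_of_constantCoeff_zero (C.constantCoeff_arc j)
  have hX := PowerSeries.HasSubst.X (S := ℂ) (0 : Fin 2)
  rw [expandHom_apply, inclT_apply, PowerSeries.subst, subst_comp_subst_apply hX.const hs,
    PowerSeries.expand_apply]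
  simp only [C.subst_arc_X_zero]
  rfl

/-- `O_k` is a free point of the branch, lying on `E_k`, and the `j`-th family of arcs, centered at
`w = c_{β_j}`, is a family of curvettes of this component: it factors through a map `θ` to the local
coordinates at `O_k` that maps the line `T = 0` to `E_k`. -/
structure CurvettesAt (j k : ℕ) (θ : Fin 2 → MvPowerSeries (Fin 2) ℂ) : Prop where
  chart : C.ChartAt k (C.famMap j (C.c (C.β j))) θ (C.arc j)
  line : PreservesLine θ
  onX : (C.point k).onX = some k
  onY : (C.point k).onY = none

theorem chartAt_zero : C.ChartAt 0 X X ![(PowerSeries.X ^ C.n : PowerSeries ℂ), C.η] := by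
  have ha : ∀ l, constantCoeff ((![(PowerSeries.X ^ C.n : PowerSeries ℂ), C.η] :
      Fin 2 → MvPowerSeries Unit ℂ) l) = 0 := by
    intro l
    fin_cases l
    · exact (map_pow PowerSeries.constantCoeff PowerSeries.X C.n).trans (by simp [C.n_ne_zero])
    · have h : PowerSeries.constantCoeff C.η = 0 := by
        rw [← PowerSeries.coeff_zero_eq_constantCoeff_apply]
        exact C.c_eq_zero_of_le_n (Nat.zero_le _)
      exact h
  have hs := hasSubst_of_constantCoeff_zero ha
  exact ⟨fun l => constantCoeff_X l, fun l => constantCoeff_X l, ha, (subst_X hs 0).symm,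
    (subst_X hs 1).symm, fun ω => rfl⟩

theorem curvettesAt_zero : C.CurvettesAt 0 1 ![X 0, X 1] := by
  have hb : ∀ l, constantCoeff ((![X 0, X 0 * X 1] : Fin 2 → MvPowerSeries (Fin 2) ℂ) l) = 0 := by
    intro l
    fin_cases l <;> simp
  have hsb := hasSubst_of_constantCoeff_zero hb
  have hs := hasSubst_of_constantCoeff_zero (C.constantCoeff_arc 0)
  have hfam : C.famMap 0 (C.c (C.β 0)) = ![X 0, X 0 * X 1] := by
    rw [famMap, famY, head_zero, map_zero, zero_add, inclT_X, e_zero, β_zero,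
      Nat.div_self C.n_pos, pow_one, c_n, map_zero, zero_add]
  have hη : C.η = PowerSeries.X ^ C.n *
      PowerSeries.mk fun k => if k = 0 then 0 else C.c (k + C.n) := by
    ext k
    rw [PowerSeries.coeff_X_pow_mul', PowerSeries.coeff_mk]
    split_ifs with h h'
    · exact C.c_eq_zero_of_le_n (by omega)
    · rw [Nat.sub_add_cancel h]
      rfl
    · exact C.c_eq_zero_of_le_n (by omega)
  have h := C.chartAt_zero.reparametrize hb (C.constantCoeff_arc 0) (fun l => by
    fin_cases l
    · exact (C.subst_arc_X_zero 0).symm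
    · refine Eq.symm ((subst_mul hs _ _).trans ?_)
      rw [C.subst_arc_X_zero, subst_X hs]
      exact hη.symm)
  have hX : (fun l => subst ![X 0, X 0 * X 1] (X l : MvPowerSeries (Fin 2) ℂ)) =
      (![X 0, X 0 * X 1] : Fin 2 → MvPowerSeries (Fin 2) ℂ) := by
    funext l
    exact subst_X hsb l
  rw [hX, ← hfam] at h
  obtain ⟨h1, h2, h3⟩ := h.blowUp_fst (Q := X 1) (by rw [hfam]; simp) (by
    rw [hfam]
    simpa using C.subst_arc_ne_zero 0 1 (f := 1) (by simp))
  rw [hfam] at h1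
  rw [constantCoeff_X, if_pos rfl] at h3
  rw [constantCoeff_X, map_zero, sub_zero] at h1
  refine ⟨?_, ⟨⟨1, by simp⟩, by simp, by simp [pderiv_X_self]⟩, h2, h3⟩
  rw [hfam]
  exact h1

theorem not_resolved_zero (hg : 0 < C.g) : ¬ (C.point 0).Resolved := by
  rintro ⟨h, -⟩
  have hn : C.n ≠ 1 := C.e_ne_one hg
  have h1 : ((2 : ℕ) : ℕ∞) ≤ (C.point 0).x.order := by
    have : (C.point 0).x.order = C.n := PowerSeries.order_X_pow C.n
    rw [this]
    have := C.n_pos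
    exact_mod_cast (by omega : 2 ≤ C.n)
  have h2 : ((2 : ℕ) : ℕ∞) ≤ (C.point 0).y.order := by
    refine PowerSeries.nat_le_order _ _ fun i hi => ?_
    exact C.c_eq_zero_of_le_n (by have := C.n_pos; omega)
  have h3 := le_min h1 h2
  rw [h] at h3
  exact absurd h3 (by decide)

/-- The terms of `η` from `β_j` up to `β_{j+1}` have exponents divisible by `e_j`, so that after
division by `t ^ β_j` they form a series in `T ^ (e_j / e_{j+1})` with constant term `c_{β_j}`. -/
theorem exists_expand_headTail {j : ℕ} (hj : j < C.g) :
    ∃ γ : PowerSeries ℂ, PowerSeries.constantCoeff γ = 0 ∧ ∀ (A : Type) [CommRing A]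
      (ε : PowerSeries ℂ →+* A), ε (C.headTail j (j + 1)) = ε (PowerSeries.C (C.c (C.β j))) +
        expandHom ε (C.e j / C.e (j + 1)) (C.e_div_e_ne_zero j.le_succ) γ := by
  set A := C.e j / C.e (j + 1) with hA
  have hA0 : A ≠ 0 := C.e_div_e_ne_zero j.le_succ
  set γ : PowerSeries ℂ := PowerSeries.mk fun k => PowerSeries.coeff (A * k) (C.headTail j (j + 1))
    with hγ
  have hexp : PowerSeries.expand A hA0 γ = C.headTail j (j + 1) := by
    ext k
    by_cases hd : A ∣ k
    · obtain ⟨l, rfl⟩ := hd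
      rw [PowerSeries.coeff_expand_mul, hγ, PowerSeries.coeff_mk]
    · rw [PowerSeries.coeff_expand_of_not_dvd _ _ _ hd, headTail, PowerSeries.coeff_mk, coeff_head]
      split_ifs with hlt
      · by_contra hc
        have h1 := C.e_dvd_of_lt_β hlt (Ne.symm hc)
        rw [mul_add, C.e_mul_β_div j.le_succ] at h1
        have h2 := (Nat.dvd_add_left (C.e_dvd_β j)).1 h1
        rw [← C.e_mul_div j.le_succ] at h2
        exact hd (Nat.dvd_of_mul_dvd_mul_left (C.e_pos (j + 1)) h2)
      · rfl
  have hc : PowerSeries.constantCoeff γ = C.c (C.β j) := by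
    rw [← C.constantCoeff_headTail j.lt_succ_self hj, ← hexp, PowerSeries.constantCoeff_expand]
  refine ⟨γ - PowerSeries.C (C.c (C.β j)), by simp [hc], fun S _ ε => ?_⟩
  rw [expandHom_apply, map_sub, hexp, PowerSeries.expand_C, map_sub]
  ring

/-- The blow-ups between two consecutive free points with families of curvettes. -/
theorem CurvettesAt.exists_succ {j k : ℕ} {θ : Fin 2 → MvPowerSeries (Fin 2) ℂ}
    (h : C.CurvettesAt j k θ) (hj : j < C.g) :
    ∃ m k' θ', k ≤ m ∧ m + 1 < k' ∧ C.CurvettesAt (j + 1) k' θ' ∧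
      (∀ l, k ≤ l → l ≤ m → (C.point l).onY = none ∧ ¬ (C.point l).Resolved) ∧
      ∀ l, m < l → l < k' → C.Satellite l := by
  obtain ⟨γ, hγ0, hγ⟩ := C.exists_expand_headTail hj
  set A := C.e j / C.e (j + 1) with hAdef
  have hA : A ≠ 0 := C.e_div_e_ne_zero j.le_succ
  have heA : C.e (j + 1) * A = C.e j := C.e_mul_div j.le_succ
  have hA1 : A ≠ 1 := fun h1 => by
    have := C.e_succ_lt (C.e_ne_one hj)
    rw [h1] at heA
    omega
  set B := C.β (j + 1) / C.e (j + 1) - C.β j / C.e (j + 1) with hBdef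
  have hβ := C.β_lt_succ hj
  have hB : C.β (j + 1) / C.e (j + 1) = B + C.β j / C.e (j + 1) :=
    (Nat.sub_add_cancel (Nat.div_le_div_right hβ.le)).symm
  have hpow : C.β j / C.e (j + 1) = A * (C.β j / C.e j) := by
    apply Nat.eq_of_mul_eq_mul_left (C.e_pos (j + 1))
    rw [← mul_assoc, heA, C.e_mul_β_div le_rfl, C.e_mul_β_div j.le_succ]
  have hB0 : B ≠ 0 := fun h0 => by
    have h1 := C.e_mul_β_div (le_refl (j + 1))
    rw [hB, h0, zero_add, C.e_mul_β_div j.le_succ] at h1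
    omega
  have hcop : Nat.Coprime A B := by
    have h1 := Nat.coprime_div_gcd_div_gcd (m := C.e j) (n := C.β (j + 1))
      (Nat.gcd_pos_of_pos_left _ (C.e_pos j))
    rw [← C.e_succ, hB, hpow] at h1
    exact (Nat.coprime_add_mul_left_right _ _ _).1 h1
  set u := C.c (C.β j) with hu
  set c' := C.c (C.β (j + 1)) with hc'
  set w : MvPowerSeries (Fin 2) ℂ := MvPowerSeries.C c' + X 1 with hw
  set b : Fin 2 → MvPowerSeries (Fin 2) ℂ := ![X 0 ^ A, inclPow A hA γ + X 0 ^ B * w] with hb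
  have hb0 : ∀ l, constantCoeff (b l) = 0 := by
    intro l
    fin_cases l
    · simp [hb, hA]
    · simp [hb, constantCoeff_inclPow, hγ0, hB0]
  have hsb := hasSubst_of_constantCoeff_zero hb0
  have hb1 : MvPowerSeries.C u + b 1 = inclT ℂ (C.headTail j (j + 1)) + X 0 ^ B * w := by
    have h1 := inclT_C (R := ℂ) u
    rw [Algebra.algebraMap_self, RingHom.id_apply] at h1
    have h2 : b 1 = inclPow A hA γ + X 0 ^ B * w := rfl
    rw [hγ, h1, h2, inclPow]
    ring
  have hmap : (fun l => subst b (C.famMap j u l)) = C.famMap (j + 1) c' := by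
    have hX0 : subst b (X 0 : MvPowerSeries (Fin 2) ℂ) = X 0 ^ A := subst_X hsb 0
    have hX1 : subst b (X 1 : MvPowerSeries (Fin 2) ℂ) = b 1 := subst_X hsb 1
    funext l
    fin_cases l
    · refine (subst_pow hsb _ _).trans ?_
      rw [hX0, ← pow_mul]
      exact congrArg (fun q => (X 0 : MvPowerSeries (Fin 2) ℂ) ^ q) (C.n_div_e_eq j.le_succ).symm
    · refine Eq.trans ?_ (C.famY_eq j.lt_succ_self hj (inclT ℂ) w).symm
      have h1 : inclT ℂ PowerSeries.X ^
          (C.β (j + 1) / C.e (j + 1) - C.β j / C.e (j + 1)) = X 0 ^ B := by rw [inclT_X]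
      rw [h1, ← hb1]
      refine (subst_add hsb _ _).trans ?_
      rw [subst_inclT hb0 A hA rfl, inclT_X, subst_mul hsb, subst_pow hsb, subst_add hsb, hX0, hX1,
        subst_C, famY]
      congr 2
      exact (congrArg (fun q => q ^ (C.β j / C.e j)) (inclPow_X A hA)).symm
  have harc0 := C.constantCoeff_arc (j + 1)
  have hsa := hasSubst_of_constantCoeff_zero harc0
  have harc : ∀ l, C.arc j l = subst (C.arc (j + 1)) (b l) := by
    intro l
    fin_cases l
    · refine Eq.symm ((subst_pow hsa _ _).trans ?_)
      rw [C.subst_arc_X_zero, ← pow_mul, heA]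
      rfl
    · -- Both families contain the branch.
      have h1 := (C.famY_branch (j + 1)).trans (C.famY_branch j).symm
      rw [C.famY_eq j.lt_succ_self hj,
        expandHom_expandHom (RingHom.id _) _ _ (C.e_pos j).ne' heA.symm, famY, famY,
        add_right_inj] at h1
      have hEX : ∀ i, expandHom (RingHom.id (PowerSeries ℂ)) (C.e i) (C.e_pos i).ne'
          PowerSeries.X = PowerSeries.X ^ C.e i := fun i => by
        rw [expandHom_apply, PowerSeries.expand_X, RingHom.id_apply]
      rw [hEX, hEX] at h1
      have h2 := mul_left_cancel₀
        (pow_ne_zero _ (pow_ne_zero _ (PowerSeries.X_ne_zero (R := ℂ)))) h1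
      have h3 : ∀ i, (C.arc i 1 : PowerSeries ℂ) = (PowerSeries.mk fun k => C.c (k + C.β i)) -
          PowerSeries.C (C.c (C.β i)) := by
        intro i
        refine PowerSeries.ext fun k => ?_
        rw [map_sub, PowerSeries.coeff_mk, PowerSeries.coeff_C]
        refine (PowerSeries.coeff_mk k fun l => if l = 0 then (0 : ℂ) else C.c (l + C.β i)).trans ?_
        split_ifs with hk
        · rw [hk, zero_add, sub_self]
        · rw [sub_zero]
      have h4 : subst (C.arc (j + 1)) (MvPowerSeries.C u + b 1) =
          (PowerSeries.mk fun k => C.c (k + C.β j) : PowerSeries ℂ) := by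
        rw [hb1, ← h2, subst_add hsa, subst_mul hsa, subst_pow hsa, C.subst_arc_inclT,
          C.subst_arc_X_zero, hw, subst_add hsa, subst_X hsa, subst_C]
        congr 2
        have h5 := h3 (j + 1)
        rw [eq_sub_iff_add_eq'] at h5
        exact h5
      rw [subst_add hsa, subst_C] at h4
      refine (h3 j).trans ?_
      rw [sub_eq_iff_eq_add']
      exact h4.symm
  have hch := h.chart.reparametrize hb0 harc0 harc
  rw [hmap] at hch
  obtain ⟨U, hU, hU0⟩ := h.line.dvd
  obtain ⟨V, s, hV, hV0⟩ := exists_subst_eq U hA hB0 hγ0 w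
  obtain ⟨P, t, hP, hP0⟩ := exists_subst_eq (θ 1) hA hB0 hγ0 w
  obtain ⟨m, k', θ', h1, h2, h3, h4, h5, h6, h7, h8⟩ := C.exists_free_of_free (j := j + 1) hA hA1
    (c := c') (C.c_β_ne_zero hj) B (V := V) (P := P)
    (r := w * (MvPowerSeries.C (constantCoeff (pderiv ℂ 1 U)) + X 0 * s)) (t := w * t)
    le_rfl hB0 hcop hch (by
      rw [hU, subst_mul hsb, subst_X hsb, hV]
      rfl) (by
      refine hP.trans ?_
      rw [mul_add]
      ring) (by rwa [hV0]) (by rw [hP0]; exact h.line.constantCoeff_one) h.line.pderiv_one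
      h.onX h.onY
  exact ⟨m, k', θ', h1, h2, ⟨h3, h4, h5, h6⟩, h7, h8⟩

end PlaneBranch

end

/-! ### The dual graph of the resolution -/

section

namespace PlaneBranch

variable (C : PlaneBranch)

/-- The components of the exceptional divisor through `O_k`. -/
noncomputable def components (k : ℕ) : Finset ℕ :=
  (C.point k).onX.toFinset ∪ (C.point k).onY.toFinset

theorem mem_components {k a : ℕ} : a ∈ C.components k ↔ (C.point k).Through a := by
  simp [components, NearPoint.Through]

theorem point_succ (k : ℕ) : C.point (k + 1) = (C.point k).blowUp (k + 1) := rfl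

theorem self_mem_components (k : ℕ) : k + 1 ∈ C.components (k + 1) := by
  classical
  rw [mem_components, point_succ, NearPoint.blowUp, NearPoint.Through]
  split_ifs <;> simp

theorem components_succ_subset (k : ℕ) :
    C.components (k + 1) ⊆ insert (k + 1) (C.components k) := by
  classical
  intro a
  rw [Finset.mem_insert, mem_components, mem_components, point_succ, NearPoint.blowUp,
    NearPoint.Through, NearPoint.Through]
  split_ifs <;> simp <;> grind

theorem bounds_of_mem_components {k a : ℕ} (h : a ∈ C.components k) : 1 ≤ a ∧ a ≤ k := by
  induction k with
  | zero => simp [components, point] at h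
  | succ k ih =>
    rcases Finset.mem_insert.1 (C.components_succ_subset k h) with rfl | h
    · omega
    · have := ih h
      omega

theorem mem_components_of_le {k l a : ℕ} (ha : a ≤ k) (hkl : k ≤ l) (h : a ∈ C.components l) :
    a ∈ C.components k := by
  induction l, hkl using Nat.le_induction with
  | base => exact h
  | succ l hl ih =>
    rcases Finset.mem_insert.1 (C.components_succ_subset l h) with rfl | h
    · omega
    · exact ih h

theorem card_components_le (k : ℕ) : (C.components k).card ≤ 2 := by
  refine (Finset.card_union_le _ _).trans ?_
  have h : ∀ o : Option ℕ, o.toFinset.card ≤ 1 := fun o => by cases o <;> simp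
  have h1 := h (C.point k).onX
  have h2 := h (C.point k).onY
  omega

theorem satellite_iff (k : ℕ) : C.Satellite k ↔ (C.components k).card = 2 := by
  classical
  have hne : ∀ a, (C.point k).onX = some a → (C.point k).onY ≠ some a := by
    intro a hx hy
    cases k with
    | zero => simp [point] at hx
    | succ k =>
      have hb : ∀ o, o = some (k + 1) → (C.point k).onX ≠ o ∧ (C.point k).onY ≠ o := by
        rintro o rfl
        constructor <;> intro h
        · have := C.bounds_of_mem_components (C.mem_components.2 (Or.inl h))
          omega
        · have := C.bounds_of_mem_components (C.mem_components.2 (Or.inr h))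
          omega
      rw [point_succ, NearPoint.blowUp] at hx hy
      have := hb _ rfl
      split_ifs at hx hy <;> simp at hx hy <;> grind
  rw [Satellite, components]
  cases hx : (C.point k).onX with
  | none => cases (C.point k).onY <;> simp
  | some a =>
    cases hy : (C.point k).onY with
    | none => simp
    | some b =>
      have hab : a ≠ b := fun h => hne a hx (by rw [hy, h])
      simp [Finset.card_pair hab]

/-- Blowing up `O_k` creates a component which meets for good those components through `O_k` that do
not pass through `O_{k+1}`. There are two of them exactly if `O_k` is a satellite point and
`O_{k+1}` is free. -/
theorem card_sdiff_eq_two_iff (k : ℕ) :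
    (C.components k \ C.components (k + 1)).card = 2 ↔ C.Satellite k ∧ ¬ C.Satellite (k + 1) := by
  rw [satellite_iff, satellite_iff]
  have h1 : C.components (k + 1) = insert (k + 1) (C.components k ∩ C.components (k + 1)) := by
    ext a
    rw [Finset.mem_insert, Finset.mem_inter]
    constructor
    · intro h
      rcases Finset.mem_insert.1 (C.components_succ_subset k h) with h' | h'
      · exact Or.inl h'
      · exact Or.inr ⟨h', h⟩
    · rintro (rfl | h)
      · exact C.self_mem_components k
      · exact h.2
  have h2 : (C.components (k + 1)).card = (C.components k ∩ C.components (k + 1)).card + 1 := by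
    conv_lhs => rw [h1]
    refine Finset.card_insert_of_notMem fun h => ?_
    have := C.bounds_of_mem_components (Finset.mem_inter.1 h).1
    omega
  have h3 := Finset.card_sdiff_add_card_inter (C.components k) (C.components (k + 1))
  have h4 := C.card_components_le k
  have h5 := C.card_components_le (k + 1)
  omega

section Resolved

variable {C}

theorem eq_of_mem_components_resolutionLength (hN : (C.point C.resolutionLength).Resolved) {a : ℕ}
    (h : a ∈ C.components C.resolutionLength) : a = C.resolutionLength := by
  have h1 : ¬ C.Satellite C.resolutionLength := fun hs => by
    rcases hN.2.1 with h' | h'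
    · exact hs.1 h'
    · exact hs.2 h'
  rw [satellite_iff] at h1
  have h2 := C.card_components_le C.resolutionLength
  have h3 := C.bounds_of_mem_components h
  obtain ⟨m, hm⟩ := Nat.exists_eq_succ_of_ne_zero (show C.resolutionLength ≠ 0 by omega)
  have h4 := C.self_mem_components m
  rw [← Nat.succ_eq_add_one, ← hm] at h4
  exact Finset.card_le_one.1 (by omega) _ h _ h4

theorem dualGraph_adj_iff (hN : (C.point C.resolutionLength).Resolved) {a b : ℕ} (ha : 1 ≤ a)
    (hab : a < b) (hb : b ≤ C.resolutionLength) :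
    C.dualGraph.Adj a b ↔ a ∈ C.components (b - 1) \ C.components b := by
  rw [dualGraph, SimpleGraph.fromRel_adj, Finset.mem_sdiff, mem_components, mem_components]
  obtain ⟨b, rfl⟩ := Nat.exists_eq_succ_of_ne_zero (show b ≠ 0 by omega)
  constructor
  · rintro ⟨-, (⟨-, -, -, h1, h2⟩ | h) | (h | h)⟩
    · refine ⟨h1, fun h3 => ?_⟩
      rcases hb.eq_or_lt with h4 | h4
      · rw [← mem_components] at h3
        rw [h4] at h3
        have := eq_of_mem_components_resolutionLength hN h3
        omega
      · exact h2 _ le_rfl h4 ⟨h3, C.mem_components.1 (C.self_mem_components b)⟩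
    all_goals omega
  · rintro ⟨h1, h2⟩
    refine ⟨hab.ne, Or.inl (Or.inl ⟨ha, hab, hb, h1, fun k hk _ h3 => h2 ?_⟩)⟩
    rw [← mem_components] at h3 ⊢
    exact C.mem_components_of_le hab.le hk h3.1

theorem dualGraph_adj_zero_iff (hN : (C.point C.resolutionLength).Resolved)
    (hpos : 1 ≤ C.resolutionLength) {b : ℕ} :
    C.dualGraph.Adj b 0 ↔ b = C.resolutionLength := by
  rw [dualGraph, SimpleGraph.fromRel_adj]
  constructor
  · rintro ⟨-, (h | h) | (h | ⟨-, -, -, h⟩)⟩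
    iterate 3 omega
    exact eq_of_mem_components_resolutionLength hN (C.mem_components.2 h)
  · rintro rfl
    refine ⟨by omega, Or.inr (Or.inr ⟨rfl, hpos, le_rfl, ?_⟩)⟩
    obtain ⟨m, hm⟩ := Nat.exists_eq_succ_of_ne_zero (show C.resolutionLength ≠ 0 by omega)
    rw [hm, ← mem_components]
    exact C.self_mem_components m

/-- The neighbours of `E_b` are the components through the center of the blow-up creating it which
get separated from the branch there, and exactly one vertex which appears later (or the branch). -/
theorem exists_neighborSet_eq (hN : (C.point C.resolutionLength).Resolved) {b : ℕ}
    (hb : b + 1 ≤ C.resolutionLength) :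
    ∃ p, p ∉ C.components b \ C.components (b + 1) ∧ C.dualGraph.neighborSet (b + 1) =
      insert p ((C.components b \ C.components (b + 1) : Finset ℕ) : Set ℕ) := by
  have hlow : ∀ a, 1 ≤ a → a < b + 1 → (a ∈ C.dualGraph.neighborSet (b + 1) ↔
      a ∈ C.components b \ C.components (b + 1)) := fun a ha hab => by
    rw [SimpleGraph.mem_neighborSet, SimpleGraph.adj_comm, dualGraph_adj_iff hN ha hab hb,
      Nat.add_sub_cancel]
  have hlow' : ∀ a ∈ C.components b \ C.components (b + 1), 1 ≤ a ∧ a < b + 1 := fun a ha => by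
    have := C.bounds_of_mem_components (Finset.mem_sdiff.1 ha).1
    omega
  have hzero : 0 ∈ C.dualGraph.neighborSet (b + 1) ↔ b + 1 = C.resolutionLength := by
    rw [SimpleGraph.mem_neighborSet, dualGraph_adj_zero_iff hN (by omega)]
  -- A neighbour `E_c` with `c > b + 1` is created at the last point on `E_{b + 1}`.
  have hup : ∀ c, b + 1 < c → (c ∈ C.dualGraph.neighborSet (b + 1) ↔ c ≤ C.resolutionLength ∧
      b + 1 ∈ C.components (c - 1) ∧ b + 1 ∉ C.components c) := fun c hc => by
    by_cases hcN : c ≤ C.resolutionLength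
    · rw [SimpleGraph.mem_neighborSet, dualGraph_adj_iff hN (by omega) hc hcN, Finset.mem_sdiff]
      exact ⟨fun h => ⟨hcN, h⟩, fun h => h.2⟩
    · rw [SimpleGraph.mem_neighborSet, dualGraph, SimpleGraph.fromRel_adj]
      constructor
      · rintro ⟨-, (h | h) | (h | h)⟩ <;> omega
      · rintro ⟨h, -⟩
        exact absurd h hcN
  rcases hb.eq_or_lt with hbN | hbN
  · refine ⟨0, fun h => absurd (hlow' 0 h).1 (by omega), ?_⟩
    ext a
    rw [Set.mem_insert_iff, Finset.mem_coe]
    rcases Nat.eq_zero_or_pos a with rfl | ha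
    · exact ⟨fun _ => Or.inl rfl, fun _ => hzero.2 hbN⟩
    rcases lt_trichotomy a (b + 1) with h | rfl | h
    · rw [hlow a ha h]
      simp [ha.ne']
    · constructor
      · intro h
        exact absurd ((SimpleGraph.mem_neighborSet _ _ _).1 h) (SimpleGraph.irrefl _)
      · rintro (h | h)
        · omega
        · have := hlow' _ h
          omega
    · rw [hup a h]
      constructor
      · rintro ⟨h1, -⟩
        omega
      · rintro (h1 | h1)
        · omega
        · have := hlow' _ h1
          omega
  · classical
    have hex : ∃ c, b + 1 < c ∧ b + 1 ∉ C.components c :=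
      ⟨C.resolutionLength, hbN, fun h => by
        have := eq_of_mem_components_resolutionLength hN h
        omega⟩
    set c := Nat.find hex with hc
    obtain ⟨hc1, hc2⟩ := Nat.find_spec hex
    rw [← hc] at hc1 hc2
    have hcN : c ≤ C.resolutionLength := Nat.find_min' hex ⟨hbN, fun h => by
        have := eq_of_mem_components_resolutionLength hN h
        omega⟩
    have hc3 : b + 1 ∈ C.components (c - 1) := by
      by_contra h
      by_cases hbc : b + 1 < c - 1
      · exact Nat.find_min hex (m := c - 1) (by omega) ⟨hbc, h⟩
      · rw [show c - 1 = b + 1 by omega] at h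
        exact h (C.self_mem_components b)
    refine ⟨c, fun h => absurd (hlow' c h).2 (by omega), ?_⟩
    ext a
    rw [Set.mem_insert_iff, Finset.mem_coe]
    rcases Nat.eq_zero_or_pos a with rfl | ha
    · rw [hzero]
      constructor
      · intro h
        omega
      · rintro (h | h)
        · omega
        · have := hlow' _ h
          omega
    rcases lt_trichotomy a (b + 1) with h | rfl | h
    · rw [hlow a ha h]
      constructor
      · exact Or.inr
      · rintro (h | h)
        · omega
        · exact h
    · constructor
      · intro h
        exact absurd ((SimpleGraph.mem_neighborSet _ _ _).1 h) (SimpleGraph.irrefl _)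
      · rintro (h | h)
        · omega
        · have := hlow' _ h
          omega
    · rw [hup a h]
      constructor
      · rintro ⟨h1, h2, h3⟩
        left
        rcases lt_trichotomy a c with h4 | h4 | h4
        · exact absurd ⟨h, h3⟩ (Nat.find_min hex h4)
        · exact h4
        · exact absurd (C.mem_components_of_le hc1.le (by omega) h2) hc2
      · rintro (rfl | h1)
        · exact ⟨hcN, hc3, hc2⟩
        · have := hlow' _ h1
          omega

/-- The vertex `b` of the dual graph is a triple point if and only if the component `E_b` was
created by blowing up a satellite point and the next point is free. -/
theorem ncard_neighborSet_eq_three_iff (hN : (C.point C.resolutionLength).Resolved)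
    (hpos : 1 ≤ C.resolutionLength) {b : ℕ} (hb : b ≤ C.resolutionLength) :
    (C.dualGraph.neighborSet b).ncard = 3 ↔ 1 ≤ b ∧ C.Satellite (b - 1) ∧ ¬ C.Satellite b := by
  cases b with
  | zero =>
    have : C.dualGraph.neighborSet 0 = {C.resolutionLength} := by
      ext a
      rw [SimpleGraph.mem_neighborSet, SimpleGraph.adj_comm, dualGraph_adj_zero_iff hN hpos]
      rfl
    rw [this, Set.ncard_singleton]
    omega
  | succ b =>
    obtain ⟨p, hp, h⟩ := exists_neighborSet_eq hN hb
    rw [h, Set.ncard_insert_of_notMem (by simpa using hp), Set.ncard_coe_finset,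
      Nat.add_sub_cancel, ← C.card_sdiff_eq_two_iff]
    omega

end Resolved

/-! ### The triple points -/

theorem count_add_eq {p : ℕ → Prop} [DecidablePred p] {a b : ℕ} (hab : a ≤ b)
    (h : ∀ l, a ≤ l → l < b → ¬ p l) : Nat.count p b = Nat.count p a := by
  induction b, hab using Nat.le_induction with
  | base => rfl
  | succ b hb ih =>
    rw [Nat.count_succ, if_neg (h b hb (Nat.lt_succ_self b)), add_zero]
    exact ih fun l hl hl' => h l hl (by omega)

open Classical in
/-- The `j`-th family is a family of curvettes of the component `E_k`, where `k` is the `j`-th index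
at which a satellite point is followed by a free one. -/
theorem exists_curvettesAt {j : ℕ} (hg : 0 < C.g) (hj : j ≤ C.g) :
    ∃ k θ, C.CurvettesAt j k θ ∧ 1 ≤ k ∧ (∀ l < k, ¬ (C.point l).Resolved) ∧
      Nat.count (fun b => 1 ≤ b ∧ C.Satellite (b - 1) ∧ ¬ C.Satellite b) (k + 1) = j ∧
      (1 ≤ j → C.Satellite (k - 1) ∧ ¬ C.Satellite k) := by
  induction j with
  | zero =>
    refine ⟨1, _, C.curvettesAt_zero, le_rfl, fun l hl => ?_, ?_, by omega⟩
    · rw [show l = 0 by omega]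
      exact C.not_resolved_zero hg
    · rw [count_add_eq (a := 0) (by omega), Nat.count_zero]
      rintro l - hl ⟨h1, h2, -⟩
      rw [show l - 1 = 0 by omega] at h2
      exact h2.1 rfl
  | succ j ih =>
    obtain ⟨k, θ, h, hk, hres, hcount, -⟩ := ih (by omega)
    obtain ⟨m, k', θ', hm, hk', h', hfree, hsat⟩ := CurvettesAt.exists_succ C h (by omega)
    have hT : C.Satellite (k' - 1) ∧ ¬ C.Satellite k' :=
      ⟨hsat _ (by omega) (by omega), fun hs => hs.2 h'.onY⟩
    refine ⟨k', θ', h', by omega, fun l hl => ?_, ?_, fun _ => hT⟩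
    · rcases Nat.lt_or_ge l k with h1 | h1
      · exact hres l h1
      rcases Nat.lt_or_ge m l with h2 | h2
      · exact C.not_resolved_of_satellite (hsat l h2 hl)
      · exact (hfree l h1 h2).2
    · rw [Nat.count_succ, if_pos ⟨by omega, hT⟩, count_add_eq (a := k + 1) (by omega), hcount]
      rintro l hl hl' ⟨-, h1, h2⟩
      rcases Nat.lt_or_ge m l with h3 | h3
      · exact h2 (hsat l h3 hl')
      · exact h1.2 (hfree (l - 1) (by omega) (by omega)).1

/-- The curve germs of the `j`-th family are transversal to the component of the `j`-th triple
point. -/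
theorem exists_curvettesAt_triplePoint {j : ℕ} (hj0 : 1 ≤ j) (hj : j ≤ C.g) :
    ∃ θ, C.CurvettesAt j (C.triplePoint j) θ := by
  classical
  obtain ⟨K, Θ, hK, hK1, hKres, -⟩ := C.exists_curvettesAt (by omega) le_rfl
  have hres : (C.point K).Resolved := by
    obtain ⟨U, hU, hU0⟩ := hK.line.dvd
    have hx : (C.point K).x.order = 1 := by
      have h := C.order_subst_arc C.g 1 hU0
      rw [pow_one, ← hU, ← hK.chart.x_eq, C.e_g] at h
      simpa using h
    refine ⟨?_, Or.inr hK.onY, fun _ => hx, fun h => absurd hK.onY h⟩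
    rw [hx, min_eq_left]
    rw [Order.one_le_iff_ne_zero, PowerSeries.order_ne_zero_iff_constCoeff_eq_zero, hK.chart.y_eq]
    exact (MvPowerSeries.constantCoeff_subst_of_constantCoeff_zero hK.chart.arc_zero _).trans
      hK.line.constantCoeff_one
  have hN : (C.point C.resolutionLength).Resolved :=
    Nat.sInf_mem (s := {k | (C.point k).Resolved}) ⟨K, hres⟩
  obtain ⟨k, θ, hk, hk1, hkres, hcount, hT⟩ := C.exists_curvettesAt (by omega) hj
  have hkN : k ≤ C.resolutionLength := by
    by_contra h
    exact hkres _ (not_le.1 h) hN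
  have hiff : ∀ b ≤ k, (C.dualGraph.neighborSet b).ncard = 3 ↔
      1 ≤ b ∧ C.Satellite (b - 1) ∧ ¬ C.Satellite b := fun b hb =>
    ncard_neighborSet_eq_three_iff hN (by omega) (by omega)
  have hcount' : Nat.count (fun a => (C.dualGraph.neighborSet a).ncard = 3) k = j - 1 := by
    rw [Nat.count_succ, if_pos ⟨hk1, hT hj0⟩] at hcount
    rw [← hcount, Nat.add_sub_cancel, Nat.count_eq_card_filter_range,
      Nat.count_eq_card_filter_range]
    congr 1
    refine Finset.filter_congr fun b hb => hiff b ?_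
    exact (Finset.mem_range.1 hb).le
  refine ⟨θ, ?_⟩
  have : C.triplePoint j = k := by
    rw [triplePoint, ← hcount']
    exact Nat.nth_count (p := fun a => (C.dualGraph.neighborSet a).ncard = 3)
      ((hiff k le_rfl).2 ⟨hk1, hT hj0⟩)
  rw [this]
  exact hk

/-- The foliation is dicritical at the `j`-th triple point if and only if the inequality of
intersection multiplicities holds. -/
theorem isDicriticalAt_triplePoint_iff {i j : ℕ} (hij : i < j) (hj : j ≤ C.g)
    {H₁ H₂ : Polynomial (PowerSeries ℂ)}
    (hd₁ : H₁.degree < (C.n / C.e j : ℕ)) (hd₂ : H₂.degree < (C.n / C.e j : ℕ)) (hH₁ : H₁ ≠ 0)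
    (hH₂ : PowerSeries.constantCoeff (H₂.coeff 0) = 0) :
    C.IsDicriticalAt (toSeries H₁ • C.omega i j + differential (toSeries H₂)) (C.triplePoint j) ↔
      C.inter H₁ + C.v i + C.v j < C.inter H₂ := by
  obtain ⟨θ, h⟩ := C.exists_curvettesAt_triplePoint (by omega) hj
  have hc : C.c (C.β j) ≠ 0 := by
    obtain ⟨j, rfl⟩ := Nat.exists_eq_succ_of_ne_zero (show j ≠ 0 by omega)
    exact C.c_β_ne_zero hj
  rw [IsDicriticalAt, h.onX, h.onY]
  simp only [true_and, reduceCtorEq, false_and, or_false]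
  set ω := toSeries H₁ • C.omega i j + differential (toSeries H₂) with hω
  have hpull : ∀ k, (C.totalPullback ω (C.triplePoint j)).pullback θ k =
      ω.pull (C.famMap j (C.c (C.β j))) k := fun k => congrFun (h.chart.pull ω) k
  constructor
  · intro ht
    by_contra hlt
    obtain ⟨M, A, B, hA, h0, h1⟩ := C.pull_famMap_of_le hij hj hd₁ hd₂ hH₁ hH₂ (not_lt.1 hlt)
    exact h.line.not_genericallyTransversal hA ((hpull 0).trans h0) ((hpull 1).trans h1) ht
  · intro hlt
    obtain ⟨M, hM⟩ := C.pull_famMap_of_lt hij hj hd₁ hd₂ hH₁ hlt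
    obtain ⟨G, hG, hk⟩ := hM ℂ (C.c (C.β j)) (IsUnit.mk0 _ hc)
    exact h.line.genericallyTransversal (not_X_dvd_of_isUnit hG.ne_zero)
      fun k => (hpull k).trans (hk k)

end PlaneBranch

end

/-! ### Formal solutions of the differential equation -/

section

open MvPowerSeries

variable {R : Type*} [CommRing R]

/-- A map of `R⟦T⟧` which is contracting for the `T`-adic topology has a fixed point. -/
theorem exists_fixed_of_contracting (Φ : PowerSeries R → PowerSeries R)
    (h : ∀ m z w, PowerSeries.X ^ m ∣ z - w → PowerSeries.X ^ (m + 1) ∣ Φ z - Φ w) :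
    ∃ z, Φ z = z := by
  set y : ℕ → PowerSeries R := fun m => Φ^[m] 0 with hy
  have hsucc : ∀ m, y (m + 1) = Φ (y m) := fun m => Function.iterate_succ_apply' Φ m 0
  have hstep : ∀ m, PowerSeries.X ^ m ∣ y (m + 1) - y m := fun m => by
    induction m with
    | zero => simp
    | succ m ih => rw [hsucc (m + 1), hsucc m]; exact h m _ _ (by rwa [← hsucc m])
  have hle : ∀ m l, m ≤ l → PowerSeries.X ^ m ∣ y l - y m := fun m l hml => by
    induction l, hml using Nat.le_induction with
    | base => simp
    | succ l hl ih =>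
      rw [← sub_add_sub_cancel]
      exact dvd_add ((pow_dvd_pow _ hl).trans (hstep l)) ih
  set z : PowerSeries R := PowerSeries.mk fun k => PowerSeries.coeff k (y (k + 1)) with hz
  have hzy : ∀ m, PowerSeries.X ^ m ∣ z - y m := fun m => by
    rw [PowerSeries.X_pow_dvd_iff]
    intro k hk
    have := PowerSeries.X_pow_dvd_iff.1 (hle (k + 1) m hk) k (Nat.lt_succ_self k)
    rw [map_sub, sub_eq_zero] at this
    rw [map_sub, hz, PowerSeries.coeff_mk, this, sub_self]
  refine ⟨z, sub_eq_zero.1 (PowerSeries.ext fun k => ?_)⟩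
  have h1 : PowerSeries.X ^ (k + 1) ∣ Φ z - z := by
    have h2 := h k _ _ (hzy k)
    have h3 := hzy (k + 1)
    rw [hsucc] at h3
    have : Φ z - z = (Φ z - Φ (y k)) - (z - Φ (y k)) := by ring
    rw [this]
    exact dvd_sub h2 h3
  rw [PowerSeries.X_pow_dvd_iff.1 h1 k (Nat.lt_succ_self k), map_zero]

theorem X_pow_dvd_subst_sub_subst {a b : Fin 2 → MvPowerSeries Unit R}
    (ha : ∀ l, constantCoeff (a l) = 0) (hb : ∀ l, constantCoeff (b l) = 0) {m : ℕ}
    (h : ∀ l, (PowerSeries.X ^ m : PowerSeries R) ∣ a l - b l) (f : MvPowerSeries (Fin 2) R) :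
    (PowerSeries.X ^ m : PowerSeries R) ∣ subst a f - subst b f := by
  rw [PowerSeries.X_pow_dvd_iff]
  intro k hk
  have h1 : coeff (Finsupp.single () k) (subst a f) = coeff (Finsupp.single () k) (subst b f) := by
    rw [coeff_subst (hasSubst_of_constantCoeff_zero ha),
      coeff_subst (hasSubst_of_constantCoeff_zero hb)]
    refine finsum_congr fun d => ?_
    congr 1
    rw [Finsupp.prod_fintype _ _ (fun _ => pow_zero _),
      Finsupp.prod_fintype _ _ (fun _ => pow_zero _),
      Fin.prod_univ_two, Fin.prod_univ_two]
    have h2 : (PowerSeries.X ^ m : PowerSeries R) ∣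
        a 0 ^ d 0 * a 1 ^ d 1 - b 0 ^ d 0 * b 1 ^ d 1 := by
      have : a 0 ^ d 0 * a 1 ^ d 1 - b 0 ^ d 0 * b 1 ^ d 1 =
          (a 0 ^ d 0 - b 0 ^ d 0) * a 1 ^ d 1 + b 0 ^ d 0 * (a 1 ^ d 1 - b 1 ^ d 1) := by ring
      rw [this]
      exact dvd_add (((h 0).trans (sub_dvd_pow_sub_pow _ _ _)).mul_right _)
        (((h 1).trans (sub_dvd_pow_sub_pow _ _ _)).mul_left _)
    have h3 := PowerSeries.X_pow_dvd_iff.1 h2 k hk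
    rw [map_sub] at h3
    exact sub_eq_zero.1 h3
  rw [map_sub]
  exact sub_eq_zero.2 h1

/-- The arc `(T, z(T))`. -/
noncomputable def graphArc (z : PowerSeries R) : Fin 2 → MvPowerSeries Unit R :=
  ![(PowerSeries.X : PowerSeries R), z]

theorem constantCoeff_graphArc {z : PowerSeries R} (hz : PowerSeries.constantCoeff z = 0)
    (l : Fin 2) : constantCoeff (graphArc z l) = 0 := by
  fin_cases l
  · exact PowerSeries.constantCoeff_X
  · exact hz

/-- The differential equation `A(T, z) + B(T, z) z' = 0` has a formal solution with `z(0) = 0` if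
`B(0, 0)` is a unit. -/
theorem exists_formal_solution [Algebra ℂ R] (A B : MvPowerSeries (Fin 2) R)
    (hB : IsUnit (constantCoeff B)) : ∃ z : PowerSeries R, PowerSeries.constantCoeff z = 0 ∧
      (subst (graphArc z) A + subst (graphArc z) B * PowerSeries.derivative R z : PowerSeries R) =
        0 := by
  obtain ⟨B', hB'⟩ := (isUnit_iff_constantCoeff.2 hB).exists_right_inv
  have hc : ∀ y : PowerSeries R, PowerSeries.constantCoeff (PowerSeries.X * y) = 0 := fun y => by
    simp
  set S : PowerSeries R → PowerSeries R := fun y =>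
    subst (graphArc (PowerSeries.X * y)) (-(A * B')) with hS
  obtain ⟨y, hy⟩ := exists_fixed_of_contracting (fun y => PowerSeries.mk fun k =>
      algebraMap ℂ R ((k + 1 : ℕ) : ℂ)⁻¹ * PowerSeries.coeff k (S y)) (fun m y w hyw => by
    have h1 : (PowerSeries.X ^ (m + 1) : PowerSeries R) ∣ S y - S w := by
      refine X_pow_dvd_subst_sub_subst (constantCoeff_graphArc (hc y))
        (constantCoeff_graphArc (hc w)) (fun l => ?_) _
      fin_cases l
      · exact (sub_self (PowerSeries.X : PowerSeries R)).symm ▸ dvd_zero _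
      · have : (PowerSeries.X : PowerSeries R) ^ (m + 1) ∣
            PowerSeries.X * y - PowerSeries.X * w := by
          rw [← mul_sub, pow_succ']
          exact mul_dvd_mul_left _ hyw
        exact this
    rw [PowerSeries.X_pow_dvd_iff] at h1 ⊢
    intro k hk
    have := h1 k hk
    rw [map_sub, sub_eq_zero] at this
    rw [map_sub, PowerSeries.coeff_mk, PowerSeries.coeff_mk, this, sub_self])
  refine ⟨PowerSeries.X * y, hc y, ?_⟩
  have hs := hasSubst_of_constantCoeff_zero (constantCoeff_graphArc (hc y))
  have hder : PowerSeries.derivative R (PowerSeries.X * y) = S y := by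
    ext k
    have h1 := congrArg (PowerSeries.coeff k) hy
    rw [PowerSeries.coeff_mk] at h1
    rw [PowerSeries.coeff_derivative, PowerSeries.coeff_succ_X_mul, ← h1]
    have h2 : algebraMap ℂ R ((k + 1 : ℕ) : ℂ)⁻¹ * ((k : R) + 1) = 1 := by
      have h3 : ((k : R) + 1) = algebraMap ℂ R ((k + 1 : ℕ) : ℂ) := by simp
      rw [h3, ← map_mul, inv_mul_cancel₀ (by exact_mod_cast Nat.succ_ne_zero k), map_one]
    linear_combination (PowerSeries.coeff k (S y)) * h2
  rw [hder]
  have h4 : S y = -(subst (graphArc (PowerSeries.X * y)) A *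
      subst (graphArc (PowerSeries.X * y)) B') := by
    rw [hS, ← subst_mul hs]
    simp only [← coe_substAlgHom hs, map_neg]
  have h5 : (subst (graphArc (PowerSeries.X * y)) B : MvPowerSeries Unit R) *
      subst (graphArc (PowerSeries.X * y)) B' = 1 := by
    rw [← subst_mul hs, hB', ← coe_substAlgHom hs, map_one]
  rw [h4]
  linear_combination (-(subst (graphArc (PowerSeries.X * y)) A : MvPowerSeries Unit R)) * h5

/-! ### Specialization of the parameter -/

theorem map_subst_algHom {σ τ S : Type*} [Algebra ℂ R] [CommRing S] [Algebra ℂ S] [Finite σ]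
    (φ : R →ₐ[ℂ] S) {a : σ → MvPowerSeries τ R} (ha : ∀ l, constantCoeff (a l) = 0)
    (f : MvPowerSeries σ ℂ) :
    map (φ : R →+* S) (subst a f) = subst (fun l => map (φ : R →+* S) (a l)) f := by
  have hs := hasSubst_of_constantCoeff_zero ha
  have hs' : HasSubst fun l => map (φ : R →+* S) (a l) :=
    hasSubst_of_constantCoeff_zero fun l => by rw [constantCoeff_map, ha, map_zero]
  ext e
  rw [coeff_map, coeff_subst hs, coeff_subst hs']
  refine ((φ : R →+* S).toAddMonoidHom.map_finsum (coeff_subst_finite hs f e)).trans ?_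
  refine finsum_congr fun d => ?_
  have h1 : (d.prod fun s k => map (φ : R →+* S) (a s) ^ k) =
      map (φ : R →+* S) (d.prod fun s k => a s ^ k) := by
    rw [map_finsuppProd]
    simp only [map_pow]
  rw [h1, coeff_map]
  exact map_smul φ _ _

open LaurentPolynomial in
/-- The evaluation of Laurent polynomials at a point of `ℂ^*`. -/
noncomputable def laurentEval (u : ℂˣ) : ℂ[T;T⁻¹] →ₐ[ℂ] ℂ :=
  { LaurentPolynomial.eval₂ (RingHom.id ℂ) u with
    commutes' := fun z => by
      rw [← LaurentPolynomial.C_eq_algebraMap]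
      exact LaurentPolynomial.eval₂_C _ _ z }

open LaurentPolynomial in
theorem laurentEval_T (u : ℂˣ) : laurentEval u (T 1) = u := by
  have := LaurentPolynomial.eval₂_T (RingHom.id ℂ) u 1
  rwa [zpow_one] at this

open LaurentPolynomial in
/-- A Laurent polynomial is a rational function without poles in `ℂ^*`. -/
theorem exists_ratFunc_eval_eq (f : ℂ[T;T⁻¹]) : ∃ s : RatFunc ℂ, ∀ u : ℂˣ,
    s.denom.eval (u : ℂ) ≠ 0 ∧ s.eval (RingHom.id ℂ) u = laurentEval u f := by
  obtain ⟨n, p, hp⟩ := f.exists_T_pow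
  set s : RatFunc ℂ := algebraMap (Polynomial ℂ) (RatFunc ℂ) p /
    algebraMap (Polynomial ℂ) (RatFunc ℂ) (Polynomial.X ^ n) with hs
  have hX : algebraMap (Polynomial ℂ) (RatFunc ℂ) (Polynomial.X ^ n) ≠ 0 :=
    RatFunc.algebraMap_ne_zero (pow_ne_zero n Polynomial.X_ne_zero)
  refine ⟨s, fun u => ?_⟩
  have hd : s.denom.eval (u : ℂ) ≠ 0 := by
    obtain ⟨q, hq⟩ := RatFunc.denom_div_dvd p (Polynomial.X ^ n)
    intro h0
    have := congrArg (Polynomial.eval (u : ℂ)) hq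
    rw [Polynomial.eval_mul, ← hs, h0, zero_mul, Polynomial.eval_pow, Polynomial.eval_X] at this
    exact pow_ne_zero n u.ne_zero this
  refine ⟨hd, ?_⟩
  have h1 : s * algebraMap (Polynomial ℂ) (RatFunc ℂ) (Polynomial.X ^ n) =
    algebraMap (Polynomial ℂ) (RatFunc ℂ) p := div_mul_cancel₀ _ hX
  have h2 := congrArg (RatFunc.eval (RingHom.id ℂ) (u : ℂ)) h1
  rw [RatFunc.eval_mul _ _ (by rwa [Polynomial.eval₂_id])
    (by rw [RatFunc.denom_algebraMap, Polynomial.eval₂_one]; exact one_ne_zero),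
    RatFunc.eval_algebraMap, RatFunc.eval_algebraMap] at h2
  simp only [Algebra.algebraMap_self, RingHom.id_apply, Polynomial.eval₂_id, Polynomial.eval_pow,
    Polynomial.eval_X] at h2
  have h3 := congrArg (laurentEval u) hp
  have h4 : laurentEval u (Polynomial.toLaurent p) = p.eval (u : ℂ) :=
    (LaurentPolynomial.eval₂_toLaurent (RingHom.id ℂ) u p).trans Polynomial.eval₂_id
  have h5 : laurentEval u (T (n : ℤ)) = (u : ℂ) ^ n :=
    LaurentPolynomial.eval₂_T_n (RingHom.id ℂ) u n
  rw [map_mul, h4, h5, ← h2] at h3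
  exact mul_right_cancel₀ (pow_ne_zero n u.ne_zero) h3

namespace PlaneBranch

variable (C : PlaneBranch)

theorem subst_graphArc_inclT [Algebra ℂ R] {z : PowerSeries R}
    (hz : PowerSeries.constantCoeff z = 0) (p : PowerSeries ℂ) :
    subst (graphArc z) (inclT R p) = PowerSeries.map (algebraMap ℂ R) p := by
  have hs := hasSubst_of_constantCoeff_zero (constantCoeff_graphArc hz)
  have hX := PowerSeries.HasSubst.X (S := R) (0 : Fin 2)
  rw [inclT_apply, PowerSeries.subst, subst_comp_subst_apply hX.const hs,
    PowerSeries.map_algebraMap_eq_subst_X]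
  simp only [subst_X hs]
  rfl

theorem subst_graphArc_famMap_zero [Algebra ℂ R] (j : ℕ) (u : R) {z : PowerSeries R}
    (hz : PowerSeries.constantCoeff z = 0) : subst (graphArc z) (C.famMap j u 0) =
      (PowerSeries.X ^ (C.n / C.e j) : PowerSeries R) := by
  have hs := hasSubst_of_constantCoeff_zero (constantCoeff_graphArc hz)
  refine (subst_pow hs _ _).trans ?_
  rw [subst_X hs]
  rfl

theorem subst_graphArc_famMap_one [Algebra ℂ R] (j : ℕ) (u : R) {z : PowerSeries R}
    (hz : PowerSeries.constantCoeff z = 0) : subst (graphArc z) (C.famMap j u 1) =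
      PowerSeries.map (algebraMap ℂ R) (C.head j) +
        PowerSeries.X ^ (C.β j / C.e j) * (PowerSeries.C u + z) := by
  have hs := hasSubst_of_constantCoeff_zero (constantCoeff_graphArc hz)
  refine (subst_add hs _ _).trans ?_
  rw [subst_graphArc_inclT hz, inclT_X, subst_mul hs, subst_pow hs, subst_add hs, subst_X hs,
    subst_X hs, subst_C]
  rfl

/-- `ψ^* ω` along a member `w = u + z(T)` of the `j`-th family. -/
theorem pull_subst_graphArc [Algebra ℂ R] {j : ℕ} (hj : j ≤ C.g) {ω : OneForm} {u : R}
    {z : PowerSeries R} (hz : PowerSeries.constantCoeff z = 0) {M : ℕ}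
    {G : Fin 2 → MvPowerSeries (Fin 2) R} (h : ∀ k, ω.pull (C.famMap j u) k = X 0 ^ M * G k) :
    ω.pull (fun l => subst (graphArc z) (C.famMap j u l)) () = (PowerSeries.X ^ M *
      (subst (graphArc z) (G 0) + subst (graphArc z) (G 1) * PowerSeries.derivative R z) :
        PowerSeries R) := by
  have hg := constantCoeff_graphArc hz
  have hs := hasSubst_of_constantCoeff_zero hg
  rw [OneForm.pull_comp (C.constantCoeff_famMap hj u) hg, Fin.sum_univ_two, h, h, subst_mul hs,
    subst_mul hs, subst_pow hs, subst_X hs]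
  have h0 : pderiv R () (graphArc z 0) = 1 := PowerSeries.derivative_X
  have h1 : pderiv R () (graphArc z 1) = PowerSeries.derivative R z := rfl
  have h2 : graphArc z 0 = (PowerSeries.X : PowerSeries R) := rfl
  rw [h0, h1, h2]
  ring

/-- The formal separatrices. Over the Laurent polynomials in `u` the differential equation has a
single solution, whose coefficients are the functions `s_l`. -/
theorem exists_formal_separatrices {j : ℕ} (hj : j ≤ C.g) {ω : OneForm} {M : ℕ}
    (hM : ∀ (R : Type) [CommRing R] [Algebra ℂ R] (u : R), IsUnit u →
      ∃ G : Fin 2 → MvPowerSeries (Fin 2) R, IsUnit (constantCoeff (G 1)) ∧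
        ∀ k, ω.pull (C.famMap j u) k = X 0 ^ M * G k) :
    ∃ s : ℕ → RatFunc ℂ, ∀ u : ℂ, u ≠ 0 → (∀ l, (s l).denom.eval u ≠ 0) ∧
      ω.pullArc (PowerSeries.X ^ (C.n / C.e j)) (C.sepFamily j s u) = 0 ∧
      ∃ z : PowerSeries ℂ, PowerSeries.constantCoeff z = 0 ∧ C.sepFamily j s u =
        C.head j + PowerSeries.X ^ (C.β j / C.e j) * (PowerSeries.C u + z) := by
  set q : LaurentPolynomial ℂ := LaurentPolynomial.T 1
  obtain ⟨G, hG, h⟩ := hM (LaurentPolynomial ℂ) q (LaurentPolynomial.isUnit_T 1)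
  obtain ⟨z, hz, hzeq⟩ := exists_formal_solution (G 0) (G 1) hG
  have hpull := C.pull_subst_graphArc hj hz h
  rw [hzeq, mul_zero] at hpull
  choose s hs using fun l => exists_ratFunc_eval_eq (PowerSeries.coeff (l - C.β j / C.e j) z)
  refine ⟨s, fun u hu => ?_⟩
  set φ := laurentEval (Units.mk0 u hu) with hφ
  refine ⟨fun l => (hs l (Units.mk0 u hu)).1, ?_⟩
  have hφz : PowerSeries.constantCoeff (PowerSeries.map (φ : LaurentPolynomial ℂ →+* ℂ) z) = 0 := by
    rw [← PowerSeries.coeff_zero_eq_constantCoeff_apply, PowerSeries.coeff_map,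
      PowerSeries.coeff_zero_eq_constantCoeff_apply, hz, map_zero]
  have hsep : C.sepFamily j s u = C.head j + PowerSeries.X ^ (C.β j / C.e j) *
      (PowerSeries.C u + PowerSeries.map (φ : LaurentPolynomial ℂ →+* ℂ) z) := by
    have hb := C.e_mul_β_div (le_refl j)
    have hlt : ∀ k, C.e j * k < C.β j ↔ k < C.β j / C.e j := fun k => by
      rw [← hb, Nat.mul_div_cancel_left _ (C.e_pos j)]
      exact Nat.mul_lt_mul_left (C.e_pos j)
    have heq : ∀ k, C.e j * k = C.β j ↔ k = C.β j / C.e j := fun k => by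
      rw [← hb, Nat.mul_div_cancel_left _ (C.e_pos j)]
      exact Nat.mul_right_inj (C.e_pos j).ne'
    ext k
    rw [sepFamily, PowerSeries.coeff_mk, map_add, PowerSeries.coeff_X_pow_mul', coeff_head]
    simp only [hlt, heq]
    rcases lt_trichotomy k (C.β j / C.e j) with h1 | h1 | h1
    · rw [if_pos h1, if_pos h1, if_neg (not_le.2 h1), add_zero]
    · rw [if_neg h1.not_lt, if_pos h1, if_neg h1.not_lt, if_pos h1.ge, h1, Nat.sub_self, zero_add,
        PowerSeries.coeff_zero_eq_constantCoeff_apply, map_add, hφz, add_zero,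
        PowerSeries.constantCoeff_C]
    · rw [if_neg h1.not_gt, if_neg h1.ne', if_neg h1.not_gt, if_pos h1.le, zero_add, map_add,
        PowerSeries.coeff_C, if_neg (by omega), zero_add, PowerSeries.coeff_map]
      exact (hs k (Units.mk0 u hu)).2
  refine ⟨?_, _, hφz, hsep⟩
  have harc : ∀ l, constantCoeff (subst (graphArc z) (C.famMap j q l) :
      MvPowerSeries Unit (LaurentPolynomial ℂ)) = 0 :=
    fun l => constantCoeff_subst_eq_zero
      (hasSubst_of_constantCoeff_zero (constantCoeff_graphArc hz)) (constantCoeff_graphArc hz)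
      (C.constantCoeff_famMap hj _ l)
  have h0 : map (φ : LaurentPolynomial ℂ →+* ℂ) (subst (graphArc z) (C.famMap j q 0)) =
      (PowerSeries.X ^ (C.n / C.e j) : PowerSeries ℂ) := by
    rw [C.subst_graphArc_famMap_zero j _ hz]
    exact (map_pow (PowerSeries.map (φ : LaurentPolynomial ℂ →+* ℂ)) _ _).trans
      (by rw [PowerSeries.map_X])
  have h1 : map (φ : LaurentPolynomial ℂ →+* ℂ) (subst (graphArc z) (C.famMap j q 1)) =
      (C.sepFamily j s u : PowerSeries ℂ) := by
    rw [C.subst_graphArc_famMap_one j _ hz, hsep]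
    have h2 : ∀ p : PowerSeries ℂ, PowerSeries.map (φ : LaurentPolynomial ℂ →+* ℂ)
        (PowerSeries.map (algebraMap ℂ (LaurentPolynomial ℂ)) p) = p := fun p => by
      ext k
      rw [PowerSeries.coeff_map, PowerSeries.coeff_map]
      exact φ.commutes _
    change PowerSeries.map (φ : LaurentPolynomial ℂ →+* ℂ) _ = _
    rw [map_add, h2, map_mul, map_pow, PowerSeries.map_X, map_add, PowerSeries.map_C]
    congr 4
    exact laurentEval_T _
  have h2 := congrArg (map (φ : LaurentPolynomial ℂ →+* ℂ)) hpull
  rw [OneForm.pull, Fin.sum_univ_two, map_add, map_mul, map_mul, map_subst_algHom φ harc,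
    map_subst_algHom φ harc] at h2
  have hd : ∀ p : MvPowerSeries Unit (LaurentPolynomial ℂ),
      map (φ : LaurentPolynomial ℂ →+* ℂ) (pderiv (LaurentPolynomial ℂ) () p) =
        pderiv ℂ () (map (φ : LaurentPolynomial ℂ →+* ℂ) p) := fun p => by
    refine MvPowerSeries.ext fun e => ?_
    rw [coeff_map, coeff_pderiv, coeff_pderiv, coeff_map, map_mul, map_add, map_natCast,
      RingHom.map_one]
  rw [hd, hd] at h2
  have h3 : (fun l => map (φ : LaurentPolynomial ℂ →+* ℂ) (subst (graphArc z) (C.famMap j q l)))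
      = ![(PowerSeries.X ^ (C.n / C.e j) : PowerSeries ℂ), C.sepFamily j s u] := by
    funext l
    fin_cases l
    · exact h0
    · exact h1
  rw [h3, h0, h1, map_zero] at h2
  rw [OneForm.pullArc_eq_pull, OneForm.pull, Fin.sum_univ_two]
  exact h2

end PlaneBranch

end

/-! ### Convergence -/

section

open MvPowerSeries
open scoped NNReal ENNReal

/-- The weighted `ℓ¹`-norm `∑ ‖f_{a,b}‖ r ^ (a + b)` of a power series in two variables. -/
noncomputable def weightedNorm (r : ℝ≥0∞) (f : MvPowerSeries (Fin 2) ℂ) : ℝ≥0∞ :=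
  ∑' m : Fin 2 →₀ ℕ, ‖coeff m f‖ₑ * r ^ (m 0 + m 1)

theorem weightedNorm_mono {r s : ℝ≥0∞} (h : r ≤ s) (f : MvPowerSeries (Fin 2) ℂ) :
    weightedNorm r f ≤ weightedNorm s f :=
  ENNReal.tsum_le_tsum fun m => by gcongr

theorem weightedNorm_add_le (r : ℝ≥0∞) (f g : MvPowerSeries (Fin 2) ℂ) :
    weightedNorm r (f + g) ≤ weightedNorm r f + weightedNorm r g := by
  rw [weightedNorm, weightedNorm, weightedNorm, ← ENNReal.tsum_add]
  refine ENNReal.tsum_le_tsum fun m => ?_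
  rw [← add_mul, map_add]
  gcongr
  exact enorm_add_le _ _

theorem weightedNorm_mul_le (r : ℝ≥0∞) (f g : MvPowerSeries (Fin 2) ℂ) :
    weightedNorm r (f * g) ≤ weightedNorm r f * weightedNorm r g := by
  classical
  set F : (Fin 2 →₀ ℕ) → ℝ≥0∞ := fun m => ‖coeff m f‖ₑ * r ^ (m 0 + m 1) with hF
  set G : (Fin 2 →₀ ℕ) → ℝ≥0∞ := fun m => ‖coeff m g‖ₑ * r ^ (m 0 + m 1) with hG
  have h1 : weightedNorm r f * weightedNorm r g =
      ∑' m, ∑ p ∈ Finset.HasAntidiagonal.antidiagonal m, F p.1 * G p.2 := by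
    rw [weightedNorm, weightedNorm, ← ENNReal.tsum_mul_right]
    simp only [← ENNReal.tsum_mul_left]
    rw [← ENNReal.tsum_prod (f := fun a b => F a * G b),
      ← Finset.HasAntidiagonal.sigmaAntidiagonalEquivProd.tsum_eq, ENNReal.tsum_sigma']
    refine tsum_congr fun m => ?_
    exact Finset.tsum_subtype (Finset.HasAntidiagonal.antidiagonal m) fun p => F p.1 * G p.2
  rw [h1]
  refine ENNReal.tsum_le_tsum fun m => ?_
  rw [coeff_mul]
  calc ‖∑ p ∈ Finset.HasAntidiagonal.antidiagonal m, coeff p.1 f * coeff p.2 g‖ₑ * r ^ (m 0 + m 1)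
      ≤ (∑ p ∈ Finset.HasAntidiagonal.antidiagonal m, ‖coeff p.1 f * coeff p.2 g‖ₑ) *
          r ^ (m 0 + m 1) := by
        gcongr
        exact enorm_sum_le _ _
    _ = ∑ p ∈ Finset.HasAntidiagonal.antidiagonal m, F p.1 * G p.2 := by
        rw [Finset.sum_mul]
        refine Finset.sum_congr rfl fun p hp => ?_
        rw [← Finset.HasAntidiagonal.mem_antidiagonal.1 hp, enorm_mul]
        simp only [Finsupp.add_apply, hF, hG]
        ring

/-- Scaling the radius of convergence by `t ≤ 1` gains a factor `t` for series without constant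
term. -/
theorem weightedNorm_mul_radius_le {t : ℝ≥0∞} (ht : t ≤ 1) (r : ℝ≥0∞)
    {f : MvPowerSeries (Fin 2) ℂ} (hf : constantCoeff f = 0) :
    weightedNorm (t * r) f ≤ t * weightedNorm r f := by
  rw [weightedNorm, weightedNorm, ← ENNReal.tsum_mul_left]
  refine ENNReal.tsum_le_tsum fun m => ?_
  by_cases hm : m = 0
  · rw [hm, coeff_zero_eq_constantCoeff_apply, hf, enorm_zero, zero_mul, zero_mul, mul_zero]
  · have h1 : m 0 + m 1 ≠ 0 := fun h => hm (by
      ext l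
      fin_cases l
      · exact (Nat.add_eq_zero_iff.1 h).1
      · exact (Nat.add_eq_zero_iff.1 h).2)
    rw [mul_pow]
    calc ‖coeff m f‖ₑ * (t ^ (m 0 + m 1) * r ^ (m 0 + m 1))
        ≤ ‖coeff m f‖ₑ * (t * r ^ (m 0 + m 1)) := by
          gcongr
          exact pow_le_of_le_one zero_le ht h1
      _ = _ := by ring

theorem isConvergent₂_iff {f : MvPowerSeries (Fin 2) ℂ} :
    IsConvergent₂ f ↔ ∃ r : ℝ≥0, 0 < r ∧ weightedNorm r f ≠ ∞ := by
  have h : ∀ r : ℝ≥0, weightedNorm r f ≠ ∞ ↔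
      Summable fun m : Fin 2 →₀ ℕ => ‖coeff m f‖ * (r : ℝ) ^ (m 0 + m 1) := fun r => by
    have h1 : weightedNorm r f =
        ∑' m : Fin 2 →₀ ℕ, ((‖coeff m f‖₊ * r ^ (m 0 + m 1) : ℝ≥0) : ℝ≥0∞) := by
      refine tsum_congr fun m => ?_
      rw [ENNReal.coe_mul, ENNReal.coe_pow]
      rfl
    rw [h1, ENNReal.tsum_coe_ne_top_iff_summable, ← NNReal.summable_coe]
    simp
  constructor
  · rintro ⟨r, hr, hs⟩
    exact ⟨⟨r, hr.le⟩, hr, (h ⟨r, hr.le⟩).2 hs⟩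
  · rintro ⟨r, hr, hs⟩
    exact ⟨r, hr, (h r).1 hs⟩

namespace IsConvergent₂

variable {f g : MvPowerSeries (Fin 2) ℂ}

theorem exists_common (hf : IsConvergent₂ f) (hg : IsConvergent₂ g) :
    ∃ r : ℝ≥0, 0 < r ∧ weightedNorm r f ≠ ∞ ∧ weightedNorm r g ≠ ∞ := by
  obtain ⟨r, hr, h⟩ := isConvergent₂_iff.1 hf
  obtain ⟨s, hs, h'⟩ := isConvergent₂_iff.1 hg
  refine ⟨min r s, lt_min hr hs, ne_top_of_le_ne_top h (weightedNorm_mono ?_ _),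
    ne_top_of_le_ne_top h' (weightedNorm_mono ?_ _)⟩
  · exact_mod_cast min_le_left r s
  · exact_mod_cast min_le_right r s

theorem add (hf : IsConvergent₂ f) (hg : IsConvergent₂ g) : IsConvergent₂ (f + g) := by
  obtain ⟨r, hr, h, h'⟩ := hf.exists_common hg
  exact isConvergent₂_iff.2 ⟨r, hr, ne_top_of_le_ne_top (ENNReal.add_ne_top.2 ⟨h, h'⟩)
    (weightedNorm_add_le _ _ _)⟩

theorem mul (hf : IsConvergent₂ f) (hg : IsConvergent₂ g) : IsConvergent₂ (f * g) := by
  obtain ⟨r, hr, h, h'⟩ := hf.exists_common hg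
  exact isConvergent₂_iff.2 ⟨r, hr, ne_top_of_le_ne_top (ENNReal.mul_ne_top h h')
    (weightedNorm_mul_le _ _ _)⟩

theorem monomial (m : Fin 2 →₀ ℕ) (z : ℂ) : IsConvergent₂ (MvPowerSeries.monomial m z) := by
  classical
  refine ⟨1, one_pos, summable_of_ne_finset_zero (s := {m}) fun k hk => ?_⟩
  rw [coeff_monomial, if_neg (by simpa using hk), norm_zero, zero_mul]

theorem const (z : ℂ) : IsConvergent₂ (MvPowerSeries.C z) := monomial 0 z

theorem var (i : Fin 2) : IsConvergent₂ (X i) := monomial (Finsupp.single i 1) 1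

theorem pow (hf : IsConvergent₂ f) (k : ℕ) : IsConvergent₂ (f ^ k) := by
  induction k with
  | zero => rw [pow_zero, ← map_one MvPowerSeries.C]; exact const 1
  | succ k ih => rw [pow_succ]; exact ih.mul hf

theorem natCast_mul (k : ℕ) (hf : IsConvergent₂ f) : IsConvergent₂ (k * f) := by
  rw [← map_natCast MvPowerSeries.C]
  exact (const _).mul hf

theorem sub (hf : IsConvergent₂ f) (hg : IsConvergent₂ g) : IsConvergent₂ (f - g) := by
  have : f - g = f + MvPowerSeries.C (-1) * g := by rw [map_neg, map_one]; ring
  rw [this]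
  exact hf.add ((const _).mul hg)

theorem sum {ι : Type*} (s : Finset ι) {F : ι → MvPowerSeries (Fin 2) ℂ}
    (h : ∀ i ∈ s, IsConvergent₂ (F i)) : IsConvergent₂ (∑ i ∈ s, F i) := by
  classical
  induction s using Finset.induction_on with
  | empty => rw [Finset.sum_empty, ← map_zero MvPowerSeries.C]; exact const 0
  | insert a s ha ih =>
    rw [Finset.sum_insert ha]
    exact (h a (Finset.mem_insert_self _ _)).add
      (ih fun i hi => h i (Finset.mem_insert_of_mem hi))

theorem pderiv (hf : IsConvergent₂ f) (i : Fin 2) : IsConvergent₂ (MvPowerSeries.pderiv ℂ i f) := by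
  obtain ⟨r, hr, h⟩ := hf
  refine ⟨r / 2, by positivity, ?_⟩
  -- `(k + 1) (r / 2) ^ k ≤ r ^ k`
  have hinj : Function.Injective fun m : Fin 2 →₀ ℕ => m + Finsupp.single i 1 :=
    add_left_injective _
  refine Summable.of_nonneg_of_le (fun m => by positivity) (fun m => ?_)
    ((h.comp_injective hinj).mul_left r⁻¹)
  have h1 : (m + Finsupp.single i 1 : Fin 2 →₀ ℕ) 0 +
      (m + Finsupp.single i 1 : Fin 2 →₀ ℕ) 1 = m 0 + m 1 + 1 := by
    fin_cases i <;> simp <;> ring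
  have h2 : ‖((m i : ℂ) + 1)‖ ≤ 2 ^ (m 0 + m 1) := by
    have h3 : ‖((m i : ℂ) + 1)‖ = ((m i + 1 : ℕ) : ℝ) := by
      rw [← Complex.norm_natCast]
      push_cast
      rfl
    have h4 : m i + 1 ≤ 2 ^ (m 0 + m 1) := by
      refine le_trans (Nat.lt_two_pow_self (n := m i)) (Nat.pow_le_pow_right (by norm_num) ?_)
      fin_cases i <;> simp
    rw [h3]
    exact_mod_cast h4
  simp only [Function.comp_apply, coeff_pderiv, norm_mul, h1]
  calc ‖coeff (m + Finsupp.single i 1) f‖ * ‖((m i : ℂ) + 1)‖ * (r / 2) ^ (m 0 + m 1)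
      ≤ ‖coeff (m + Finsupp.single i 1) f‖ * 2 ^ (m 0 + m 1) * (r / 2) ^ (m 0 + m 1) := by gcongr
    _ = _ := by
      rw [div_pow, pow_succ]
      field_simp

theorem of_X_pow_mul {M : ℕ} (h : IsConvergent₂ (X 0 ^ M * f)) : IsConvergent₂ f := by
  classical
  obtain ⟨r, hr, h⟩ := h
  refine ⟨r, hr, ?_⟩
  have hinj : Function.Injective fun m : Fin 2 →₀ ℕ => Finsupp.single 0 M + m :=
    add_right_injective _
  refine ((h.comp_injective hinj).mul_left (r ^ M)⁻¹).congr fun m => ?_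
  have h1 : coeff (Finsupp.single 0 M + m) (X 0 ^ M * f) = coeff m f := by
    rw [X_pow_eq, coeff_add_monomial_mul, one_mul]
  have h2 : (Finsupp.single 0 M + m : Fin 2 →₀ ℕ) 0 + (Finsupp.single 0 M + m : Fin 2 →₀ ℕ) 1 =
      M + (m 0 + m 1) := by
    simp
    ring
  simp only [Function.comp_apply, h1, h2]
  rw [pow_add]
  field_simp

end IsConvergent₂

theorem IsConvergent.of_finite {p : PowerSeries ℂ}
    (h : ∃ N, ∀ k, N ≤ k → PowerSeries.coeff k p = 0) :
    IsConvergent p := by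
  obtain ⟨N, hN⟩ := h
  refine ⟨1, one_pos, summable_of_ne_finset_zero (s := Finset.range N) fun k hk => ?_⟩
  rw [hN k (by simpa using hk), norm_zero, zero_mul]

theorem IsConvergent.expand {p : PowerSeries ℂ} (h : IsConvergent p) (q : ℕ) (hq : q ≠ 0) :
    IsConvergent (PowerSeries.expand q hq p) := by
  obtain ⟨r, hr, h⟩ := h
  refine ⟨min r 1, lt_min hr one_pos, ?_⟩
  have h0 : 0 ≤ min r 1 := (lt_min hr one_pos).le
  have hinj : Function.Injective fun k : ℕ => q * k := fun a b hab =>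
    Nat.eq_of_mul_eq_mul_left (Nat.pos_of_ne_zero hq) hab
  rw [← hinj.summable_iff]
  · refine Summable.of_nonneg_of_le (fun k => by simp only [Function.comp_apply]; positivity)
      (fun k => ?_) h
    simp only [Function.comp_apply, PowerSeries.coeff_expand_mul]
    gcongr
    calc (min r 1) ^ (q * k) ≤ (min r 1) ^ k :=
          pow_le_pow_of_le_one h0 (min_le_right _ _)
            (Nat.le_mul_of_pos_left k (Nat.pos_of_ne_zero hq))
      _ ≤ r ^ k := pow_le_pow_left₀ h0 (min_le_left _ _) k
  · intro k hk
    rw [PowerSeries.coeff_expand_of_not_dvd _ _ _ fun ⟨l, hl⟩ => hk ⟨l, hl.symm⟩, norm_zero,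
      zero_mul]

theorem IsConvergent.inclT {p : PowerSeries ℂ} (h : IsConvergent p) :
    IsConvergent₂ (inclT ℂ p) := by
  classical
  obtain ⟨r, hr, h⟩ := h
  refine ⟨r, hr, ?_⟩
  have hinj : Function.Injective fun k : ℕ => Finsupp.single (0 : Fin 2) k :=
    Finsupp.single_injective 0
  rw [← hinj.summable_iff]
  · refine h.congr fun k => ?_
    simp [inclT_apply, PowerSeries.coeff_subst_single]
  · intro m hm
    rw [inclT_apply, PowerSeries.coeff_subst_single, if_neg fun h => hm ⟨m 0, h.symm⟩, norm_zero,
      zero_mul]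

namespace PlaneBranch

variable (C : PlaneBranch)

theorem isConvergentPoly_semiroot {i : ℕ} (hi : i ≤ C.g) : IsConvergentPoly (C.semiroot i) := by
  intro l
  cases i with
  | zero =>
    refine IsConvergent.of_finite ⟨2, fun k hk => ?_⟩
    rw [semiroot, Polynomial.coeff_C]
    split_ifs
    · rw [PowerSeries.coeff_X, if_neg (by omega)]
    · rw [map_zero]
  | succ i => exact IsConvergent.of_finite (C.semiroot_coeff_finite (by omega) l)

theorem isConvergent₂_famEval (j : ℕ) (u : ℂ) {H : Polynomial (PowerSeries ℂ)}
    (hH : IsConvergentPoly H) :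
    IsConvergent₂ (C.famEval j (inclT ℂ) (MvPowerSeries.C u + X 1) H) := by
  have hhead : IsConvergent (C.head j) := IsConvergent.of_finite ⟨C.β j, fun k hk => by
    rw [coeff_head, if_neg]
    have := Nat.le_mul_of_pos_left k (C.e_pos j)
    omega⟩
  have hY : IsConvergent₂ (C.famY j (inclT ℂ) (MvPowerSeries.C u + X 1)) := by
    rw [famY, inclT_X]
    exact hhead.inclT.add (((IsConvergent₂.var 0).pow _).mul
      ((IsConvergent₂.const u).add (IsConvergent₂.var 1)))
  rw [famEval, Polynomial.eval₂_eq_sum_range]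
  refine IsConvergent₂.sum _ fun l _ => IsConvergent₂.mul ?_ (hY.pow l)
  rw [expandHom_apply]
  exact ((hH l).expand _ _).inclT

theorem isConvergent₂_pull_famMap {i j : ℕ} (hij : i < j) (hj : j ≤ C.g) (u : ℂ)
    {H₁ H₂ : Polynomial (PowerSeries ℂ)} (h₁ : IsConvergentPoly H₁) (h₂ : IsConvergentPoly H₂)
    (k : Fin 2) : IsConvergent₂
      ((toSeries H₁ • C.omega i j + differential (toSeries H₂)).pull (C.famMap j u) k) := by
  have hE := fun (H : Polynomial (PowerSeries ℂ)) (hH : IsConvergentPoly H) =>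
    C.isConvergent₂_famEval j u hH
  have hi := C.isConvergentPoly_semiroot (show i ≤ C.g by omega)
  have hj' := C.isConvergentPoly_semiroot hj
  rw [C.pull_omega H₁ H₂ (C.constantCoeff_famMap hj u)]
  simp only [C.subst_famMap hj]
  exact ((hE _ h₁).mul (((IsConvergent₂.natCast_mul _ (hE _ hi)).mul ((hE _ hj').pderiv k)).sub
    ((IsConvergent₂.natCast_mul _ (hE _ hj')).mul ((hE _ hi).pderiv k)))).add ((hE _ h₂).pderiv k)

end PlaneBranch

/-! ### Convergence of the formal solution -/

/-- The weighted `ℓ¹`-norm of the truncation of a power series below degree `K`. -/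
noncomputable def truncNorm (r : ℝ≥0∞) (K : ℕ) (p : PowerSeries ℂ) : ℝ≥0∞ :=
  ∑ k ∈ Finset.range K, ‖PowerSeries.coeff k p‖ₑ * r ^ k

section TruncNorm

variable (r : ℝ≥0∞) (K : ℕ) (p q : PowerSeries ℂ)

theorem truncNorm_add_le : truncNorm r K (p + q) ≤ truncNorm r K p + truncNorm r K q := by
  rw [truncNorm, truncNorm, truncNorm, ← Finset.sum_add_distrib]
  refine Finset.sum_le_sum fun k _ => ?_
  rw [← add_mul, map_add]
  gcongr
  exact enorm_add_le _ _

theorem truncNorm_C_mul (z : ℂ) :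
    truncNorm r K (PowerSeries.C z * p) = ‖z‖ₑ * truncNorm r K p := by
  rw [truncNorm, truncNorm, Finset.mul_sum]
  refine Finset.sum_congr rfl fun k _ => ?_
  rw [PowerSeries.coeff_C_mul, enorm_mul, mul_assoc]

theorem truncNorm_mul_le : truncNorm r K (p * q) ≤ truncNorm r K p * truncNorm r K q := by
  set F : ℕ → ℝ≥0∞ := fun k => ‖PowerSeries.coeff k p‖ₑ * r ^ k with hF
  set G : ℕ → ℝ≥0∞ := fun k => ‖PowerSeries.coeff k q‖ₑ * r ^ k with hG
  have h1 : ∀ k, ‖PowerSeries.coeff k (p * q)‖ₑ * r ^ k ≤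
      ∑ x ∈ Finset.HasAntidiagonal.antidiagonal k, F x.1 * G x.2 := fun k => by
    rw [PowerSeries.coeff_mul]
    calc ‖∑ x ∈ Finset.HasAntidiagonal.antidiagonal k,
          PowerSeries.coeff x.1 p * PowerSeries.coeff x.2 q‖ₑ * r ^ k
        ≤ (∑ x ∈ Finset.HasAntidiagonal.antidiagonal k,
          ‖PowerSeries.coeff x.1 p * PowerSeries.coeff x.2 q‖ₑ) * r ^ k := by
          gcongr
          exact enorm_sum_le _ _
      _ = ∑ x ∈ Finset.HasAntidiagonal.antidiagonal k, F x.1 * G x.2 := by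
          rw [Finset.sum_mul]
          refine Finset.sum_congr rfl fun x hx => ?_
          rw [← Finset.HasAntidiagonal.mem_antidiagonal.1 hx, enorm_mul, pow_add]
          ring
  calc truncNorm r K (p * q)
      ≤ ∑ k ∈ Finset.range K, ∑ x ∈ Finset.HasAntidiagonal.antidiagonal k, F x.1 * G x.2 :=
        Finset.sum_le_sum fun k _ => h1 k
    _ ≤ ∑ k ∈ Finset.range K, ∑ x ∈ Finset.range K ×ˢ Finset.range K,
          if x.1 + x.2 = k then F x.1 * G x.2 else 0 := by
        refine Finset.sum_le_sum fun k hk => ?_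
        rw [← Finset.sum_filter]
        refine Finset.sum_le_sum_of_subset fun x hx => ?_
        have h2 := Finset.HasAntidiagonal.mem_antidiagonal.1 hx
        have h3 := Finset.mem_range.1 hk
        rw [Finset.mem_filter, Finset.mem_product, Finset.mem_range, Finset.mem_range]
        omega
    _ ≤ ∑ x ∈ Finset.range K ×ˢ Finset.range K, F x.1 * G x.2 := by
        rw [Finset.sum_comm]
        refine Finset.sum_le_sum fun x _ => ?_
        rw [Finset.sum_ite_eq]
        split_ifs
        · exact le_rfl
        · exact zero_le
    _ = truncNorm r K p * truncNorm r K q := by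
        rw [truncNorm, truncNorm, Finset.sum_mul_sum, Finset.sum_product]

theorem truncNorm_one_le : truncNorm r K 1 ≤ 1 := by
  cases K with
  | zero => simp [truncNorm]
  | succ K =>
    rw [truncNorm, Finset.sum_range_succ']
    simp [PowerSeries.coeff_one]

theorem truncNorm_X_mul : truncNorm r (K + 1) (PowerSeries.X * p) = r * truncNorm r K p := by
  rw [truncNorm, truncNorm, Finset.sum_range_succ', Finset.mul_sum, PowerSeries.coeff_zero_X_mul,
    enorm_zero, zero_mul, add_zero]
  refine Finset.sum_congr rfl fun k _ => ?_
  rw [PowerSeries.coeff_succ_X_mul]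
  ring

theorem truncNorm_X_le : truncNorm r K PowerSeries.X ≤ r := by
  cases K with
  | zero => simp [truncNorm]
  | succ K =>
    rw [← mul_one PowerSeries.X, truncNorm_X_mul]
    exact mul_le_of_le_one_right' (truncNorm_one_le r K)

theorem truncNorm_pow_le (n : ℕ) : truncNorm r K (p ^ n) ≤ truncNorm r K p ^ n := by
  induction n with
  | zero => rw [pow_zero, pow_zero]; exact truncNorm_one_le r K
  | succ n ih =>
    rw [pow_succ, pow_succ]
    exact (truncNorm_mul_le r K _ _).trans (by gcongr)

variable {p} in
theorem truncNorm_succ_mul_le (hp : PowerSeries.constantCoeff p = 0) :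
    truncNorm r (K + 1) (p * q) ≤ truncNorm r (K + 1) p * truncNorm r K q := by
  obtain ⟨s, rfl⟩ := PowerSeries.X_dvd_iff.2 hp
  rw [mul_assoc, truncNorm_X_mul, truncNorm_X_mul, mul_assoc]
  gcongr
  exact truncNorm_mul_le r K s q

variable {p} in
theorem truncNorm_succ_le_derivative (hp : PowerSeries.constantCoeff p = 0) :
    truncNorm r (K + 1) p ≤ r * truncNorm r K (PowerSeries.derivative ℂ p) := by
  rw [truncNorm, truncNorm, Finset.sum_range_succ', Finset.mul_sum,
    PowerSeries.coeff_zero_eq_constantCoeff_apply, hp, enorm_zero, zero_mul, add_zero]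
  refine Finset.sum_le_sum fun k _ => ?_
  rw [PowerSeries.coeff_derivative, enorm_mul]
  have h1 : (1 : ℝ≥0∞) ≤ ‖((k : ℂ) + 1)‖ₑ := by
    have h2 : ‖((k : ℂ) + 1)‖ = ((k + 1 : ℕ) : ℝ) := by
      rw [← Complex.norm_natCast]
      push_cast
      rfl
    rw [← ofReal_norm, h2, ENNReal.one_le_ofReal]
    exact_mod_cast Nat.succ_pos k
  calc ‖PowerSeries.coeff (k + 1) p‖ₑ * r ^ (k + 1)
      = r * (‖PowerSeries.coeff (k + 1) p‖ₑ * 1 * r ^ k) := by ring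
    _ ≤ _ := by gcongr

variable {p r K} in
/-- If `|p|_r ≤ ρ` for the truncated norm and `r ≤ ρ`, then `|f(T, p(T))|_r ≤ |f|_ρ`. -/
theorem truncNorm_subst_graphArc_le (hp : PowerSeries.constantCoeff p = 0) {ρ : ℝ≥0∞} (hr : r ≤ ρ)
    (hK : truncNorm r K p ≤ ρ) (f : MvPowerSeries (Fin 2) ℂ) :
    truncNorm r K (subst (graphArc p) f) ≤ weightedNorm ρ f := by
  have hs := hasSubst_of_constantCoeff_zero (constantCoeff_graphArc hp)
  set P : (Fin 2 →₀ ℕ) → PowerSeries ℂ := fun m => PowerSeries.X ^ m 0 * p ^ m 1 with hP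
  have hcoeff : ∀ k, ‖PowerSeries.coeff k (subst (graphArc p) f : PowerSeries ℂ)‖ₑ ≤
      ∑' m, ‖coeff m f‖ₑ * ‖PowerSeries.coeff k (P m)‖ₑ := fun k => by
    have h1 : PowerSeries.coeff k (subst (graphArc p) f : PowerSeries ℂ) =
        ∑ᶠ m, coeff m f • PowerSeries.coeff k (P m) := by
      refine (coeff_subst hs f (Finsupp.single () k)).trans (finsum_congr fun m => ?_)
      rw [Finsupp.prod_fintype _ _ (fun _ => pow_zero _), Fin.prod_univ_two]
      rfl
    have h2 : (Function.support fun m => coeff m f • PowerSeries.coeff k (P m)).Finite := by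
      refine (coeff_subst_finite hs f (Finsupp.single () k)).subset fun m hm => ?_
      rw [Function.mem_support] at hm ⊢
      rw [Finsupp.prod_fintype _ _ (fun _ => pow_zero _), Fin.prod_univ_two]
      exact hm
    rw [h1, ← tsum_eq_finsum (L := .unconditional _) h2]
    refine enorm_tsum_le_tsum_enorm.trans (le_of_eq (tsum_congr fun m => ?_))
    rw [smul_eq_mul, enorm_mul]
  calc truncNorm r K (subst (graphArc p) f)
      ≤ ∑ k ∈ Finset.range K, (∑' m, ‖coeff m f‖ₑ * ‖PowerSeries.coeff k (P m)‖ₑ) * r ^ k :=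
        Finset.sum_le_sum fun k _ => by
          gcongr
          exact hcoeff k
    _ = ∑' m, ‖coeff m f‖ₑ * truncNorm r K (P m) := by
        simp only [← ENNReal.tsum_mul_right]
        rw [← Summable.tsum_finsetSum fun _ _ => ENNReal.summable]
        refine tsum_congr fun m => ?_
        rw [truncNorm, Finset.mul_sum]
        refine Finset.sum_congr rfl fun k _ => by rw [mul_assoc]
    _ ≤ weightedNorm ρ f := by
        refine ENNReal.tsum_le_tsum fun m => ?_
        gcongr
        calc truncNorm r K (P m)
            ≤ truncNorm r K (PowerSeries.X ^ m 0) * truncNorm r K (p ^ m 1) :=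
              truncNorm_mul_le _ _ _ _
          _ ≤ truncNorm r K PowerSeries.X ^ m 0 * truncNorm r K p ^ m 1 := by
              gcongr <;> exact truncNorm_pow_le _ _ _ _
          _ ≤ ρ ^ m 0 * ρ ^ m 1 := by
              gcongr
              exact (truncNorm_X_le r K).trans hr
          _ = ρ ^ (m 0 + m 1) := (pow_add _ _ _).symm

end TruncNorm

theorem isConvergent_of_truncNorm_le {p : PowerSeries ℂ} {r ρ : ℝ≥0} (hr : 0 < r)
    (h : ∀ K, truncNorm r K p ≤ ρ) : IsConvergent p := by
  refine ⟨r, hr, ?_⟩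
  have h1 : ∑' k, ((‖PowerSeries.coeff k p‖₊ * r ^ k : ℝ≥0) : ℝ≥0∞) ≠ ∞ := by
    refine ne_top_of_le_ne_top (ENNReal.coe_ne_top (r := ρ)) ?_
    rw [ENNReal.tsum_eq_iSup_nat]
    refine iSup_le fun K => le_trans (le_of_eq ?_) (h K)
    refine Finset.sum_congr rfl fun k _ => ?_
    rw [ENNReal.coe_mul, ENNReal.coe_pow]
    rfl
  rw [ENNReal.tsum_coe_ne_top_iff_summable, ← NNReal.summable_coe] at h1
  simpa using h1

/-- Formal solutions of the differential equation `A(T, z) + B(T, z) z' = 0`, `B(0, 0) ≠ 0`,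
converge. In `B(0,0) z' = -A(T, z) - (B - B(0,0))(T, z) z'` the coefficient of `z'` on the right is
small on a small disc, so that the truncations of `z'` stay bounded. -/
theorem isConvergent_of_formal_solution {A B : MvPowerSeries (Fin 2) ℂ} (hA : IsConvergent₂ A)
    (hB : IsConvergent₂ B) (hB0 : constantCoeff B ≠ 0) {z : PowerSeries ℂ}
    (hz : PowerSeries.constantCoeff z = 0)
    (h : (subst (graphArc z) A + subst (graphArc z) B * PowerSeries.derivative ℂ z :
      PowerSeries ℂ) = 0) : IsConvergent z := by
  have hs := hasSubst_of_constantCoeff_zero (constantCoeff_graphArc hz)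
  set b := constantCoeff B with hb
  set B' := B - MvPowerSeries.C b with hB'
  have hB'0 : constantCoeff B' = 0 := by rw [hB', map_sub, constantCoeff_C, sub_self]
  obtain ⟨ρ, hρ, hAρ, hBρ⟩ := hA.exists_common (hB.sub (IsConvergent₂.const b))
  obtain ⟨a, ha⟩ : ∃ a : ℝ≥0, (a : ℝ≥0∞) = weightedNorm ρ A := ⟨_, ENNReal.coe_toNNReal hAρ⟩
  obtain ⟨w, hw⟩ : ∃ w : ℝ≥0, (w : ℝ≥0∞) = weightedNorm ρ B' := ⟨_, ENNReal.coe_toNNReal hBρ⟩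
  set β : ℝ≥0 := ‖b‖₊ with hβ
  have hβ0 : 0 < β := nnnorm_pos.2 hB0
  set t : ℝ≥0 := min 1 (β / 2 / (w + 1)) with ht
  have ht0 : 0 < t := lt_min one_pos (by positivity)
  have htw : t * w ≤ β / 2 := by
    calc t * w ≤ β / 2 / (w + 1) * (w + 1) := by
          gcongr
          · exact min_le_right _ _
          · exact le_self_add
      _ = β / 2 := div_mul_cancel₀ _ (by positivity)
  set D : ℝ≥0 := 2 * a / β + 1 with hD
  have haD : a ≤ β / 2 * D := by
    have : β / 2 * D = a + β / 2 := by
      rw [hD]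
      field_simp
    rw [this]
    exact le_self_add
  have hD1 : 1 ≤ D := le_add_self
  set r : ℝ≥0 := t * ρ / D with hr
  have hr0 : 0 < r := by positivity
  have hrD : r * D = t * ρ := div_mul_cancel₀ _ (by positivity)
  have hrρ : r ≤ t * ρ := by
    rw [← hrD]
    exact le_mul_of_one_le_right' hD1
  set q := PowerSeries.derivative ℂ z with hq
  have heq : PowerSeries.C b * q = PowerSeries.C (-1) * (subst (graphArc z) A : PowerSeries ℂ) +
      PowerSeries.C (-1) * ((subst (graphArc z) B' : PowerSeries ℂ) * q) := by
    have h1 : (subst (graphArc z) B : PowerSeries ℂ) =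
        PowerSeries.C b + (subst (graphArc z) B' : PowerSeries ℂ) := by
      have h2 : B = MvPowerSeries.C b + B' := by rw [hB']; ring
      conv_lhs => rw [h2]
      rw [subst_add hs, subst_C]
      rfl
    rw [h1] at h
    rw [map_neg, map_one]
    linear_combination h
  have hA' : weightedNorm ((t * ρ : ℝ≥0) : ℝ≥0∞) A ≤ a := by
    rw [ha]
    refine weightedNorm_mono ?_ A
    exact_mod_cast mul_le_of_le_one_left' (min_le_left _ _)
  have hB'' : weightedNorm ((t * ρ : ℝ≥0) : ℝ≥0∞) B' ≤ ((β / 2 : ℝ≥0) : ℝ≥0∞) := by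
    rw [ENNReal.coe_mul]
    refine (weightedNorm_mul_radius_le (by exact_mod_cast min_le_left _ _) _ hB'0).trans ?_
    rw [← hw]
    exact_mod_cast htw
  have hneg : ‖(-1 : ℂ)‖ₑ = 1 := by simp
  have hzq : ∀ K, truncNorm r K q ≤ D → truncNorm r (K + 1) z ≤ ((t * ρ : ℝ≥0) : ℝ≥0∞) :=
    fun K hK => by
      refine (truncNorm_succ_le_derivative _ K hz).trans ?_
      rw [← hrD, ENNReal.coe_mul]
      gcongr
  have key : ∀ K, truncNorm r K q ≤ D := fun K => by
    induction K with
    | zero => simp [truncNorm]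
    | succ K ih =>
      have hrρ' : (r : ℝ≥0∞) ≤ ((t * ρ : ℝ≥0) : ℝ≥0∞) := by exact_mod_cast hrρ
      have hzK := hzq K ih
      have h1 : (β : ℝ≥0∞) * truncNorm r (K + 1) q ≤ β * D := by
        calc (β : ℝ≥0∞) * truncNorm r (K + 1) q = truncNorm r (K + 1) (PowerSeries.C b * q) :=
              (truncNorm_C_mul _ _ _ b).symm
          _ ≤ truncNorm r (K + 1) (subst (graphArc z) A) +
                truncNorm r (K + 1) ((subst (graphArc z) B' : PowerSeries ℂ) * q) := by
              rw [heq]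
              refine (truncNorm_add_le _ _ _ _).trans ?_
              rw [truncNorm_C_mul, truncNorm_C_mul, hneg, one_mul, one_mul]
          _ ≤ a + truncNorm r (K + 1) (subst (graphArc z) B') * truncNorm r K q := by
              gcongr
              · exact (truncNorm_subst_graphArc_le hz hrρ' hzK A).trans hA'
              · refine truncNorm_succ_mul_le _ K q ?_
                exact (constantCoeff_subst_of_constantCoeff_zero (constantCoeff_graphArc hz)
                  B').trans hB'0
          _ ≤ a + ((β / 2 : ℝ≥0) : ℝ≥0∞) * D := by
              gcongr
              exact (truncNorm_subst_graphArc_le hz hrρ' hzK B').trans hB''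
          _ ≤ β * D := by
              have : a + β / 2 * D ≤ β * D := by
                calc a + β / 2 * D ≤ β / 2 * D + β / 2 * D := by gcongr
                  _ = β * D := by rw [← add_mul, add_halves]
              exact_mod_cast this
      exact (ENNReal.mul_le_mul_iff_right (by exact_mod_cast hβ0.ne') ENNReal.coe_ne_top).1 h1
  refine isConvergent_of_truncNorm_le (ρ := t * ρ) hr0 fun K => ?_
  cases K with
  | zero => simp [truncNorm]
  | succ K => exact hzq K (key K)

end

section

namespace PlaneBranch

variable (C : PlaneBranch)

/-- The formal separatrices converge. -/
theorem exists_separatrices {i j : ℕ} (hij : i < j) (hj : j ≤ C.g)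
    {H₁ H₂ : Polynomial (PowerSeries ℂ)} (hc₁ : IsConvergentPoly H₁) (hc₂ : IsConvergentPoly H₂)
    (hd₁ : H₁.degree < (C.n / C.e j : ℕ)) (hd₂ : H₂.degree < (C.n / C.e j : ℕ)) (hH₁ : H₁ ≠ 0)
    (hlt : C.inter H₁ + C.v i + C.v j < C.inter H₂) :
    ∃ s : ℕ → RatFunc ℂ, ∀ u : ℂ, u ≠ 0 → (∀ l, (s l).denom.eval u ≠ 0) ∧
      (toSeries H₁ • C.omega i j + differential (toSeries H₂)).IsSeparatrix
        (PowerSeries.X ^ (C.n / C.e j)) (C.sepFamily j s u) := by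
  obtain ⟨M, hM⟩ := C.pull_famMap_of_lt hij hj hd₁ hd₂ hH₁ hlt
  obtain ⟨s, hs⟩ := C.exists_formal_separatrices hj hM
  refine ⟨s, fun u hu => ?_⟩
  obtain ⟨hden, hpull, z, hz, hsep⟩ := hs u hu
  obtain ⟨G, hG, h⟩ := hM ℂ u (IsUnit.mk0 u hu)
  have hconv : ∀ k, IsConvergent₂ (G k) := fun k =>
    IsConvergent₂.of_X_pow_mul (M := M) (h k ▸ C.isConvergent₂_pull_famMap hij hj u hc₁ hc₂ k)
  have harc : (fun l => MvPowerSeries.subst (graphArc z) (C.famMap j u l)) =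
      ![(PowerSeries.X ^ (C.n / C.e j) : PowerSeries ℂ), C.sepFamily j s u] := by
    funext l
    fin_cases l
    · exact C.subst_graphArc_famMap_zero j u hz
    · refine (C.subst_graphArc_famMap_one j u hz).trans ?_
      rw [hsep, Algebra.algebraMap_self, PowerSeries.map_id]
      rfl
  have hode := C.pull_subst_graphArc hj hz h
  rw [harc, ← OneForm.pullArc_eq_pull, hpull] at hode
  have hode' := (mul_eq_zero.1 hode.symm).resolve_left (pow_ne_zero M PowerSeries.X_ne_zero)
  obtain ⟨r, hr, hzr⟩ := isConvergent_of_formal_solution (hconv 0) (hconv 1) hG.ne_zero hz hode'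
  have hhead : PowerSeries.constantCoeff (C.head j) = 0 := C.constantCoeff_head j
  have hb := C.β_div_ne_zero hj
  refine ⟨hden, IsConvergent.of_finite ⟨C.n / C.e j + 1, fun k hk => ?_⟩, ?_, ?_, ?_,
    Or.inl (pow_ne_zero _ PowerSeries.X_ne_zero), hpull⟩
  · rw [PowerSeries.coeff_X_pow, if_neg (by omega)]
  · -- Beyond the degree `b = β_j / e_j` the coefficients are those of `T ^ b z`.
    refine ⟨r, hr, (summable_nat_add_iff (C.β j / C.e j + 1)).1 ?_⟩
    refine (((summable_nat_add_iff 1).2 hzr).mul_left (r ^ (C.β j / C.e j))).congr fun k => ?_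
    have h1 : PowerSeries.coeff (k + (C.β j / C.e j + 1)) (C.sepFamily j s u) =
        PowerSeries.coeff (k + 1) z := by
      rw [hsep, map_add, PowerSeries.coeff_X_pow_mul', if_pos (by omega), coeff_head, if_neg,
        zero_add, map_add, PowerSeries.coeff_C, if_neg (by omega), zero_add]
      · rw [← add_assoc, Nat.add_right_comm, Nat.add_sub_cancel]
      · refine not_lt.2 ((C.e_mul_β_div (le_refl j)).ge.trans (Nat.mul_le_mul_left _ ?_))
        exact le_add_left (Nat.le_succ _)
    rw [h1]
    ring
  · rw [map_pow, PowerSeries.constantCoeff_X, zero_pow (C.n_div_e_ne_zero j)]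
  · rw [hsep, map_add, hhead, map_mul, map_pow, PowerSeries.constantCoeff_X, zero_pow hb, zero_mul,
      add_zero]

end PlaneBranch

end

theorem corollary3p3 (C : PlaneBranch) (i j : ℕ) (hij : i < j) (hj : j ≤ C.g)
    (H₁ H₂ : Polynomial (PowerSeries ℂ)) (hc₁ : IsConvergentPoly H₁) (hc₂ : IsConvergentPoly H₂)
    (hd₁ : H₁.degree < (C.n / C.e j : ℕ)) (hd₂ : H₂.degree < (C.n / C.e j : ℕ))
    (hH₁ : H₁ ≠ 0) (hH₂ : PowerSeries.constantCoeff (H₂.coeff 0) = 0)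
    (ω : OneForm) (hω : ω = toSeries H₁ • C.omega i j + differential (toSeries H₂))
    (hfol : ω.DefinesSingularFoliation) :
    (C.IsDicriticalAt ω (C.triplePoint j) ↔ C.inter H₁ + C.v i + C.v j < C.inter H₂) ∧
    (C.inter H₁ + C.v i + C.v j < C.inter H₂ →
      ∃ s : ℕ → RatFunc ℂ, ∀ u : ℂ, u ≠ 0 →
        (∀ l, (s l).denom.eval u ≠ 0) ∧
        ω.IsSeparatrix (PowerSeries.X ^ (C.n / C.e j)) (C.sepFamily j s u)) := by
  subst hω
  exact ⟨C.isDicriticalAt_triplePoint_iff hij hj hd₁ hd₂ hH₁ hH₂,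
    C.exists_separatrices hij hj hc₁ hc₂ hd₁ hd₂ hH₁⟩
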